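/- Let $a,b,c\ge 0$ and $d\ge 1$ be integers with $a+b+c=d$, and let $C$ be the normalization of the complex projective plane curve $$y^d=x^a(x-z)^bz^c ,$$ that is, the (possibly disconnected) smooth projective curve of this cyclic Belyi cover $(x:y:z)\mapsto (x:z)$ of $\mathbb P^1$, which is unramified outside of $x/z=0,1,\infty$. Let $T:C\to C$ be the deck transformation induced by $(x,y,z)\mapsto (x,e^{2\pi i/d}y,z)$. Write $[\cdot]$ for the integer part. 1. The space $H^0(C,\Omega^1_C)$ of holomorphic 1-forms is finite-dimensional. Let $j\in\mathbb Z$ and let $m_j$ be the multiplicity of $e^{2\pi i j/d}$ as a root of the characteristic polynomial of the action of $T$ on $H^0(C,\Omega^1_C)$ by pull-back. If $d$ does not divide both $aj$ and $bj$, then $$m_j=-\left(\left[-\frac{aj}{d}\right]+\left[-\frac{bj}{d}\right]+\left[\frac{(a+b)j}{d}\right]+1\right);$$ if $d$ divides both $aj$ and $bj$, then $m_j=0$. In particular $m_j$ is always $0$ or $1$. 2. If $\gcd(a,b,c,d)=1$ (the irreducible case), then $H_1(C,\mathbb C)$ is finite-dimensional and the characteristic polynomial of the map induced by $T$ on it is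 $$\Delta(t)=\frac{(t^d-1)(t-1)^2}{(t^{\gcd(a,d)}-1)(t^{\gcd(b,d)}-1)(t^{\gcd(c,d)}-1)} .$$ -/

import Mathlib

open scoped KaehlerDifferential

noncomputable section

namespace BelyiCover

/-! ### The smooth complete curve attached to a ring of rational functions

`K` is the ring of rational functions of a (possibly reducible) reduced complex curve, i.e. a finite
product of function fields in one variable over `ℂ`.  The points of the normalization of the
projective curve are the `ℂ`-valued places of `K`; a point is recorded as the map that sends a
rational function to its value in `ℂ ∪ {∞}` at that point. -/

section Curve

variable (K : Type) [CommRing K] [Algebra ℂ K]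

/-- A `ℂ`-valued place of `K`: an evaluation `f ↦ f(P) ∈ ℂ ∪ {∞}` which is a homomorphism of
`ℂ`-algebras on the functions with a finite value, and such that for every `f` with a pole at `P`
there is a `g` with `g(P) = 0` and `(f g)(P) = 1`. -/
@[ext]
structure Place where
  /-- the value of a rational function at the point -/
  val : K → OnePoint ℂ
  val_algebraMap : ∀ r : ℂ, val (algebraMap ℂ K r) = (r : OnePoint ℂ)
  val_add : ∀ (f g : K) (u v : ℂ), val f = (u : OnePoint ℂ) → val g = (v : OnePoint ℂ) →
    val (f + g) = ((u + v : ℂ) : OnePoint ℂ)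
  val_mul : ∀ (f g : K) (u v : ℂ), val f = (u : OnePoint ℂ) → val g = (v : OnePoint ℂ) →
    val (f * g) = ((u * v : ℂ) : OnePoint ℂ)
  exists_of_pole : ∀ f : K, val f = OnePoint.infty →
    ∃ g : K, val g = ((0 : ℂ) : OnePoint ℂ) ∧ val (f * g) = ((1 : ℂ) : OnePoint ℂ)

/-- The classical topology on the curve: the coarsest one for which every rational function is a
continuous map to the Riemann sphere `OnePoint ℂ`. -/
instance : TopologicalSpace (Place K) := TopologicalSpace.induced Place.val Pi.topologicalSpace

variable {K}

/-- The ring of rational functions that are regular at the point `P`. -/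
def Place.ring (P : Place K) : Subalgebra ℂ K where
  carrier := {f | ∃ u : ℂ, P.val f = (u : OnePoint ℂ)}
  mul_mem' := by
    rintro f g ⟨u, hu⟩ ⟨v, hv⟩
    exact ⟨_, P.val_mul f g u v hu hv⟩
  add_mem' := by
    rintro f g ⟨u, hu⟩ ⟨v, hv⟩
    exact ⟨_, P.val_add f g u v hu hv⟩
  algebraMap_mem' := fun r => ⟨r, P.val_algebraMap r⟩

/-- The map induced on points by an automorphism `σ` of the ring of rational functions:
the value of `f` at the image of `P` is the value of `σ f` at `P`. -/
def Place.map (σ : K ≃ₐ[ℂ] K) (P : Place K) : Place K where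
  val f := P.val (σ f)
  val_algebraMap r := by rw [AlgEquiv.commutes]; exact P.val_algebraMap r
  val_add f g u v hf hg := by rw [map_add]; exact P.val_add _ _ u v hf hg
  val_mul f g u v hf hg := by rw [map_mul]; exact P.val_mul _ _ u v hf hg
  exists_of_pole f hf := by
    obtain ⟨g, hg, hfg⟩ := P.exists_of_pole (σ f) hf
    exact ⟨σ.symm g, by simpa using hg, by simpa using hfg⟩

theorem Place.continuous_map (σ : K ≃ₐ[ℂ] K) : Continuous (Place.map σ : Place K → Place K) := by
  refine continuous_induced_rng.2 (continuous_pi fun f => ?_)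
  exact (continuous_apply (σ f)).comp continuous_induced_dom

variable (K)

/-- The holomorphic 1-forms on the curve, `H⁰(C, Ω¹)`: the rational differentials that are regular
at every point `P`, i.e. lie in the module of differentials of the local ring at `P`. -/
def holomorphicForms : Submodule ℂ Ω[K⁄ℂ] :=
  ⨅ P : Place K, (Submodule.span P.ring
    ((KaehlerDifferential.D ℂ K) '' (P.ring : Set K))).restrictScalars ℂ

variable {K}

/-- Pull-back of rational differentials, `f dg ↦ σ(f) dσ(g)`. -/
def pullback (σ : K ≃ₐ[ℂ] K) : Ω[K⁄ℂ] →ₗ[ℂ] Ω[K⁄ℂ] :=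
  Ideal.mapCotangent (KaehlerDifferential.ideal ℂ K) (KaehlerDifferential.ideal ℂ K)
    (Algebra.TensorProduct.map (σ : K →ₐ[ℂ] K) (σ : K →ₐ[ℂ] K)) (by
      intro x hx
      have key : ∀ x, Algebra.TensorProduct.lmul' ℂ (S := K)
          (Algebra.TensorProduct.map (σ : K →ₐ[ℂ] K) (σ : K →ₐ[ℂ] K) x) =
          σ (Algebra.TensorProduct.lmul' ℂ (S := K) x) := by
        intro x
        induction x with
        | zero => simp
        | tmul a b => simp
        | add a b ha hb => simp only [map_add, ha, hb]
      simp only [KaehlerDifferential.ideal, Ideal.mem_comap, RingHom.mem_ker] at hx ⊢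
      exact (key x).trans ((congrArg σ hx).trans (map_zero σ)))

theorem pullback_D (σ : K ≃ₐ[ℂ] K) (g : K) :
    pullback σ (KaehlerDifferential.D ℂ K g) = KaehlerDifferential.D ℂ K (σ g) := by
  rw [KaehlerDifferential.D_apply, KaehlerDifferential.D_apply]
  refine (Ideal.mapCotangent_toCotangent _ _ _ _ _).trans ?_
  congr 1
  ext
  simp

theorem pullback_smul (σ : K ≃ₐ[ℂ] K) (f : K) (ω : Ω[K⁄ℂ]) :
    pullback σ (f • ω) = σ f • pullback σ ω := by
  obtain ⟨x, rfl⟩ := (KaehlerDifferential.ideal ℂ K).toCotangent_surjective ω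
  have h : ∀ (k : K) (y : KaehlerDifferential.ideal ℂ K),
      (k • (KaehlerDifferential.ideal ℂ K).toCotangent y : Ω[K⁄ℂ]) =
      (KaehlerDifferential.ideal ℂ K).toCotangent
        (algebraMap K (TensorProduct ℂ K K) k • y) := by
    intro k y
    rw [map_smul]
    exact (algebraMap_smul (TensorProduct ℂ K K) k
      ((KaehlerDifferential.ideal ℂ K).toCotangent y)).symm
  refine (congrArg (pullback σ) (h f x)).trans ?_
  refine (Ideal.mapCotangent_toCotangent _ _ _ _ _).trans ?_
  refine Eq.trans ?_ (h (σ f) _).symm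
  congr 1
  ext
  simp
  rfl

theorem pullback_mem (σ : K ≃ₐ[ℂ] K) {ω : Ω[K⁄ℂ]} (hω : ω ∈ holomorphicForms K) :
    pullback σ ω ∈ holomorphicForms K := by
  simp only [holomorphicForms, Submodule.mem_iInf, Submodule.restrictScalars_mem] at hω ⊢
  intro P
  refine Submodule.span_induction ?_ ?_ ?_ ?_ (hω (P.map σ))
  · rintro _ ⟨g, hg, rfl⟩
    rw [pullback_D]
    exact Submodule.subset_span ⟨σ g, hg, rfl⟩
  · rw [map_zero]; exact Submodule.zero_mem _
  · intro x y _ _ hx hy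
    rw [map_add]; exact Submodule.add_mem _ hx hy
  · intro r x _ hx
    have : pullback σ (r • x) = (⟨σ r, r.2⟩ : P.ring) • pullback σ x := pullback_smul σ r x
    rw [this]
    exact Submodule.smul_mem _ _ hx

/-- The action of `σ` on the space of holomorphic 1-forms by pull-back. -/
def pullbackHolomorphic (σ : K ≃ₐ[ℂ] K) : Module.End ℂ (holomorphicForms K) :=
  (pullback σ).restrict fun _ => pullback_mem σ

variable (K)

/-- The first singular homology `H₁(C, ℂ)` of the curve with its classical topology. -/
abbrev H1 : ModuleCat ℂ :=
  ((AlgebraicTopology.singularHomologyFunctor (ModuleCat ℂ) 1).obj (ModuleCat.of ℂ ℂ)).obj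
    (TopCat.of (Place K))

variable {K}

/-- The map induced on `H₁(C, ℂ)`. -/
def homologyMap (σ : K ≃ₐ[ℂ] K) : Module.End ℂ (H1 K) :=
  (((AlgebraicTopology.singularHomologyFunctor (ModuleCat ℂ) 1).obj (ModuleCat.of ℂ ℂ)).map
    (TopCat.ofHom ⟨Place.map σ, Place.continuous_map σ⟩)).hom

end Curve

/-! ### The cyclic Belyi cover -/

/-- The equation of the plane curve `y ^ d = x ^ a (x - z) ^ b z ^ c`, where `a + b + c = d`, in the
affine chart `z = 1`, as a polynomial in `y` over `ℂ(x)`: `y ^ d - x ^ a (x - 1) ^ b`. -/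
def equation (a b d : ℕ) : Polynomial (RatFunc ℂ) :=
  Polynomial.X ^ d - Polynomial.C (RatFunc.X ^ a * (RatFunc.X - 1) ^ b)

/-- The ring of rational functions of the curve. -/
abbrev FunctionRing (a b d : ℕ) : Type := AdjoinRoot (equation a b d)

/-- `e ^ (2 π i / d)` -/
def omega (d : ℕ) : ℂ := Complex.exp (2 * Real.pi * Complex.I / d)

theorem omega_pow (d : ℕ) : omega d ^ d = 1 := by
  rcases Nat.eq_zero_or_pos d with rfl | hd
  · simp
  · rw [omega, ← Complex.exp_nat_mul, mul_div_cancel₀ _ (Nat.cast_ne_zero.2 hd.ne')]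
    exact Complex.exp_two_pi_mul_I

theorem omega_ne_zero (d : ℕ) : omega d ≠ 0 := Complex.exp_ne_zero _

/-- The `ℂ(x)`-algebra endomorphism `y ↦ ζ y`, for `ζ ^ d = 1`. -/
def scaleHom (a b d : ℕ) (ζ : ℂ) (h : ζ ^ d = 1) :
    FunctionRing a b d →ₐ[RatFunc ℂ] FunctionRing a b d :=
  AdjoinRoot.liftAlgHom (equation a b d) (Algebra.ofId _ _)
    (algebraMap ℂ (FunctionRing a b d) ζ * AdjoinRoot.root (equation a b d)) (by
      have h1 : (algebraMap ℂ (FunctionRing a b d) ζ) ^ d = 1 := by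
        rw [← map_pow, h, map_one]
      have h0 : AdjoinRoot.root (equation a b d) ^ d -
          AdjoinRoot.of (equation a b d) (RatFunc.X ^ a * (RatFunc.X - 1) ^ b) = 0 := by
        have := AdjoinRoot.eval₂_root (equation a b d)
        conv at this => lhs; arg 3; rw [equation]
        rwa [Polynomial.eval₂_sub, Polynomial.eval₂_X_pow, Polynomial.eval₂_C] at this
      conv_lhs => arg 3; rw [equation]
      rw [Polynomial.eval₂_sub, Polynomial.eval₂_X_pow, Polynomial.eval₂_C, mul_pow, h1, one_mul]
      exact h0)

theorem scaleHom_root (a b d : ℕ) (ζ : ℂ) (h : ζ ^ d = 1) :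
    scaleHom a b d ζ h (AdjoinRoot.root (equation a b d)) =
      algebraMap ℂ (FunctionRing a b d) ζ * AdjoinRoot.root (equation a b d) := by
  simp [scaleHom]

theorem scaleHom_comp (a b d : ℕ) (ζ ξ : ℂ) (h : ζ ^ d = 1) (h' : ξ ^ d = 1) (e : ξ * ζ = 1) :
    (scaleHom a b d ζ h).comp (scaleHom a b d ξ h') = AlgHom.id _ _ := by
  refine AdjoinRoot.algHom_ext ?_
  rw [AlgHom.comp_apply, scaleHom_root, map_mul, scaleHom_root, AlgHom.id_apply,
    IsScalarTower.algebraMap_apply ℂ (RatFunc ℂ) (FunctionRing a b d) ξ, AlgHom.commutes,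
    ← IsScalarTower.algebraMap_apply, ← mul_assoc, ← map_mul, e, map_one, one_mul]

/-- The automorphism `x ↦ x`, `y ↦ e ^ (2 π i / d) y` of the ring of rational functions. -/
def deck (a b d : ℕ) : FunctionRing a b d ≃ₐ[ℂ] FunctionRing a b d :=
  (AlgEquiv.ofAlgHom (scaleHom a b d (omega d) (omega_pow d))
    (scaleHom a b d (omega d)⁻¹ (by rw [inv_pow, omega_pow, inv_one]))
    (scaleHom_comp _ _ _ _ _ _ _ (inv_mul_cancel₀ (omega_ne_zero d)))
    (scaleHom_comp _ _ _ _ _ _ _ (mul_inv_cancel₀ (omega_ne_zero d)))).restrictScalars ℂ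

end BelyiCover

end

/-!
The curve is studied through the places of its function ring `K = ℂ(x)[y]`,
`y ^ d = x ^ a (x - 1) ^ b`, and through explicit parametrizations. Around each of the branch points
`0, 1, ∞` there is a coordinate `w` (one of `x`, `1 - x`, `x⁻¹`) for which the equation becomes
`y ^ d = κ w ^ A (1 - w) ^ B`, and with `g = gcd(A, d)`, `e = d / g`, `k = A / g` the part of the
curve where `w` avoids `[1, ∞]` is a union of `g` discs (the star `Cusp.nbhd`), parametrized by
`w = t ^ e`, `y = ξ t ^ k (1 - t ^ e) ^ (B / d)` with `ξ ^ d = κ` (`Cusp.star`). Every place is the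
limit of points of such a parametrization, since the deck transformations act transitively on the
places with a given value of `x` (`Place.exists_eq_map_deck_pow`).

*Holomorphic forms.* Since `T` has finite order, the multiplicity of an eigenvalue is the dimension
of its eigenspace (`rootMultiplicity_charpoly_of_pow_eq_one`). A form in the eigenspace of `ζ ^ j`
is `r(x) y ^ j x ^ m (1 - x) ^ n dx` with `m = [-aj/d]`, `n = [-bj/d]`. Its regularity over the
finite part of the line forces `r` to be a polynomial, and regularity at infinity forces
`deg r < m_j`, where `m_j` is the number `multiplicity` (`exists_polynomial_of_mem`); conversely
such forms are holomorphic (`coeffU_smul_D_mem`). As `m_j ≤ 1`, the eigenspace is zero or spanned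
by a single form.

*Homology.* The dual of `H₁` consists of singular cocycles modulo coboundaries (`Represents`). On a
star every cocycle has a primitive, by integration along rays (`Cusp.exists_primitive`). Two stars
meet in a union of `d` simply connected sheets over a plane with one or two slits, labelled by the
`d`-th roots of unity (`Cusp.label`), which `T` permutes cyclically; hence for an eigenclass with eigenvalue
`μ = ζ ^ j` the primitives can be chosen so as to differ by a constant multiple of the `j`-th power
of the label. This leaves three constants, one for each pair of stars. Comparing them over the upper
and the lower half plane, where the labels differ by the monodromy around `0` and `1`, gives two
linear relations (one is built into `HasData`, the other is `HasData.relation`), and conversely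
constants with these relations are realized, through the covering space that they define (`exists_hasData_of_relation`). So the gluing data
form a line, unless the coefficients of the relations degenerate. They are ambiguous by locally
constant eigenfunctions on a star, which exist exactly if `μ ^ g = 1`, since `T` permutes the `g`
discs of a star cyclically. It follows that the eigenspace has dimension one if `μ ^ a`, `μ ^ b`
and `μ ^ c` all differ from `1`, and is zero otherwise. The formula for the characteristic
polynomial is the comparison of the multiplicities of the roots on both sides, where
`gcd(a, b, c, d) = 1` enters through the fact that two of these powers can be trivial only for
`μ = 1`.
-/

open scoped KaehlerDifferential
noncomputable section
namespace BelyiCover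

/-! ### Cocycles on singular simplices and the dual of `H₁` -/

section Cohomology

open CategoryTheory AlgebraicTopology Simplicial

variable {X : Type} [TopologicalSpace X]

/-- The affine map of the standard 1-simplex onto the edge of the standard 2-simplex from the
vertex `i` to the vertex `j`. -/
def edge (i j : Fin 3) : C(stdSimplex ℝ (Fin 2), stdSimplex ℝ (Fin 3)) :=
  ⟨stdSimplex.map ![i, j], stdSimplex.continuous_map _⟩

/-- A function on singular 1-simplices which is a singular 1-cocycle. -/
def IsCocycle (φ : C(stdSimplex ℝ (Fin 2), X) → ℂ) : Prop :=
  ∀ σ : C(stdSimplex ℝ (Fin 3), X),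
    φ (σ.comp (edge 0 1)) + φ (σ.comp (edge 1 2)) = φ (σ.comp (edge 0 2))

/-- `φ` is the coboundary of the function `f`. -/
def IsCoboundary (φ : C(stdSimplex ℝ (Fin 2), X) → ℂ) (f : X → ℂ) : Prop :=
  ∀ γ : C(stdSimplex ℝ (Fin 2), X), φ γ = f (γ (stdSimplex.vertex 1)) - f (γ (stdSimplex.vertex 0))

variable (X) in
/-- The singular chain complex of `X` with complex coefficients. -/
abbrev chains : ChainComplex (ModuleCat ℂ) ℕ :=
  (TopCat.toSSet.obj (TopCat.of X)).chainComplex (ModuleCat.of ℂ ℂ)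

/-- A 1-simplex of the singular simplicial set as a continuous map. -/
def simplexOne (γ : (TopCat.toSSet.obj (TopCat.of X)) _⦋1⦌) : C(stdSimplex ℝ (Fin 2), X) :=
  TopCat.toSSetObjEquiv _ _ γ

/-- A 2-simplex of the singular simplicial set as a continuous map. -/
def simplexTwo (γ : (TopCat.toSSet.obj (TopCat.of X)) _⦋2⦌) : C(stdSimplex ℝ (Fin 3), X) :=
  TopCat.toSSetObjEquiv _ _ γ

/-- A 0-simplex of the singular simplicial set as a point. -/
def simplexZero (γ : (TopCat.toSSet.obj (TopCat.of X)) _⦋0⦌) : X :=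
  TopCat.toSSetObjEquiv _ _ γ (stdSimplex.vertex (S := ℝ) (X := Fin 1) 0)

theorem simplexTwo_delta (i : Fin 3) (j k : Fin 3) (h : ∀ l : Fin 2, i.succAbove l = ![j, k] l)
    (γ : (TopCat.toSSet.obj (TopCat.of X)) _⦋2⦌) :
    simplexOne ((TopCat.toSSet.obj (TopCat.of X)).δ i γ) = (simplexTwo γ).comp (edge j k) := by
  have : edge j k = ⟨stdSimplex.map (Fin.succAbove i), stdSimplex.continuous_map _⟩ := by
    unfold edge
    congr 2
    exact funext fun l => (h l).symm
  rw [this]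
  rfl

theorem simplexOne_delta (i : Fin 2) (j : Fin 2) (h : i.succAbove 0 = j)
    (γ : (TopCat.toSSet.obj (TopCat.of X)) _⦋1⦌) :
    simplexZero ((TopCat.toSSet.obj (TopCat.of X)).δ i γ) = simplexOne γ (stdSimplex.vertex j) := by
  have : simplexZero ((TopCat.toSSet.obj (TopCat.of X)).δ i γ) =
    simplexOne γ (stdSimplex.map (Fin.succAbove i) (stdSimplex.vertex (S := ℝ) (X := Fin 1) 0)) := rfl
  rw [this, stdSimplex.map_vertex, h]

/-- The 1-cochain with values `φ`, as a linear form on the singular 1-chains. -/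
def cochainHom (φ : C(stdSimplex ℝ (Fin 2), X) → ℂ) : (chains X).X 1 ⟶ ModuleCat.of ℂ ℂ :=
  Limits.Sigma.desc fun γ => ModuleCat.ofHom (φ (simplexOne γ) • LinearMap.id)

theorem ι_cochainHom (φ : C(stdSimplex ℝ (Fin 2), X) → ℂ)
    (γ : (TopCat.toSSet.obj (TopCat.of X)) _⦋1⦌) :
    SSet.ιChainComplex _ γ ≫ cochainHom φ = ModuleCat.ofHom (φ (simplexOne γ) • LinearMap.id) := by
  exact Limits.Sigma.ι_desc _ _

/-- The 0-cochain with values `f`, as a linear form on the singular 0-chains. -/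
def cochainHomZero (f : X → ℂ) : (chains X).X 0 ⟶ ModuleCat.of ℂ ℂ :=
  Limits.Sigma.desc fun γ => ModuleCat.ofHom (f (simplexZero γ) • LinearMap.id)

theorem ι_cochainHomZero (f : X → ℂ) (γ : (TopCat.toSSet.obj (TopCat.of X)) _⦋0⦌) :
    SSet.ιChainComplex _ γ ≫ cochainHomZero f = ModuleCat.ofHom (f (simplexZero γ) • LinearMap.id) := by
  exact Limits.Sigma.ι_desc _ _

/-- The function `φ` on 1-simplices represents the linear form `θ` on `H₁(X, ℂ)`: they agree on
cycles. -/
def Represents (φ : C(stdSimplex ℝ (Fin 2), X) → ℂ) (θ : (chains X).homology 1 ⟶ ModuleCat.of ℂ ℂ) : Prop :=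
  (chains X).homologyπ 1 ≫ θ = (chains X).iCycles 1 ≫ cochainHom φ

theorem cochainHom_add (φ ψ : C(stdSimplex ℝ (Fin 2), X) → ℂ) :
    cochainHom (φ + ψ) = cochainHom φ + cochainHom ψ := by
  refine SSet.chainComplex_hom_ext fun γ => ?_
  rw [Preadditive.comp_add, ι_cochainHom, ι_cochainHom, ι_cochainHom]
  ext; simp

theorem cochainHom_smul (c : ℂ) (φ : C(stdSimplex ℝ (Fin 2), X) → ℂ) :
    cochainHom (c • φ) = c • cochainHom φ := by
  refine SSet.chainComplex_hom_ext fun γ => ?_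
  rw [Linear.comp_smul, ι_cochainHom, ι_cochainHom]
  ext; simp

theorem Represents.add {φ ψ : C(stdSimplex ℝ (Fin 2), X) → ℂ} {θ η : (chains X).homology 1 ⟶ ModuleCat.of ℂ ℂ}
    (h : Represents φ θ) (h' : Represents ψ η) : Represents (φ + ψ) (θ + η) := by
  unfold Represents at *
  rw [cochainHom_add, Preadditive.comp_add, Preadditive.comp_add, h, h']

theorem Represents.smul (c : ℂ) {φ : C(stdSimplex ℝ (Fin 2), X) → ℂ}
    {θ : (chains X).homology 1 ⟶ ModuleCat.of ℂ ℂ} (h : Represents φ θ) : Represents (c • φ) (c • θ) := by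
  unfold Represents at *
  rw [cochainHom_smul, Linear.comp_smul, Linear.comp_smul, h]

/-- The map on the singular chain complex induced by a continuous self-map. -/
abbrev chainsMap (σ : C(X, X)) : chains X ⟶ chains X :=
  SSet.chainComplexMap (TopCat.toSSet.map (TopCat.ofHom σ)) (ModuleCat.of ℂ ℂ)

theorem Represents.comp (σ : C(X, X)) {φ : C(stdSimplex ℝ (Fin 2), X) → ℂ}
    {θ : (chains X).homology 1 ⟶ ModuleCat.of ℂ ℂ} (h : Represents φ θ) :
    Represents (fun γ => φ (σ.comp γ))
      (HomologicalComplex.homologyMap (chainsMap σ) 1 ≫ θ) := by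
  unfold Represents at *
  have h1 : cochainHom (fun γ => φ (σ.comp γ)) = (chainsMap σ).f 1 ≫ cochainHom φ := by
    refine SSet.chainComplex_hom_ext fun γ => ?_
    rw [SSet.ι_chainComplexMap_f_assoc, ι_cochainHom, ι_cochainHom]
    rfl
  rw [h1, ← HomologicalComplex.cyclesMap_i_assoc, ← h,
    ← HomologicalComplex.homologyπ_naturality_assoc]

theorem isCocycle_iff (φ : C(stdSimplex ℝ (Fin 2), X) → ℂ) :
    IsCocycle φ ↔ (chains X).d 2 1 ≫ cochainHom φ = 0 := by
  have key : ∀ γ : (TopCat.toSSet.obj (TopCat.of X)) _⦋2⦌,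
      SSet.ιChainComplex _ γ ≫ (chains X).d 2 1 ≫ cochainHom φ =
      ModuleCat.ofHom ((φ ((simplexTwo γ).comp (edge 1 2)) - φ ((simplexTwo γ).comp (edge 0 2)) +
        φ ((simplexTwo γ).comp (edge 0 1))) • LinearMap.id) := by
    intro γ
    rw [SSet.ιChainComplex_d_assoc, Preadditive.sum_comp, Fin.sum_univ_three]
    simp only [Linear.smul_comp, ι_cochainHom]
    rw [simplexTwo_delta 0 1 2 (by decide), simplexTwo_delta 1 0 2 (by decide),
      simplexTwo_delta 2 0 1 (by decide)]
    ext
    simp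
    ring
  constructor
  · intro h
    refine SSet.chainComplex_hom_ext fun γ => ?_
    rw [key, ← h]
    ext; simp
  · intro h σ
    have := key ((TopCat.toSSetObjEquiv (TopCat.of X) (.op ⦋2⦌)).symm σ)
    rw [h, Limits.comp_zero] at this
    have h2 := congrArg (fun f => f.hom (1 : ℂ)) this
    have h3 : simplexTwo ((TopCat.toSSetObjEquiv (TopCat.of X) (.op ⦋2⦌)).symm σ) = σ :=
      Equiv.apply_symm_apply _ _
    rw [h3] at h2
    simp at h2
    linear_combination -h2

theorem isCoboundary_iff (φ : C(stdSimplex ℝ (Fin 2), X) → ℂ) (f : X → ℂ) :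
    IsCoboundary φ f ↔ cochainHom φ = (chains X).d 1 0 ≫ cochainHomZero f := by
  have key : ∀ γ : (TopCat.toSSet.obj (TopCat.of X)) _⦋1⦌,
      SSet.ιChainComplex _ γ ≫ (chains X).d 1 0 ≫ cochainHomZero f =
      ModuleCat.ofHom ((f (simplexOne γ (stdSimplex.vertex 1)) -
        f (simplexOne γ (stdSimplex.vertex 0))) • LinearMap.id) := by
    intro γ
    rw [SSet.ιChainComplex_d_assoc, Preadditive.sum_comp, Fin.sum_univ_two]
    simp only [Linear.smul_comp, ι_cochainHomZero]
    rw [simplexOne_delta 0 1 (by decide), simplexOne_delta 1 0 (by decide)]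
    ext
    simp
    ring
  constructor
  · intro h
    refine SSet.chainComplex_hom_ext fun γ => ?_
    rw [key, ι_cochainHom, h]
  · intro h σ
    have := key ((TopCat.toSSetObjEquiv (TopCat.of X) (.op ⦋1⦌)).symm σ)
    rw [← h, ι_cochainHom] at this
    have h2 := congrArg (fun f => f.hom (1 : ℂ)) this
    have h3 : simplexOne ((TopCat.toSSetObjEquiv (TopCat.of X) (.op ⦋1⦌)).symm σ) = σ :=
      Equiv.apply_symm_apply _ _
    rw [h3] at h2
    simpa using h2

theorem exists_cochainHom_eq (Φ : (chains X).X 1 ⟶ ModuleCat.of ℂ ℂ) : ∃ φ, cochainHom φ = Φ := by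
  refine ⟨fun γ => (SSet.ιChainComplex _
    ((TopCat.toSSetObjEquiv (TopCat.of X) (.op ⦋1⦌)).symm γ) ≫ Φ).hom (1 : ℂ), ?_⟩
  refine SSet.chainComplex_hom_ext fun γ => ?_
  rw [ι_cochainHom]
  have h3 : (TopCat.toSSetObjEquiv (TopCat.of X) (.op ⦋1⦌)).symm (simplexOne γ) = γ :=
    Equiv.symm_apply_apply _ _
  rw [h3]
  ext; simp

theorem exists_cochainHomZero_eq (Φ : (chains X).X 0 ⟶ ModuleCat.of ℂ ℂ) :
    ∃ f, cochainHomZero f = Φ := by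
  refine ⟨fun p => (SSet.ιChainComplex _
    ((TopCat.toSSetObjEquiv (TopCat.of X) (.op ⦋0⦌)).symm (.const _ p)) ≫ Φ).hom (1 : ℂ), ?_⟩
  refine SSet.chainComplex_hom_ext fun γ => ?_
  rw [ι_cochainHomZero]
  have h3 : (TopCat.toSSetObjEquiv (TopCat.of X) (.op ⦋0⦌)).symm (.const _ (simplexZero γ)) = γ := by
    rw [Equiv.symm_apply_eq]
    ext t
    exact congrArg (TopCat.toSSetObjEquiv (TopCat.of X) (.op ⦋0⦌) γ)
      (Subsingleton.elim (α := stdSimplex ℝ (Fin 1)) _ _)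
  rw [h3]
  ext; simp

/-- Every cocycle represents a linear form on `H₁`. -/
theorem IsCocycle.exists_represents {φ : C(stdSimplex ℝ (Fin 2), X) → ℂ} (h : IsCocycle φ) :
    ∃ θ, Represents φ θ := by
  rw [isCocycle_iff] at h
  refine ⟨((chains X).homologyι 1 ≫ (chains X).descOpcycles (cochainHom φ) 2 (by simp) h), ?_⟩
  unfold Represents
  rw [HomologicalComplex.homology_π_ι_assoc, HomologicalComplex.p_descOpcycles]

/-- Every linear form on `H₁` is represented by a cocycle. -/
theorem exists_isCocycle_represents (θ : (chains X).homology 1 ⟶ ModuleCat.of ℂ ℂ) :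
    ∃ φ, IsCocycle φ ∧ Represents φ θ := by
  have hinj : Function.Injective ((chains X).homologyι 1).hom :=
    (ModuleCat.mono_iff_injective _).1 inferInstance
  obtain ⟨Ψ, hΨ⟩ := LinearMap.exists_leftInverse_of_injective ((chains X).homologyι 1).hom
    (LinearMap.ker_eq_bot.2 hinj)
  obtain ⟨φ, hφ⟩ := exists_cochainHom_eq ((chains X).pOpcycles 1 ≫ ModuleCat.homEquiv.symm Ψ ≫ θ)
  refine ⟨φ, ?_, ?_⟩
  · rw [isCocycle_iff, hφ, HomologicalComplex.d_pOpcycles_assoc, Limits.zero_comp]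
  · unfold Represents
    rw [hφ, ← HomologicalComplex.homology_π_ι_assoc]
    have h1 : (chains X).homologyι 1 ≫ ModuleCat.homEquiv.symm Ψ = 𝟙 _ := by
      ext v
      exact LinearMap.congr_fun hΨ v
    rw [reassoc_of% h1]

theorem Represents.eq_zero {φ : C(stdSimplex ℝ (Fin 2), X) → ℂ}
    {θ : (chains X).homology 1 ⟶ ModuleCat.of ℂ ℂ} (h : Represents φ θ) {f : X → ℂ} (hf : IsCoboundary φ f) :
    θ = 0 := by
  unfold Represents at h
  rw [(isCoboundary_iff φ f).1 hf, HomologicalComplex.iCycles_d_assoc, Limits.zero_comp]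
    at h
  exact (cancel_epi ((chains X).homologyπ 1)).1 (h.trans Limits.comp_zero.symm)

theorem Represents.exists_isCoboundary {φ : C(stdSimplex ℝ (Fin 2), X) → ℂ}
    (h : Represents φ 0) : ∃ f, IsCoboundary φ f := by
  have h0 : (chains X).iCycles 1 ≫ cochainHom φ = 0 := by
    rw [← h]; exact Limits.comp_zero
  have hker : LinearMap.ker ((chains X).d 1 0).hom ≤ LinearMap.ker (cochainHom φ).hom := by
    intro z hz
    let Z : ModuleCat.of ℂ ℂ ⟶ (chains X).X 1 :=
      ModuleCat.homEquiv.symm (LinearMap.toSpanSingleton ℂ ((chains X).X 1) z)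
    have hZ : Z.hom (1 : ℂ) = z := one_smul ℂ z
    have hz' : Z ≫ (chains X).d 1 0 = 0 := by
      ext
      exact (congrArg _ hZ).trans hz
    have h2 : Z ≫ cochainHom φ = 0 := by
      rw [← (chains X).liftCycles_i Z 0 (by simp) hz', Category.assoc, h0, Limits.comp_zero]
    exact (congrArg _ hZ).symm.trans (congrArg (fun f => f.hom (1 : ℂ)) h2)
  have hmem : (cochainHom φ).hom ∈ (LinearMap.ker ((chains X).d 1 0).hom).dualAnnihilator := by
    rw [Submodule.mem_dualAnnihilator]
    intro z hz
    exact hker hz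
  rw [← LinearMap.range_dualMap_eq_dualAnnihilator_ker] at hmem
  obtain ⟨g, hg⟩ := hmem
  obtain ⟨f, hf⟩ := exists_cochainHomZero_eq (X := X) (ModuleCat.ofHom g)
  refine ⟨f, (isCoboundary_iff _ _).2 ?_⟩
  rw [hf]
  ext v
  exact (LinearMap.congr_fun hg v).symm

end Cohomology

/-! ### Values of a cocycle on affine segments, and subdivision -/

section Segments

open Topology

variable {X : Type} [TopologicalSpace X]

variable {E : Type*} [AddCommGroup E] [Module ℝ E] [TopologicalSpace E] [ContinuousAdd E]
  [ContinuousSMul ℝ E]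

/-- The affine 1-simplex in a real vector space from `p` to `q`. -/
def seg (p q : E) : C(stdSimplex ℝ (Fin 2), E) where
  toFun u := u.1 0 • p + u.1 1 • q
  continuous_toFun :=
    have h (i : Fin 2) : Continuous fun u : stdSimplex ℝ (Fin 2) => u.1 i :=
      (continuous_apply i).comp continuous_subtype_val
    ((h 0).smul continuous_const).add ((h 1).smul continuous_const)

/-- The affine 2-simplex with vertices `p`, `q`, `r`. -/
def tri (p q r : E) : C(stdSimplex ℝ (Fin 3), E) where
  toFun u := u.1 0 • p + u.1 1 • q + u.1 2 • r
  continuous_toFun :=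
    have h (i : Fin 3) : Continuous fun u : stdSimplex ℝ (Fin 3) => u.1 i :=
      (continuous_apply i).comp continuous_subtype_val
    (((h 0).smul continuous_const).add ((h 1).smul continuous_const)).add
      ((h 2).smul continuous_const)

theorem edge_apply (i j k : Fin 3) (u : stdSimplex ℝ (Fin 2)) :
    (edge i j u).1 k = (if i = k then u.1 0 else 0) + (if j = k then u.1 1 else 0) := by
  change FunOnFinite.linearMap ℝ ℝ ![i, j] u.1 k = _
  rw [FunOnFinite.linearMap_apply_apply, Finset.sum_filter, Fin.sum_univ_two]
  rfl

theorem tri_comp_edge (p q r : E) (i j : Fin 3) :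
    (tri p q r).comp (edge i j) = seg (![p, q, r] i) (![p, q, r] j) := by
  ext u
  simp only [tri, seg, ContinuousMap.comp_apply, ContinuousMap.coe_mk, edge_apply]
  fin_cases i <;> fin_cases j <;> simp [add_smul] <;> abel

variable {φ : C(stdSimplex ℝ (Fin 2), X) → ℂ}

theorem IsCocycle.seg_add (h : IsCocycle φ) (F : C(E, X)) (p q r : E) :
    φ (F.comp (seg p q)) + φ (F.comp (seg q r)) = φ (F.comp (seg p r)) := by
  have := h (F.comp (tri p q r))
  simp only [ContinuousMap.comp_assoc, tri_comp_edge] at this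
  exact this

theorem IsCocycle.seg_self (h : IsCocycle φ) (F : C(E, X)) (p : E) :
    φ (F.comp (seg p p)) = 0 := by
  simpa using h.seg_add F p p p

theorem IsCocycle.const (h : IsCocycle φ) (x : X) : φ (.const _ x) = 0 :=
  h.seg_self (.const ℝ x) 0

theorem seg_vertex_zero (p q : E) : seg p q (stdSimplex.vertex 0) = p := by
  simp [seg]

theorem seg_vertex_one (p q : E) : seg p q (stdSimplex.vertex 1) = q := by
  simp [seg]

/-- The extension of a 1-simplex to a map from the real line which is constant outside `[0, 1]`. -/
def lineOf (γ : C(stdSimplex ℝ (Fin 2), X)) : C(ℝ, X) where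
  toFun t := γ (stdSimplexHomeomorphUnitInterval.symm
    (Set.projIcc 0 1 zero_le_one t))
  continuous_toFun := by fun_prop

theorem lineOf_comp_seg (γ : C(stdSimplex ℝ (Fin 2), X)) : (lineOf γ).comp (seg 0 1) = γ := by
  ext u
  simp only [lineOf, ContinuousMap.comp_apply, ContinuousMap.coe_mk]
  congr 1
  rw [Homeomorph.symm_apply_eq]
  have : seg (0 : ℝ) 1 u = u.1 1 := by simp [seg]
  rw [this, Set.projIcc_of_mem zero_le_one ⟨u.2.1 1, stdSimplex.le_one u 1⟩]
  rfl

/-- A cocycle which has the primitive `f` on each set of an open cover has the primitive `f`. -/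
theorem IsCocycle.isCoboundary_of_cover (h : IsCocycle φ) {ι : Type*} (U : ι → Set X)
    (hU : ∀ i, IsOpen (U i)) (hcov : ∀ x, ∃ i, x ∈ U i) (f : X → ℂ)
    (hf : ∀ i, ∀ γ : C(stdSimplex ℝ (Fin 2), X), (∀ u, γ u ∈ U i) →
      φ γ = f (γ (stdSimplex.vertex 1)) - f (γ (stdSimplex.vertex 0))) :
    IsCoboundary φ f := by
  intro γ
  set F := lineOf γ with hF
  obtain ⟨t, ht0, htm, ⟨N, hN⟩, ht⟩ := exists_monotone_Icc_subset_open_cover_unitInterval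
    (c := fun i => (fun s : unitInterval => F s) ⁻¹' U i)
    (fun i => (hU i).preimage (by fun_prop)) (fun s _ => by
      obtain ⟨i, hi⟩ := hcov (F s)
      exact Set.mem_iUnion.2 ⟨i, hi⟩)
  have key : ∀ n, φ (F.comp (seg 0 (t n : ℝ))) = f (F (t n)) - f (F 0) := by
    intro n
    induction n with
    | zero => rw [ht0]; simpa using h.seg_self F (0 : ℝ)
    | succ n ih =>
      obtain ⟨i, hi⟩ := ht n
      rw [← h.seg_add F 0 (t n : ℝ), ih, hf i (F.comp (seg (t n : ℝ) (t (n + 1)))) ?_]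
      · simp only [ContinuousMap.comp_apply, seg_vertex_zero, seg_vertex_one]
        ring
      · intro u
        have h1 : seg (t n : ℝ) (t (n + 1)) u ∈ Set.Icc (t n : ℝ) (t (n + 1)) := by
          have hle : (t n : ℝ) ≤ t (n + 1) := htm (Nat.le_succ n)
          have : seg (t n : ℝ) (t (n + 1)) u ∈ segment ℝ (t n : ℝ) (t (n + 1)) :=
            ⟨u.1 0, u.1 1, u.2.1 0, u.2.1 1, stdSimplex.add_eq_one u, rfl⟩
          rwa [segment_eq_Icc hle] at this
        have h2 := hi (show (⟨_, (t n).2.1.trans h1.1, h1.2.trans (t (n + 1)).2.2⟩ : unitInterval) ∈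
          Set.Icc (t n) (t (n + 1)) from ⟨h1.1, h1.2⟩)
        exact h2
  have h1 := key N
  rw [hN N le_rfl] at h1
  have h2 : γ = F.comp (seg 0 1) := (lineOf_comp_seg γ).symm
  rw [h2]
  simpa [seg_vertex_zero, seg_vertex_one] using h1

end Segments

/-! ### Singular cocycles from locally constant Čech cocycles -/

section Cech

open Topology Bundle

variable {X : Type} [TopologicalSpace X]

/-- The complex numbers with the discrete topology. -/
def DiscreteComplex : Type := ℂ

instance : TopologicalSpace DiscreteComplex := ⊥
instance : DiscreteTopology DiscreteComplex := ⟨rfl⟩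

/-- Translation of a point of the discrete fibre by a complex number. -/
def DiscreteComplex.translate (v : DiscreteComplex) (z : ℂ) : DiscreteComplex :=
  show ℂ from (show ℂ from v) + z

variable {ι : Type}

/-- The covering space with fibre `ℂ` (discrete) glued from the sets `U i × ℂ` by the translations
`c i j`. -/
def cechBundle (U : ι → Set X) (hU : ∀ i, IsOpen (U i)) (idx : X → ι)
    (hidx : ∀ x, x ∈ U (idx x)) (c : ι → ι → X → ℂ)
    (hc : ∀ i j, ∀ x ∈ U i ∩ U j, ∀ᶠ y in 𝓝 x, c i j y = c i j x)
    (hcoc : ∀ i j k, ∀ x ∈ U i ∩ U j ∩ U k, c i j x + c j k x = c i k x) :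
    FiberBundleCore ι X DiscreteComplex where
  baseSet := U
  isOpen_baseSet := hU
  indexAt := idx
  mem_baseSet_at := hidx
  coordChange i j x v := v.translate (c i j x)
  coordChange_self i x hx v := by
    have h : c i i x = 0 := by simpa using hcoc i i i x ⟨⟨hx, hx⟩, hx⟩
    rw [h]; exact add_zero (show ℂ from v)
  continuousOn_coordChange i j := by
    rintro ⟨x, v⟩ ⟨hx, -⟩
    refine ContinuousAt.continuousWithinAt ?_
    refine (continuousAt_const (y := v.translate (c i j x))).congr ?_
    rw [nhds_prod_eq, nhds_discrete DiscreteComplex]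
    have := hc i j x hx
    filter_upwards [Filter.prod_mem_prod this (Filter.mem_pure.2 rfl : {v} ∈ pure v)] with p hp
    rw [hp.1, hp.2]
  coordChange_comp i j k x hx v := by
    rw [← hcoc i j k x hx]; exact add_assoc (show ℂ from v) _ _

/-- A locally constant Čech 1-cocycle `c` comes from a singular cocycle: there is a singular
cocycle with primitives `f i` on the sets `U i` of the cover that differ by `c`. The cocycle
measures the displacement along the fibre of lifts to the covering space glued from `c`. -/
theorem exists_isCocycle_of_cech (U : ι → Set X) (hU : ∀ i, IsOpen (U i)) (idx : X → ι)
    (hidx : ∀ x, x ∈ U (idx x)) (c : ι → ι → X → ℂ)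
    (hc : ∀ i j, ∀ x ∈ U i ∩ U j, ∀ᶠ y in 𝓝 x, c i j y = c i j x)
    (hcoc : ∀ i j k, ∀ x ∈ U i ∩ U j ∩ U k, c i j x + c j k x = c i k x) :
    ∃ φ : C(stdSimplex ℝ (Fin 2), X) → ℂ, IsCocycle φ ∧ ∃ f : ι → X → ℂ,
      (∀ i, ∀ γ : C(stdSimplex ℝ (Fin 2), X), (∀ u, γ u ∈ U i) →
        φ γ = f i (γ (stdSimplex.vertex 1)) - f i (γ (stdSimplex.vertex 0))) ∧
      ∀ i j, ∀ x ∈ U i ∩ U j, f i x - f j x = c i j x := by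
  set Z := cechBundle U hU idx hidx c hc hcoc with hZ
  have cov : IsCoveringMap Z.proj := FiberBundle.isCoveringMap (F := DiscreteComplex) (E := Z.Fiber)
  let s : Z.TotalSpace → ℂ := fun e => e.2
  -- the coordinate of a lift in the chart `U i` is locally constant
  have hloc : ∀ {n : ℕ} (G : C(stdSimplex ℝ (Fin n), Z.TotalSpace)) (i : ι) (a : stdSimplex ℝ (Fin n)),
      Z.proj (G a) ∈ U i → ∀ᶠ b in 𝓝 a, s (G b) + c (idx (Z.proj (G b))) i (Z.proj (G b)) =
        s (G a) + c (idx (Z.proj (G a))) i (Z.proj (G a)) := by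
    intro n G i a ha
    have h1 : ContinuousAt (fun b => (Z.localTriv i (G b)).2) a := by
      refine continuousAt_snd.comp ?_
      refine ContinuousAt.comp (g := Z.localTriv i) ?_ G.continuous.continuousAt
      refine (Z.localTriv i).continuousOn.continuousAt ?_
      exact (Z.localTriv i).open_source.mem_nhds ((Z.mem_localTriv_source i _).2 ha)
    have h2 := h1.eventually (show {(Z.localTriv i (G a)).2} ∈ 𝓝 _ by
      rw [nhds_discrete]; exact Filter.mem_pure.2 rfl)
    filter_upwards [h2] with b hb
    exact hb
  have hlift : ∀ {n : ℕ} [NeZero n] (σ : C(stdSimplex ℝ (Fin n), X)), ∃ G : C(stdSimplex ℝ (Fin n), Z.TotalSpace),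
      ∀ a, Z.proj (G a) = σ a := by
    intro n _ σ
    have hconv : Convex ℝ (stdSimplex ℝ (Fin n)) := convex_stdSimplex ℝ _
    have : LocallyPathConnectedSpace (stdSimplex ℝ (Fin n)) := hconv.locallyPathConnectedSpace
    have : ContractibleSpace (stdSimplex ℝ (Fin n)) :=
      hconv.contractibleSpace ⟨_, single_mem_stdSimplex ℝ 0⟩
    obtain ⟨G, hG, -⟩ := cov.existsUnique_continuousMap_lifts σ (stdSimplex.vertex 0)
      ⟨σ (stdSimplex.vertex 0), (0 : ℂ)⟩ rfl
    exact ⟨G, fun a => congrFun hG.2 a⟩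
  have huniq : ∀ {n : ℕ} [NeZero n] (G G' : C(stdSimplex ℝ (Fin n), Z.TotalSpace)),
      (∀ a, Z.proj (G a) = Z.proj (G' a)) → ∀ a b, s (G a) - s (G' a) = s (G b) - s (G' b) := by
    intro n _ G G' h a b
    have hlc : IsLocallyConstant (fun a => s (G a) - s (G' a)) := by
      rw [IsLocallyConstant.iff_eventually_eq]
      intro a
      have h1 := hloc G (idx (Z.proj (G a))) a (hidx _)
      have h2 := hloc G' (idx (Z.proj (G a))) a (by rw [← h a]; exact hidx _)
      filter_upwards [h1, h2] with b hb hb'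
      rw [← h b, ← h a] at hb'
      linear_combination hb - hb'
    have : PreconnectedSpace (stdSimplex ℝ (Fin n)) :=
      isPreconnected_iff_preconnectedSpace.1 (convex_stdSimplex ℝ _).isPreconnected
    exact hlc.apply_eq_of_preconnectedSpace a b
  choose L hL using fun γ : C(stdSimplex ℝ (Fin 2), X) => hlift γ
  refine ⟨fun γ => s (L γ (stdSimplex.vertex 1)) - s (L γ (stdSimplex.vertex 0)), ?_,
    fun i x => - c (idx x) i x, ?_, ?_⟩
  · intro σ
    obtain ⟨G, hG⟩ := hlift σ
    have h1 : ∀ i j : Fin 3, s (L (σ.comp (edge i j)) (stdSimplex.vertex 1)) -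
        s (L (σ.comp (edge i j)) (stdSimplex.vertex 0)) =
        s (G (stdSimplex.vertex j)) - s (G (stdSimplex.vertex i)) := by
      intro i j
      have h2 := huniq (L (σ.comp (edge i j))) (G.comp (edge i j)) (fun a => by
        rw [hL]; exact (hG _).symm) (stdSimplex.vertex 1) (stdSimplex.vertex 0)
      have h3 : edge i j (stdSimplex.vertex 1) = stdSimplex.vertex j := stdSimplex.map_vertex _ _
      have h4 : edge i j (stdSimplex.vertex 0) = stdSimplex.vertex i := stdSimplex.map_vertex _ _
      rw [ContinuousMap.comp_apply, ContinuousMap.comp_apply, h3, h4] at h2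
      linear_combination h2
    simp only [h1]
    ring
  · intro i γ hγ
    have hlc : IsLocallyConstant (fun a => s (L γ a) + c (idx (γ a)) i (γ a)) := by
      rw [IsLocallyConstant.iff_eventually_eq]
      intro a
      have := hloc (L γ) i a (by rw [hL]; exact hγ a)
      simpa only [hL] using this
    have : PreconnectedSpace (stdSimplex ℝ (Fin 2)) :=
      isPreconnected_iff_preconnectedSpace.1 (convex_stdSimplex ℝ _).isPreconnected
    have := hlc.apply_eq_of_preconnectedSpace (stdSimplex.vertex 1) (stdSimplex.vertex 0)
    simp only at this ⊢
    linear_combination this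
  · intro i j x hx
    have := hcoc (idx x) i j x ⟨⟨hidx x, hx.1⟩, hx.2⟩
    linear_combination -this

end Cech

/-! ### Averaging over a cyclic group -/

section Average

variable {V : Type*} [AddCommGroup V] [Module ℂ V]

theorem omega_isPrimitiveRoot {d : ℕ} (hd : 0 < d) : IsPrimitiveRoot (omega d) d :=
  Complex.isPrimitiveRoot_exp d hd.ne'

/-- The projection `d⁻¹ ∑ μ⁻ᵏ Tᵏ` to the eigenspace of `T` for the eigenvalue `μ`, when
`T ^ d = 1` and `μ ^ d = 1`. -/
def eigenProj (T : V →ₗ[ℂ] V) (d : ℕ) (μ : ℂ) : V →ₗ[ℂ] V :=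
  (d : ℂ)⁻¹ • ∑ k ∈ Finset.range d, (μ⁻¹) ^ k • (T ^ k)

theorem eigenProj_apply (T : V →ₗ[ℂ] V) (d : ℕ) (μ : ℂ) (v : V) :
    eigenProj T d μ v = (d : ℂ)⁻¹ • ∑ k ∈ Finset.range d, (μ⁻¹) ^ k • (T ^ k) v := by
  simp [eigenProj]

theorem apply_eigenProj {T : V →ₗ[ℂ] V} {d : ℕ} (hT : T ^ d = 1) {μ : ℂ}
    (hμ : μ ^ d = 1) (hd : 0 < d) (v : V) : T (eigenProj T d μ v) = μ • eigenProj T d μ v := by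
  have hμ0 : μ ≠ 0 := by rintro rfl; rw [zero_pow hd.ne'] at hμ; exact zero_ne_one hμ
  rw [eigenProj_apply, map_smul, map_sum, smul_comm μ]
  congr 1
  rw [Finset.smul_sum]
  have h := Finset.sum_range_succ (fun k => (μ * (μ⁻¹) ^ k) • (T ^ k) v) d
  rw [Finset.sum_range_succ'] at h
  simp only [inv_pow, hμ, hT, pow_zero, inv_one] at h
  have h2 := add_right_cancel h
  simp only [← inv_pow] at h2
  simp only [smul_smul]
  rw [← h2]
  refine Finset.sum_congr rfl fun k _ => ?_
  rw [map_smul, pow_succ' T, Module.End.mul_apply, pow_succ, mul_comm _ μ⁻¹, mul_inv_cancel_left₀ hμ0]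

theorem eigenProj_eq_self {T : V →ₗ[ℂ] V} {d : ℕ} (hd : 0 < d) {μ : ℂ} (hμ : μ ^ d = 1) {v : V}
    (hv : T v = μ • v) : eigenProj T d μ v = v := by
  have hμ0 : μ ≠ 0 := by rintro rfl; rw [zero_pow hd.ne'] at hμ; exact zero_ne_one hμ
  have h : ∀ k, (T ^ k) v = μ ^ k • v := by
    intro k
    induction k with
    | zero => simp
    | succ k ih => rw [pow_succ', Module.End.mul_apply, ih, map_smul, hv, smul_smul, pow_succ]
  rw [eigenProj_apply]
  simp only [h, smul_smul, inv_pow, inv_mul_cancel₀ (pow_ne_zero _ hμ0), one_smul,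
    Finset.sum_const, Finset.card_range]
  rw [← Nat.cast_smul_eq_nsmul ℂ, smul_smul, inv_mul_cancel₀ (Nat.cast_ne_zero.2 hd.ne'), one_smul]

theorem sum_eigenProj (T : V →ₗ[ℂ] V) {d : ℕ} (hd : 0 < d) (v : V) :
    ∑ j ∈ Finset.range d, eigenProj T d (omega d ^ j) v = v := by
  have hζ := omega_isPrimitiveRoot hd
  simp only [eigenProj_apply]
  rw [← Finset.smul_sum, Finset.sum_comm]
  simp only [← Finset.sum_smul]
  have h : ∀ k ∈ Finset.range d, k ≠ 0 →
      (∑ j ∈ Finset.range d, ((omega d ^ j)⁻¹) ^ k) • (T ^ k) v = 0 := by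
    intro k hk hk0
    have h1 : ∀ j, ((omega d ^ j)⁻¹) ^ k = ((omega d ^ k)⁻¹) ^ j := by
      intro j; rw [inv_pow, inv_pow, ← pow_mul, ← pow_mul, mul_comm]
    have h2 : (omega d ^ k)⁻¹ ≠ 1 := by
      rw [ne_eq, inv_eq_one]
      exact hζ.pow_ne_one_of_pos_of_lt hk0 (Finset.mem_range.1 hk)
    have h3 : ((omega d ^ k)⁻¹) ^ d = 1 := by
      rw [inv_pow, ← pow_mul, mul_comm, pow_mul, omega_pow, one_pow, inv_one]
    simp only [h1]
    rw [geom_sum_eq h2, h3, sub_self, zero_div, zero_smul]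
  rw [Finset.sum_eq_single 0 h (fun h0 => absurd (Finset.mem_range.2 hd) h0)]
  simp [smul_smul, inv_mul_cancel₀ (Nat.cast_ne_zero.2 hd.ne' : (d : ℂ) ≠ 0)]

end Average

/-! ### The ring of rational functions of the cover -/

section FunctionRing

open Polynomial

variable {a b d : ℕ}

variable (a b d) in
/-- The coordinate function `x`. -/
def xK : FunctionRing a b d := algebraMap (RatFunc ℂ) _ RatFunc.X

variable (a b d) in
/-- The coordinate function `y`. -/
def yK : FunctionRing a b d := AdjoinRoot.root (equation a b d)

theorem yK_pow : yK a b d ^ d = xK a b d ^ a * (xK a b d - 1) ^ b := by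
  have h := AdjoinRoot.eval₂_root (equation a b d)
  conv at h => lhs; arg 3; rw [equation]
  rw [eval₂_sub, eval₂_X_pow, eval₂_C, sub_eq_zero] at h
  rw [yK, h, xK, AdjoinRoot.algebraMap_eq]
  simp

theorem ratFunc_X_sub_C_ne_zero (c : ℂ) : (RatFunc.X - RatFunc.C c : RatFunc ℂ) ≠ 0 := by
  have : (RatFunc.X - RatFunc.C c : RatFunc ℂ) = algebraMap ℂ[X] (RatFunc ℂ) (X - C c) := by
    rw [map_sub, RatFunc.algebraMap_X, RatFunc.algebraMap_C]
  rw [this]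
  exact RatFunc.algebraMap_ne_zero (X_sub_C_ne_zero c)

theorem isUnit_xK_sub (c : ℂ) : IsUnit (xK a b d - algebraMap ℂ _ c) := by
  have : xK a b d - algebraMap ℂ _ c =
      algebraMap (RatFunc ℂ) (FunctionRing a b d) (RatFunc.X - RatFunc.C c) := by
    rw [map_sub, xK, IsScalarTower.algebraMap_apply ℂ (RatFunc ℂ) (FunctionRing a b d)]
    rfl
  rw [this]
  exact (IsUnit.mk0 _ (ratFunc_X_sub_C_ne_zero c)).map _

theorem isUnit_xK : IsUnit (xK a b d) := by
  simpa using isUnit_xK_sub (a := a) (b := b) (d := d) 0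

theorem isUnit_xK_sub_one : IsUnit (xK a b d - 1) := by
  simpa using isUnit_xK_sub (a := a) (b := b) (d := d) 1

theorem isUnit_yK (hd : 0 < d) : IsUnit (yK a b d) := by
  rw [← isUnit_pow_iff hd.ne', yK_pow]
  exact (isUnit_xK.pow _).mul (isUnit_xK_sub_one.pow _)

theorem equation_monic (hd : 0 < d) : (equation a b d).Monic :=
  monic_X_pow_sub_C _ hd.ne'

theorem finite_functionRing (hd : 0 < d) : Module.Finite (RatFunc ℂ) (FunctionRing a b d) :=
  (equation_monic hd).finite_adjoinRoot

theorem exists_sum_yK (hd : 0 < d) (f : FunctionRing a b d) : ∃ c : ℕ → RatFunc ℂ,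
    f = ∑ i ∈ Finset.range d, c i • yK a b d ^ i := by
  have hm := equation_monic (a := a) (b := b) hd
  obtain ⟨p, hp, rfl⟩ : ∃ p : (RatFunc ℂ)[X], p.natDegree < d ∧ AdjoinRoot.mk _ p = f := by
    obtain ⟨q, rfl⟩ := AdjoinRoot.mk_surjective f
    refine ⟨q %ₘ equation a b d, ?_, ?_⟩
    · have h1 : (equation a b d).natDegree = d := natDegree_X_pow_sub_C
      have := natDegree_modByMonic_lt q hm (fun h => by
        rw [h] at h1; simp at h1; omega)
      omega
    · rw [AdjoinRoot.mk_eq_mk, modByMonic_eq_sub_mul_div]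
      exact ⟨-(q /ₘ equation a b d), by ring⟩
  refine ⟨p.coeff, ?_⟩
  rw [← AdjoinRoot.aeval_eq, aeval_eq_sum_range' hp]
  rfl

theorem yK_linearIndependent (hd : 0 < d) (c : ℕ → RatFunc ℂ)
    (h : ∑ i ∈ Finset.range d, c i • yK a b d ^ i = 0) : ∀ i < d, c i = 0 := by
  have h1 : ∑ i ∈ Finset.range d, c i • yK a b d ^ i =
      AdjoinRoot.mk (equation a b d) (∑ i ∈ Finset.range d, C (c i) * X ^ i) := by
    rw [map_sum]
    refine Finset.sum_congr rfl fun i _ => ?_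
    rw [Algebra.smul_def, map_mul, map_pow]
    rfl
  rw [h1, AdjoinRoot.mk_eq_zero] at h
  have h2 : ∑ i ∈ Finset.range d, C (c i) * X ^ i = (0 : (RatFunc ℂ)[X]) := by
    refine eq_zero_of_dvd_of_degree_lt h ?_
    rw [equation, degree_X_pow_sub_C hd]
    refine (degree_sum_fin_lt (n := d) fun i => c i).trans_eq' ?_
    rw [Finset.sum_range]
  intro i hi
  have h3 := congrArg (fun p => p.coeff i) h2
  simpa [finsetSum_coeff, coeff_C_mul, coeff_X_pow, hi] using h3

/-! #### The deck transformation -/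

theorem deck_algebraMap (r : RatFunc ℂ) :
    deck a b d (algebraMap (RatFunc ℂ) _ r) = algebraMap (RatFunc ℂ) _ r :=
  (scaleHom a b d (omega d) (omega_pow d)).commutes r

theorem deck_smul (r : RatFunc ℂ) (f : FunctionRing a b d) :
    deck a b d (r • f) = r • deck a b d f := by
  rw [Algebra.smul_def, map_mul, deck_algebraMap, Algebra.smul_def]

theorem deck_yK : deck a b d (yK a b d) = algebraMap ℂ _ (omega d) * yK a b d :=
  scaleHom_root a b d (omega d) (omega_pow d)

theorem deck_xK : deck a b d (xK a b d) = xK a b d := deck_algebraMap _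

theorem deck_pow_algebraMap (k : ℕ) (r : RatFunc ℂ) :
    (deck a b d ^ k) (algebraMap (RatFunc ℂ) _ r) = algebraMap (RatFunc ℂ) _ r := by
  induction k with
  | zero => rfl
  | succ k ih => rw [pow_succ', AlgEquiv.mul_apply, ih, deck_algebraMap]

theorem deck_pow_yK (k : ℕ) :
    (deck a b d ^ k) (yK a b d) = algebraMap ℂ _ (omega d ^ k) * yK a b d := by
  induction k with
  | zero => simp
  | succ k ih =>
    rw [pow_succ', AlgEquiv.mul_apply, ih, map_mul, AlgEquiv.commutes, deck_yK, pow_succ, map_mul,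
      mul_assoc]

/-- Ring homomorphisms from the function ring are determined by constants, `x` and `y`. -/
theorem functionRing_hom_ext {R : Type*} [CommRing R] {F G : FunctionRing a b d →+* R}
    (hc : ∀ c : ℂ, F (algebraMap ℂ _ c) = G (algebraMap ℂ _ c))
    (hx : F (xK a b d) = G (xK a b d)) (hy : F (yK a b d) = G (yK a b d)) : F = G := by
  refine AdjoinRoot.ringHom_ext ?_ hy
  refine IsLocalization.ringHom_ext (nonZeroDivisors ℂ[X]) ?_
  refine Polynomial.ringHom_ext (fun c => ?_) ?_
  · simp only [RingHom.comp_apply, RatFunc.algebraMap_C]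
    exact hc c
  · simp only [RingHom.comp_apply, RatFunc.algebraMap_X]
    exact hx

theorem deck_pow_self : deck a b d ^ d = 1 := by
  have : ((deck a b d ^ d : FunctionRing a b d ≃ₐ[ℂ] FunctionRing a b d) :
      FunctionRing a b d →+* FunctionRing a b d) = RingHom.id _ := by
    refine functionRing_hom_ext (fun c => ?_) ?_ ?_
    · exact AlgEquiv.commutes _ c
    · exact deck_pow_algebraMap d _
    · refine (deck_pow_yK d).trans ?_
      rw [omega_pow, map_one, one_mul]; rfl
  exact AlgEquiv.ext fun f => RingHom.congr_fun this f

theorem exists_algebraMap_of_deck_eq (hd : 0 < d) {f : FunctionRing a b d} (hf : deck a b d f = f) :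
    ∃ r : RatFunc ℂ, f = algebraMap _ _ r := by
  obtain ⟨c, rfl⟩ := exists_sum_yK hd f
  have hζ := omega_isPrimitiveRoot hd
  have h : ∑ i ∈ Finset.range d, ((RatFunc.C (omega d) ^ i - 1) * c i) • yK a b d ^ i = 0 := by
    rw [← sub_eq_zero, map_sum, ← Finset.sum_sub_distrib] at hf
    rw [← hf]
    refine Finset.sum_congr rfl fun i _ => ?_
    rw [deck_smul, map_pow, deck_yK, mul_pow, IsScalarTower.algebraMap_apply ℂ (RatFunc ℂ),
      ← map_pow (algebraMap (RatFunc ℂ) (FunctionRing a b d)), ← Algebra.smul_def, smul_smul, sub_mul, sub_smul, one_mul, mul_comm (c i)]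
    rfl
  have h0 := yK_linearIndependent hd _ h
  refine ⟨c 0, ?_⟩
  rw [Finset.sum_eq_single 0]
  · rw [pow_zero, Algebra.smul_def, mul_one]
  · intro i hi hi0
    rw [Finset.mem_range] at hi
    rcases mul_eq_zero.1 (h0 i hi) with h1 | h1
    · exfalso
      rw [← map_pow, sub_eq_zero, ← map_one RatFunc.C, RatFunc.C_injective.eq_iff] at h1
      exact hζ.pow_ne_one_of_pos_of_lt hi0 hi h1
    · rw [h1, zero_smul]
  · intro h1; exact absurd (Finset.mem_range.2 hd) h1

variable (a b d) in
/-- The deck transformation as a `ℂ`-linear map. -/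
abbrev deckLin : FunctionRing a b d →ₗ[ℂ] FunctionRing a b d := (deck a b d).toLinearMap

theorem deckLin_pow_apply (k : ℕ) (f : FunctionRing a b d) :
    (deckLin a b d ^ k) f = (deck a b d ^ k) f := by
  induction k with
  | zero => rfl
  | succ k ih => rw [pow_succ', pow_succ', Module.End.mul_apply, ih]; rfl

theorem deckLin_pow_self : deckLin a b d ^ d = 1 := by
  ext f
  rw [deckLin_pow_apply, deck_pow_self]; rfl

variable (a b) in
/-- `y` as a unit of the function ring. -/
def yU (hd : 0 < d) : (FunctionRing a b d)ˣ := (isUnit_yK hd).unit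

theorem deck_yU_zpow (hd : 0 < d) (j : ℤ) :
    deck a b d (↑(yU a b hd ^ j)) = algebraMap ℂ _ (omega d ^ j) * ↑(yU a b hd ^ j) := by
  have h1 : Units.map (deck a b d : FunctionRing a b d →* FunctionRing a b d) (yU a b hd) =
      Units.map (algebraMap ℂ (FunctionRing a b d) : ℂ →* FunctionRing a b d)
        (Units.mk0 _ (omega_ne_zero d)) * yU a b hd :=
    Units.ext deck_yK
  have h2 := congrArg (fun u => ((u ^ j : (FunctionRing a b d)ˣ) : FunctionRing a b d)) h1
  simp only [← map_zpow, mul_zpow, Units.val_mul, Units.coe_map] at h2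
  simpa using h2

/-- The eigenspace of the deck transformation for `ζ ^ j` is `ℂ(x) y ^ j`. -/
theorem exists_eq_smul_of_deck_eq (hd : 0 < d) (j : ℤ) {f : FunctionRing a b d}
    (hf : deck a b d f = omega d ^ j • f) :
    ∃ r : RatFunc ℂ, f = algebraMap _ _ r * ↑(yU a b hd ^ j) := by
  have h1 : deck a b d (f * ↑(yU a b hd ^ (-j))) = f * ↑(yU a b hd ^ (-j)) := by
    rw [map_mul, hf, deck_yU_zpow, Algebra.smul_def, mul_mul_mul_comm, ← map_mul,
      ← zpow_add₀ (omega_ne_zero d), add_neg_cancel, zpow_zero, map_one, one_mul]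
  obtain ⟨r, hr⟩ := exists_algebraMap_of_deck_eq hd h1
  refine ⟨r, ?_⟩
  rw [← hr, mul_assoc, ← Units.val_mul, ← zpow_add, neg_add_cancel, zpow_zero, Units.val_one,
    mul_one]

/-- Every rational function becomes a unit after subtracting a suitable constant, and any finite
set of constants can be avoided. -/
theorem exists_isUnit_sub (hd : 0 < d) (f : FunctionRing a b d) (S : Set ℂ) (hS : S.Finite) :
    ∃ c : ℂ, c ∉ S ∧ IsUnit (f - algebraMap ℂ _ c) := by
  have := finite_functionRing (a := a) (b := b) hd
  obtain ⟨p, hp, hpf⟩ : IsIntegral (RatFunc ℂ) f := Algebra.IsIntegral.isIntegral f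
  have hfin : {c : ℂ | p.eval (RatFunc.C c) = 0}.Finite := by
    have : {c : ℂ | p.eval (RatFunc.C c) = 0} = RatFunc.C ⁻¹' {r | p.IsRoot r} := rfl
    rw [this]
    exact (p.finite_setOfPred_isRoot hp.ne_zero).preimage RatFunc.C_injective.injOn
  obtain ⟨c, hc⟩ := ((hfin.union hS).infinite_compl).nonempty
  rw [Set.mem_compl_iff, Set.mem_union, not_or] at hc
  refine ⟨c, hc.2, ?_⟩
  have h1 : (X - C (RatFunc.C c)) ∣ p - C (p.eval (RatFunc.C c)) :=
    X_sub_C_dvd_sub_C_eval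
  obtain ⟨q, hq⟩ := h1
  have h2 := congrArg (aeval f) hq
  rw [map_sub, map_mul, map_sub, aeval_C, aeval_X, aeval_C, aeval_def, hpf, zero_sub] at h2
  have h3 : algebraMap (RatFunc ℂ) (FunctionRing a b d) (RatFunc.C c) = algebraMap ℂ _ c :=
    (IsScalarTower.algebraMap_apply ℂ (RatFunc ℂ) (FunctionRing a b d) c).symm
  rw [h3] at h2
  refine isUnit_of_mul_isUnit_left (y := aeval f q) ?_
  rw [← h2]
  exact ((IsUnit.mk0 _ hc.1).map _).neg

end FunctionRing

/-! ### Evaluation of rational functions at points of the affine curve -/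

section Evaluation

open Polynomial Filter Topology

variable {a b d : ℕ}

variable (a b d) in
/-- The rational function on the curve defined by a polynomial in `x` and `y`. -/
def ofPoly : ℂ[X][X] →+* FunctionRing a b d :=
  (AdjoinRoot.mk (equation a b d)).comp (mapRingHom (algebraMap ℂ[X] (RatFunc ℂ)))

theorem ofPoly_C (q : ℂ[X]) :
    ofPoly a b d (C q) = algebraMap (RatFunc ℂ) _ (algebraMap ℂ[X] (RatFunc ℂ) q) := by
  simp only [ofPoly, RingHom.comp_apply, coe_mapRingHom, map_C]
  rfl

theorem ofPoly_X : ofPoly a b d X = yK a b d := by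
  simp [ofPoly, yK]

theorem exists_num_den (f : FunctionRing a b d) :
    ∃ N : ℂ[X][X], ∃ q : ℂ[X], q ≠ 0 ∧ ofPoly a b d (C q) * f = ofPoly a b d N := by
  obtain ⟨p, rfl⟩ := AdjoinRoot.mk_surjective f
  obtain ⟨q, hq, h⟩ := IsLocalization.integerNormalization_spec (nonZeroDivisors ℂ[X]) p
  refine ⟨IsLocalization.integerNormalization (nonZeroDivisors ℂ[X]) p, q,
    nonZeroDivisors.ne_zero hq, ?_⟩
  simp only [ofPoly, RingHom.comp_apply, coe_mapRingHom, h, map_C, ← map_mul]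
  rw [Algebra.smul_def]
  rfl

theorem evalEval_eq_zero (hd : 0 < d) {N : ℂ[X][X]} (hN : ofPoly a b d N = 0) {x y : ℂ}
    (h : y ^ d = x ^ a * (x - 1) ^ b) : N.evalEval x y = 0 := by
  have hm : (X ^ d - C (X ^ a * (X - 1) ^ b) : ℂ[X][X]).Monic := monic_X_pow_sub_C _ hd.ne'
  have hmap : (X ^ d - C (X ^ a * (X - 1) ^ b) : ℂ[X][X]).map (algebraMap ℂ[X] (RatFunc ℂ)) =
      equation a b d := by
    rw [equation]
    simp [RatFunc.algebraMap_X]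
  have h1 : (X ^ d - C (X ^ a * (X - 1) ^ b) : ℂ[X][X]) ∣ N := by
    rw [← map_dvd_map _ (RatFunc.algebraMap_injective ℂ) hm, hmap]
    exact AdjoinRoot.mk_eq_zero.1 hN
  obtain ⟨Q, rfl⟩ := h1
  rw [evalEval_mul]
  simp [evalEval, h]

/-- A numerator of a rational function, as a polynomial in `x` and `y`. -/
def numK (f : FunctionRing a b d) : ℂ[X][X] := (exists_num_den f).choose

/-- A denominator of a rational function, as a polynomial in `x`. -/
def denK (f : FunctionRing a b d) : ℂ[X] := (exists_num_den f).choose_spec.choose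

theorem denK_ne_zero (f : FunctionRing a b d) : denK f ≠ 0 :=
  (exists_num_den f).choose_spec.choose_spec.1

theorem denK_mul (f : FunctionRing a b d) :
    ofPoly a b d (C (denK f)) * f = ofPoly a b d (numK f) :=
  (exists_num_den f).choose_spec.choose_spec.2

/-- The value of a rational function at the point `(x, y)` of the affine curve; it is meaningful
for all but finitely many `x`. -/
def evalK (f : FunctionRing a b d) (x y : ℂ) : ℂ := (numK f).evalEval x y / (denK f).eval x

theorem eventually_eval_ne_zero {q : ℂ[X]} (hq : q ≠ 0) : ∀ᶠ x in cofinite, q.eval x ≠ 0 := by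
  rw [eventually_cofinite]
  simpa using q.finite_setOfPred_isRoot hq

theorem evalK_eventually_eq (hd : 0 < d) {f : FunctionRing a b d} {N : ℂ[X][X]} {q : ℂ[X]}
    (hq : q ≠ 0) (h : ofPoly a b d (C q) * f = ofPoly a b d N) :
    ∀ᶠ x in cofinite, ∀ y : ℂ, y ^ d = x ^ a * (x - 1) ^ b →
      evalK f x y = N.evalEval x y / q.eval x := by
  filter_upwards [eventually_eval_ne_zero hq, eventually_eval_ne_zero (denK_ne_zero f)] with
    x h1 h2 y hy
  have h3 : ofPoly a b d (C q * numK f - C (denK f) * N) = 0 := by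
    rw [map_sub, map_mul, map_mul, ← h, ← denK_mul]; ring
  have h4 := evalEval_eq_zero hd h3 hy
  rw [evalEval_sub, evalEval_mul, evalEval_mul, evalEval_C, evalEval_C] at h4
  rw [evalK, div_eq_div_iff h2 h1]
  linear_combination h4

/-- A family of points of the affine curve, indexed by a filter along which `x` eventually leaves
every finite set. -/
structure OnCurve (a b d : ℕ) {α : Type*} (l : Filter α) (X Y : α → ℂ) : Prop where
  tendsto : Tendsto X l cofinite
  eqn : ∀ᶠ t in l, Y t ^ d = X t ^ a * (X t - 1) ^ b

variable {α : Type*} {l : Filter α} {X Y : α → ℂ}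

theorem OnCurve.evalK_eventually_eq (hd : 0 < d) (h : OnCurve a b d l X Y) {f : FunctionRing a b d}
    {N : ℂ[X][X]} {q : ℂ[X]} (hq : q ≠ 0) (hf : ofPoly a b d (C q) * f = ofPoly a b d N) :
    ∀ᶠ t in l, evalK f (X t) (Y t) = N.evalEval (X t) (Y t) / q.eval (X t) := by
  filter_upwards [h.tendsto.eventually (BelyiCover.evalK_eventually_eq hd hq hf), h.eqn] with t h1 h2
  exact h1 _ h2

/-- Evaluation of rational functions along a family of points of the curve, as a ring homomorphism
to germs. -/
def evalGerm (hd : 0 < d) (h : OnCurve a b d l X Y) : FunctionRing a b d →+* Germ l ℂ where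
  toFun f := ((fun t => evalK f (X t) (Y t) : α → ℂ) : Germ l ℂ)
  map_one' := Germ.coe_eq.2 <| by
    filter_upwards [h.evalK_eventually_eq hd (f := 1) (N := 1) (q := 1) one_ne_zero (by simp)] with
      t h1
    rw [h1]; simp [evalEval]
  map_zero' := Germ.coe_eq.2 <| by
    filter_upwards [h.evalK_eventually_eq hd (f := 0) (N := 0) (q := 1) one_ne_zero (by simp)] with
      t h1
    rw [h1]; simp [evalEval]
  map_mul' f g := Germ.coe_eq.2 <| by
    filter_upwards [h.evalK_eventually_eq hd (f := f * g) (N := numK f * numK g)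
      (q := denK f * denK g) (mul_ne_zero (denK_ne_zero f) (denK_ne_zero g)) (by
        rw [map_mul C, map_mul, map_mul, ← denK_mul, ← denK_mul]; ring)] with t h1
    rw [h1]
    simp [evalK, evalEval_mul, div_mul_div_comm]
  map_add' f g := Germ.coe_eq.2 <| by
    filter_upwards [h.evalK_eventually_eq hd (f := f + g)
      (N := C (denK g) * numK f + C (denK f) * numK g)
      (q := denK f * denK g) (mul_ne_zero (denK_ne_zero f) (denK_ne_zero g)) (by
        rw [map_mul C, map_mul, map_add, map_mul, map_mul, ← denK_mul, ← denK_mul]; ring),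
      h.tendsto.eventually (eventually_eval_ne_zero (denK_ne_zero f)),
      h.tendsto.eventually (eventually_eval_ne_zero (denK_ne_zero g))] with t h1 h2 h3
    rw [h1]
    simp only [evalK, evalEval_add, evalEval_mul, evalEval_C, eval_mul]
    field_simp

theorem evalGerm_apply (hd : 0 < d) (h : OnCurve a b d l X Y) (f : FunctionRing a b d) :
    evalGerm hd h f = ((fun t => evalK f (X t) (Y t) : α → ℂ) : Germ l ℂ) := rfl

theorem evalGerm_ofPoly (hd : 0 < d) (h : OnCurve a b d l X Y) (N : ℂ[X][X]) :
    evalGerm hd h (ofPoly a b d N) = ((fun t => N.evalEval (X t) (Y t) : α → ℂ) : Germ l ℂ) := by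
  refine Germ.coe_eq.2 ?_
  filter_upwards [h.evalK_eventually_eq hd (f := ofPoly a b d N) (N := N) (q := 1) one_ne_zero
    (by simp)] with t h1
  rw [h1]; simp

theorem evalGerm_xK (hd : 0 < d) (h : OnCurve a b d l X Y) :
    evalGerm hd h (xK a b d) = (X : Germ l ℂ) := by
  have : xK a b d = ofPoly a b d (C Polynomial.X) := by
    rw [ofPoly_C, RatFunc.algebraMap_X]; rfl
  rw [this, evalGerm_ofPoly]; simp [evalEval]

theorem evalGerm_yK (hd : 0 < d) (h : OnCurve a b d l X Y) :
    evalGerm hd h (yK a b d) = (Y : Germ l ℂ) := by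
  rw [← ofPoly_X, evalGerm_ofPoly]; simp [evalEval]

theorem evalGerm_const (hd : 0 < d) (h : OnCurve a b d l X Y) (c : ℂ) :
    evalGerm hd h (algebraMap ℂ _ c) = ((fun _ => c : α → ℂ) : Germ l ℂ) := by
  have : algebraMap ℂ (FunctionRing a b d) c = ofPoly a b d (C (C c)) := by
    rw [ofPoly_C, RatFunc.algebraMap_C]; rfl
  rw [this, evalGerm_ofPoly]; simp

theorem evalGerm_ratFunc (hd : 0 < d) (h : OnCurve a b d l X Y) (r : RatFunc ℂ) :
    evalGerm hd h (algebraMap (RatFunc ℂ) _ r) =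
      ((fun t => r.num.eval (X t) / r.denom.eval (X t) : α → ℂ) : Germ l ℂ) := by
  refine Germ.coe_eq.2 ?_
  filter_upwards [h.evalK_eventually_eq hd (f := algebraMap (RatFunc ℂ) _ r) (N := C r.num)
    (q := r.denom) r.denom_ne_zero (by
      rw [ofPoly_C, ofPoly_C, ← map_mul]
      congr 1
      rw [mul_comm, ← eq_div_iff (RatFunc.algebraMap_ne_zero r.denom_ne_zero)]
      exact (RatFunc.num_div_denom r).symm)] with t h1
  rw [h1, evalEval_C]

/-- Twisting by the deck transformation multiplies the second coordinate by `ζ`. -/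
theorem evalGerm_deck (hd : 0 < d) (h : OnCurve a b d l X Y)
    (h' : OnCurve a b d l X (fun t => omega d * Y t)) (f : FunctionRing a b d) :
    evalGerm hd h (deck a b d f) = evalGerm hd h' f := by
  have : (evalGerm hd h).comp (deck a b d : FunctionRing a b d →+* FunctionRing a b d) =
      evalGerm hd h' := by
    refine functionRing_hom_ext (fun c => ?_) ?_ ?_
    · refine (congrArg (evalGerm hd h) ((deck a b d).commutes c)).trans ?_
      rw [evalGerm_const, evalGerm_const]
    · refine (congrArg (evalGerm hd h) deck_xK).trans ?_
      rw [evalGerm_xK, evalGerm_xK]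
    · refine (congrArg (evalGerm hd h) deck_yK).trans ?_
      rw [map_mul, evalGerm_const, evalGerm_yK, evalGerm_yK]
      rfl
  exact RingHom.congr_fun this f

theorem OnCurve.omega_mul (h : OnCurve a b d l X Y) :
    OnCurve a b d l X (fun t => omega d * Y t) :=
  ⟨h.tendsto, h.eqn.mono fun t ht => by rw [mul_pow, omega_pow, one_mul, ht]⟩

theorem tendsto_coe_onePoint {F : α → ℂ} {c : ℂ} :
    Tendsto (fun t => (F t : OnePoint ℂ)) l (𝓝 (c : OnePoint ℂ)) ↔ Tendsto F l (𝓝 c) :=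
  (OnePoint.isOpenEmbedding_coe.isInducing.tendsto_nhds_iff).symm

theorem tendsto_coe_infty {F : α → ℂ} :
    Tendsto (fun t => (F t : OnePoint ℂ)) l (𝓝 OnePoint.infty) ↔
      Tendsto F l (Bornology.cobounded ℂ) := by
  rw [← Metric.cobounded_eq_cocompact.symm, ← coclosedCompact_eq_cocompact,
    ← OnePoint.comap_coe_nhds_infty, tendsto_comap_iff]
  rfl

/-- The place obtained as a limit of points of the affine curve along which every rational function
has a limit in the Riemann sphere. -/
def limitPlace [l.NeBot] (hd : 0 < d) (h : OnCurve a b d l X Y)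
    (v : FunctionRing a b d → OnePoint ℂ)
    (hv : ∀ f, Tendsto (fun t => (evalK f (X t) (Y t) : OnePoint ℂ)) l (𝓝 (v f))) :
    Place (FunctionRing a b d) where
  val := v
  val_algebraMap r := by
    refine tendsto_nhds_unique (hv _) ?_
    rw [tendsto_coe_onePoint]
    exact (tendsto_congr' (Germ.coe_eq.1 (evalGerm_const hd h r))).2 tendsto_const_nhds
  val_add f g u w hf hg := by
    have h1 := hv f
    have h2 := hv g
    rw [hf, tendsto_coe_onePoint] at h1
    rw [hg, tendsto_coe_onePoint] at h2
    refine tendsto_nhds_unique (hv _) ?_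
    rw [tendsto_coe_onePoint]
    exact (tendsto_congr' (Germ.coe_eq.1 (map_add (evalGerm hd h) f g))).2 (h1.add h2)
  val_mul f g u w hf hg := by
    have h1 := hv f
    have h2 := hv g
    rw [hf, tendsto_coe_onePoint] at h1
    rw [hg, tendsto_coe_onePoint] at h2
    refine tendsto_nhds_unique (hv _) ?_
    rw [tendsto_coe_onePoint]
    exact (tendsto_congr' (Germ.coe_eq.1 (map_mul (evalGerm hd h) f g))).2 (h1.mul h2)
  exists_of_pole f hf := by
    -- the inverse of `f - c` works for any constant `c` for which it exists
    obtain ⟨c, -, u, hu⟩ := exists_isUnit_sub hd f ∅ Set.finite_empty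
    have h1 := hv f
    rw [hf, tendsto_coe_infty] at h1
    have h2 : f * ↑u⁻¹ = 1 + algebraMap ℂ _ c * ↑u⁻¹ := by
      have : f = ↑u + algebraMap ℂ _ c := by rw [hu]; ring
      conv_lhs => rw [this]
      rw [add_mul, Units.mul_inv]
    have h3 : Tendsto (fun t => evalK (↑u⁻¹ : FunctionRing a b d) (X t) (Y t)) l (𝓝 0) := by
      have h4 := congrArg (evalGerm hd h) (Units.mul_inv u)
      rw [hu, map_mul, map_sub, evalGerm_const, map_one] at h4
      have h5 : ∀ᶠ t in l, (evalK f (X t) (Y t) - c) * evalK (↑u⁻¹ : FunctionRing a b d) (X t) (Y t)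
        = 1 := Germ.coe_eq.1 h4
      have h6 : Tendsto (fun t => evalK f (X t) (Y t) - c) l (Bornology.cobounded ℂ) := by
        rw [← tendsto_norm_atTop_iff_cobounded] at h1 ⊢
        exact tendsto_atTop_mono (fun t => norm_sub_norm_le _ _)
          (tendsto_atTop_add_const_right _ (-‖c‖) h1)
      refine (tendsto_inv₀_cobounded.comp h6).congr' ?_
      filter_upwards [h5] with t ht
      exact inv_eq_of_mul_eq_one_right ht
    refine ⟨↑u⁻¹, tendsto_nhds_unique (hv _) (tendsto_coe_onePoint.2 h3), ?_⟩
    refine tendsto_nhds_unique (hv _) (tendsto_coe_onePoint.2 ?_)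
    have h4 : ∀ᶠ t in l, evalK (f * (↑u⁻¹ : FunctionRing a b d)) (X t) (Y t) =
        1 + c * evalK (↑u⁻¹ : FunctionRing a b d) (X t) (Y t) := by
      have h5 := congrArg (evalGerm hd h) h2
      rw [map_add, map_mul _ (algebraMap ℂ _ c), evalGerm_const, map_one] at h5
      exact Germ.coe_eq.1 h5
    refine (tendsto_congr' h4).2 ?_
    simpa using (h3.const_mul c).const_add 1

end Evaluation

/-! ### Points of the curve given by meromorphic parametrizations -/

section Chart

open Filter Topology

theorem meromorphicAt_eval {X : ℂ → ℂ} {t : ℂ} (hX : MeromorphicAt X t) (p : Polynomial ℂ) :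
    MeromorphicAt (fun s => p.eval (X s)) t := by
  induction p using Polynomial.induction_on' with
  | add p q hp hq => simpa only [Polynomial.eval_add] using! hp.add hq
  | monomial n c =>
    simp only [Polynomial.eval_monomial]
    exact (MeromorphicAt.const c t).mul (hX.pow n)

theorem meromorphicAt_evalEval {X Y : ℂ → ℂ} {t : ℂ} (hX : MeromorphicAt X t)
    (hY : MeromorphicAt Y t) (N : Polynomial (Polynomial ℂ)) :
    MeromorphicAt (fun s => N.evalEval (X s) (Y s)) t := by
  induction N using Polynomial.induction_on' with
  | add p q hp hq => simpa only [Polynomial.evalEval_add] using! hp.add hq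
  | monomial n c =>
    have : ∀ s, (Polynomial.monomial n c).evalEval (X s) (Y s) = c.eval (X s) * Y s ^ n := by
      intro s
      simp [Polynomial.evalEval, Polynomial.eval_monomial]
    simp only [this]
    exact (meromorphicAt_eval hX c).mul (hY.pow n)

theorem meromorphicAt_evalK {a b d : ℕ} {X Y : ℂ → ℂ} {t : ℂ} (hX : MeromorphicAt X t)
    (hY : MeromorphicAt Y t) (f : FunctionRing a b d) :
    MeromorphicAt (fun s => evalK f (X s) (Y s)) t :=
  (meromorphicAt_evalEval hX hY _).div (meromorphicAt_eval hX _)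

theorem exists_sphereLimit {F : ℂ → ℂ} {t : ℂ} (hF : MeromorphicAt F t) :
    ∃ v : OnePoint ℂ, Tendsto (fun s => (F s : OnePoint ℂ)) (𝓝[≠] t) (𝓝 v) := by
  rcases lt_or_ge (meromorphicOrderAt F t) 0 with h | h
  · exact ⟨OnePoint.infty, tendsto_coe_infty.2 (tendsto_cobounded_of_meromorphicOrderAt_neg h)⟩
  · obtain ⟨c, hc⟩ := tendsto_nhds_of_meromorphicOrderAt_nonneg hF h
    exact ⟨c, tendsto_coe_onePoint.2 hc⟩

/-- A meromorphic parametrization `t ↦ (X t, Y t)` of a piece of the curve, by a subset of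
the complex plane. -/
structure Chart (a b d : ℕ) where
  /-- the domain of the parameter -/
  dom : Set ℂ
  /-- the first coordinate -/
  X : ℂ → ℂ
  /-- the second coordinate -/
  Y : ℂ → ℂ
  merX : ∀ t ∈ dom, MeromorphicAt X t
  merY : ∀ t ∈ dom, MeromorphicAt Y t
  onCurve : ∀ t ∈ dom, OnCurve a b d (𝓝[≠] t) X Y

variable {a b d : ℕ}

namespace Chart

variable (hd : 0 < d) (c : Chart a b d)

/-- The point of the curve with parameter `t`: the value of a rational function there is the limit
of its values at nearby parameters. -/
def place (t : c.dom) : Place (FunctionRing a b d) :=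
  limitPlace hd (c.onCurve t t.2)
    (fun f => limUnder (𝓝[≠] (t : ℂ)) fun s => (evalK f (c.X s) (c.Y s) : OnePoint ℂ))
    fun f => tendsto_nhds_limUnder
      (exists_sphereLimit (meromorphicAt_evalK (c.merX t t.2) (c.merY t t.2) f))

theorem tendsto_place (t : c.dom) (f : FunctionRing a b d) :
    Tendsto (fun s => (evalK f (c.X s) (c.Y s) : OnePoint ℂ)) (𝓝[≠] (t : ℂ))
      (𝓝 ((c.place hd t).val f)) :=
  tendsto_nhds_limUnder
      (exists_sphereLimit (meromorphicAt_evalK (c.merX t t.2) (c.merY t t.2) f))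

/-- The germ at the parameter `t` of a rational function. -/
abbrev germ (t : c.dom) : FunctionRing a b d →+* Germ (𝓝[≠] (t : ℂ)) ℂ :=
  evalGerm hd (c.onCurve t t.2)

theorem place_val {t : c.dom} {f : FunctionRing a b d} {g : ℂ → ℂ}
    (h : c.germ hd t f = (g : Germ (𝓝[≠] (t : ℂ)) ℂ)) (hg : ContinuousAt g t) :
    (c.place hd t).val f = (g t : OnePoint ℂ) := by
  refine tendsto_nhds_unique (c.tendsto_place hd t f) (tendsto_coe_onePoint.2 ?_)
  exact (tendsto_congr' (Germ.coe_eq.1 h)).2 (hg.tendsto.mono_left nhdsWithin_le_nhds)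

theorem continuous_place : Continuous (c.place hd) := by
  refine continuous_induced_rng.2 (continuous_pi fun f => ?_)
  rw [continuous_iff_continuousAt]
  intro t
  -- the closedness of a neighbourhood passes from the nearby values to their limits
  refine (closed_nhds_basis _).tendsto_right_iff.2 fun W hW => ?_
  have h1 := (c.tendsto_place hd t f).eventually hW.1
  have h2 : ∀ᶠ s in 𝓝 (t : ℂ), ∀ hs : s ∈ c.dom, (c.place hd ⟨s, hs⟩).val f ∈ W := by
    rw [eventually_nhdsWithin_iff, ← eventually_eventually_nhds] at h1
    filter_upwards [h1] with s hs hsd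
    rcases eq_or_ne s t with rfl | hne
    · exact mem_of_mem_nhds hW.1
    · refine hW.2.mem_of_tendsto (c.tendsto_place hd ⟨s, hsd⟩ f) ?_
      filter_upwards [nhdsWithin_le_nhds hs, nhdsWithin_le_nhds (isOpen_ne.mem_nhds hne)] with r h3 h4
      exact h3 h4
  have h3 : ∀ᶠ s : c.dom in 𝓝 t, ∀ hs : (s : ℂ) ∈ c.dom, (c.place hd ⟨s, hs⟩).val f ∈ W :=
    continuous_subtype_val.continuousAt.eventually h2
  filter_upwards [h3] with s hs
  exact hs s.2

/-- Two parametrizations that agree up to a change of the parameter define the same points. -/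
theorem place_eq {c c' : Chart a b d} {t : c.dom} {t' : c'.dom} (θ : ℂ → ℂ)
    (hθ : Tendsto θ (𝓝[≠] (t : ℂ)) (𝓝[≠] (t' : ℂ)))
    (hX : ∀ᶠ s in 𝓝[≠] (t : ℂ), c.X s = c'.X (θ s)) (hY : ∀ᶠ s in 𝓝[≠] (t : ℂ), c.Y s = c'.Y (θ s)) :
    c.place hd t = c'.place hd t' := by
  refine Place.ext (funext fun f => ?_)
  refine tendsto_nhds_unique (c.tendsto_place hd t f) ?_
  refine ((c'.tendsto_place hd t' f).comp hθ).congr' ?_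
  filter_upwards [hX, hY] with s h1 h2
  simp [h1, h2]

theorem map_deck_place {c c' : Chart a b d} {t : c.dom} {t' : c'.dom} (htt : (t : ℂ) = t')
    (hX : ∀ᶠ s in 𝓝[≠] (t : ℂ), c'.X s = c.X s)
    (hY : ∀ᶠ s in 𝓝[≠] (t : ℂ), c'.Y s = omega d * c.Y s) :
    (c.place hd t).map (deck a b d) = c'.place hd t' := by
  refine Place.ext (funext fun f => ?_)
  refine tendsto_nhds_unique (c.tendsto_place hd t (deck a b d f)) ?_
  have h1 := c'.tendsto_place hd t' f
  rw [← htt] at h1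
  refine h1.congr' ?_
  have h2 := evalGerm_deck hd (c.onCurve t t.2) (c.onCurve t t.2).omega_mul f
  filter_upwards [hX, hY, Germ.coe_eq.1 h2] with s h3 h4 h5
  rw [h5, h3, h4]

end Chart

end Chart

/-! ### Coordinates at the three branch points -/

section Cusps

open Filter Topology

/-- The three branch points `0`, `1`, `∞` of the cover. -/
inductive Cusp
  | zero
  | one
  | infty

namespace Cusp

/-- The Möbius involution that moves the branch point to `0` and another branch point to `1`. -/
def M : Cusp → ℂ → ℂ
  | zero, w => w
  | one, w => 1 - w
  | infty, w => w⁻¹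

/-- The order of `y ^ d` at the branch point. -/
def A (a b : ℕ) : Cusp → ℤ
  | zero => a
  | one => b
  | infty => -(a + b)

/-- The order of `y ^ d` at the point where the coordinate `w` at the branch point equals `1`. -/
def B (a b : ℕ) : Cusp → ℕ
  | zero => b
  | one => a
  | infty => b

/-- The constant factor in `y ^ d = κ w ^ A (1 - w) ^ B`. -/
def κ (b : ℕ) : Cusp → ℂ
  | zero => (-1) ^ b
  | one => (-1) ^ b
  | infty => 1

theorem κ_ne_zero (b : ℕ) (i : Cusp) : i.κ b ≠ 0 := by
  cases i <;> simp [κ]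

theorem M_M (i : Cusp) (w : ℂ) : i.M (i.M w) = w := by
  cases i <;> simp [M]

theorem M_eqn (a b : ℕ) (i : Cusp) {w : ℂ} (hw : w ≠ 0) :
    i.M w ^ a * (i.M w - 1) ^ b = i.κ b * w ^ i.A a b * (1 - w) ^ i.B a b := by
  cases i
  · simp only [M, A, B, κ, zpow_natCast]
    have : (w - 1) = -1 * (1 - w) := by ring
    rw [this, mul_pow]; ring
  · simp only [M, A, B, κ, zpow_natCast]
    have : (1 - w - 1) = -1 * w := by ring
    rw [this, mul_pow]; ring
  · simp only [M, A, B, κ]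
    have : w⁻¹ - 1 = w⁻¹ * (1 - w) := by field_simp
    rw [this, mul_pow, ← Nat.cast_add, zpow_neg, zpow_natCast, pow_add, inv_pow, inv_pow,
      mul_inv]
    ring

variable {a b d : ℕ}

variable (a b d) in
/-- The local coordinate `x`, `1 - x` or `x⁻¹` at the branch point, as a unit of the function
ring. -/
def wU : Cusp → (FunctionRing a b d)ˣ
  | zero => (isUnit_xK).unit
  | one => -(isUnit_xK_sub_one).unit
  | infty => (isUnit_xK).unit⁻¹

theorem isUnit_one_sub_wU (i : Cusp) : IsUnit (1 - (i.wU a b d : FunctionRing a b d)) := by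
  cases i
  · have : (1 - (zero.wU a b d : FunctionRing a b d)) = -(xK a b d - 1) := by
      simp [wU]
    rw [this]
    exact isUnit_xK_sub_one.neg
  · have : (1 - (one.wU a b d : FunctionRing a b d)) = xK a b d := by
      simp [wU]
    rw [this]
    exact isUnit_xK
  · have : (1 - (infty.wU a b d : FunctionRing a b d)) =
        (infty.wU a b d : FunctionRing a b d) * (xK a b d - 1) := by
      rw [mul_sub, mul_one]
      congr 1
      exact ((isUnit_xK (a := a) (b := b) (d := d)).val_inv_mul).symm
    rw [this]
    exact (Units.isUnit _).mul isUnit_xK_sub_one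

theorem deck_wU (i : Cusp) : deck a b d (i.wU a b d) = i.wU a b d := by
  cases i
  · exact deck_xK
  · simp [wU, deck_xK]
  · have h : Units.map (deck a b d : FunctionRing a b d →* FunctionRing a b d)
        (isUnit_xK).unit = (isUnit_xK).unit := Units.ext deck_xK
    have h2 := congrArg (fun u => ((u⁻¹ : (FunctionRing a b d)ˣ) : FunctionRing a b d)) h
    simp only [← map_inv] at h2
    exact h2

theorem yU_pow (hd : 0 < d) (i : Cusp) : (yU a b hd : FunctionRing a b d) ^ d =
    algebraMap ℂ _ (i.κ b) * ↑(i.wU a b d ^ i.A a b) *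
      (1 - (i.wU a b d : FunctionRing a b d)) ^ i.B a b := by
  have h0 : (yU a b hd : FunctionRing a b d) = yK a b d := rfl
  rw [h0, yK_pow]
  have hneg : algebraMap ℂ (FunctionRing a b d) ((-1) ^ b) = (-1) ^ b := by simp
  cases i
  · have hw : (zero.wU a b d : FunctionRing a b d) = xK a b d := rfl
    simp only [A, B, κ, zpow_natCast, Units.val_pow_eq_pow_val, hw, hneg]
    have : (xK a b d - 1) = -1 * (1 - xK a b d) := by ring
    rw [this, mul_pow]; ring
  · have hw : (one.wU a b d : FunctionRing a b d) = 1 - xK a b d := by simp [wU]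
    simp only [A, B, κ, zpow_natCast, Units.val_pow_eq_pow_val, hw, hneg]
    have : (xK a b d - 1) = -1 * (1 - xK a b d) := by ring
    rw [this, mul_pow]; ring
  · set u := (isUnit_xK (a := a) (b := b) (d := d)).unit with hu
    have hux : (u : FunctionRing a b d) = xK a b d := rfl
    have hw : infty.wU a b d = u⁻¹ := rfl
    have h1 : (1 : FunctionRing a b d) - (u⁻¹ : (FunctionRing a b d)ˣ) =
        (u⁻¹ : (FunctionRing a b d)ˣ) * (xK a b d - 1) := by
      rw [← hux, mul_sub, mul_one, Units.inv_mul]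
    simp only [A, B, κ, hw, map_one, one_mul]
    rw [h1, mul_pow, ← mul_assoc, ← Units.val_pow_eq_pow_val, ← Units.val_mul, ← hux,
      ← Units.val_pow_eq_pow_val]
    congr 2
    rw [← zpow_natCast u⁻¹, inv_zpow, inv_zpow, ← zpow_neg, ← zpow_neg, ← zpow_add, neg_neg,
      ← zpow_natCast]
    congr 1
    ring

theorem germ_wU (hd : 0 < d) {α : Type*} {l : Filter α} {X Y : α → ℂ}
    (h : OnCurve a b d l X Y) (i : Cusp) :
    evalGerm hd h (i.wU a b d) = ((fun t => i.M (X t) : α → ℂ) : Germ l ℂ) := by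
  cases i
  · exact evalGerm_xK hd h
  · have : (one.wU a b d : FunctionRing a b d) = 1 - xK a b d := by simp [wU]
    rw [this, map_sub, map_one, evalGerm_xK]
    rfl
  · have h1 : (infty.wU a b d : FunctionRing a b d) * xK a b d = 1 :=
      (isUnit_xK (a := a) (b := b) (d := d)).val_inv_mul
    have h2 := congrArg (evalGerm hd h) h1
    rw [map_mul, map_one, evalGerm_xK, evalGerm_apply] at h2
    have h3 : ∀ᶠ t in l, evalK (infty.wU a b d : FunctionRing a b d) (X t) (Y t) * X t = 1 :=
      Germ.coe_eq.1 h2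
    rw [evalGerm_apply]
    refine Germ.coe_eq.2 ?_
    filter_upwards [h3] with t ht
    exact eq_inv_of_mul_eq_one_left ht

/-! #### Ramification -/

variable (a b d)

/-- The number of points of the curve over the branch point. -/
def g (i : Cusp) : ℕ := Int.gcd (i.A a b) d

/-- The ramification index. -/
def e (i : Cusp) : ℕ := d / i.g a b d

/-- The order of `y` at the points over the branch point. -/
def k (i : Cusp) : ℤ := i.A a b / i.g a b d

/-- The Bézout coefficient `p` in `p k + q e = 1`. -/
def p (i : Cusp) : ℤ := Int.gcdA (i.k a b d) (i.e a b d)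

/-- The Bézout coefficient `q` in `p k + q e = 1`. -/
def q (i : Cusp) : ℤ := Int.gcdB (i.k a b d) (i.e a b d)

variable {a b d}

theorem g_pos (hd : 0 < d) (i : Cusp) : 0 < i.g a b d :=
  Int.gcd_pos_of_ne_zero_right _ (by exact_mod_cast hd.ne')

theorem e_mul_g (i : Cusp) : i.e a b d * i.g a b d = d :=
  Nat.div_mul_cancel (Int.natCast_dvd_natCast.1 (Int.gcd_dvd_right _ _))

theorem k_mul_g (i : Cusp) : i.k a b d * i.g a b d = i.A a b :=
  Int.ediv_mul_cancel (Int.gcd_dvd_left _ _)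

theorem e_pos (hd : 0 < d) (i : Cusp) : 0 < i.e a b d :=
  Nat.pos_of_ne_zero fun h => by
    have := i.e_mul_g (a := a) (b := b) (d := d)
    rw [h, zero_mul] at this; omega

theorem k_mul_d (i : Cusp) : i.k a b d * d = i.A a b * i.e a b d := by
  have h1 := i.k_mul_g (a := a) (b := b) (d := d)
  have h2 : (i.e a b d : ℤ) * i.g a b d = d := by exact_mod_cast i.e_mul_g
  linear_combination (-(i.k a b d : ℤ)) * h2 + (i.e a b d : ℤ) * h1

theorem bezout (hd : 0 < d) (i : Cusp) :
    i.p a b d * i.k a b d + i.q a b d * i.e a b d = 1 := by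
  have h1 : Int.gcd (i.k a b d) (i.e a b d) = 1 := by
    have := Int.gcd_div_gcd_div_gcd (i := i.A a b) (j := d) (i.g_pos hd)
    have h2 : ((d : ℤ) / (i.g a b d : ℕ)) = (i.e a b d : ℕ) := by
      rw [e, Int.natCast_div]
    rw [← h2]
    exact this
  have h2 := Int.gcd_eq_gcd_ab (i.k a b d) (i.e a b d)
  rw [h1] at h2
  rw [p, q]
  push_cast at h2
  linarith

end Cusp

theorem evalGerm_zpow {a b d : ℕ} (hd : 0 < d) {α : Type*} {l : Filter α} {X Y : α → ℂ}
    (h : OnCurve a b d l X Y) {u : (FunctionRing a b d)ˣ} {F : α → ℂ}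
    (hu : evalGerm hd h (u : FunctionRing a b d) = (F : Germ l ℂ)) (n : ℤ) :
    evalGerm hd h (↑(u ^ n) : FunctionRing a b d) = ((fun t => F t ^ n : α → ℂ) : Germ l ℂ) := by
  have hinv : evalGerm hd h (↑u⁻¹ : FunctionRing a b d) = ((fun t => (F t)⁻¹ : α → ℂ) : Germ l ℂ) := by
    have h1 := congrArg (evalGerm hd h) u.inv_mul
    rw [map_mul, hu, map_one, evalGerm_apply] at h1
    have h2 : ∀ᶠ t in l, evalK (↑u⁻¹ : FunctionRing a b d) (X t) (Y t) * F t = 1 :=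
      Germ.coe_eq.1 h1
    rw [evalGerm_apply]
    refine Germ.coe_eq.2 ?_
    filter_upwards [h2] with t ht
    exact eq_inv_of_mul_eq_one_left ht
  obtain ⟨m, rfl | rfl⟩ := n.eq_nat_or_neg
  · simp only [zpow_natCast, Units.val_pow_eq_pow_val, map_pow, hu]
    rfl
  · simp only [zpow_neg, zpow_natCast, ← inv_pow, Units.val_pow_eq_pow_val, map_pow, hinv]
    rfl

namespace Cusp

variable {a b d : ℕ}

theorem eventually_ne_zero (t : ℂ) : ∀ᶠ s in 𝓝[≠] t, s ≠ 0 :=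
  nhdsNE_le_cofinite t ((Set.finite_singleton (0 : ℂ)).compl_mem_cofinite)

theorem tendsto_M_pow (hd : 0 < d) (i : Cusp) (t : ℂ) :
    Tendsto (fun s : ℂ => i.M (s ^ i.e a b d)) (𝓝[≠] t) cofinite := by
  have h1 : Function.Injective i.M := Function.LeftInverse.injective (M_M i)
  have h2 : Tendsto (fun s : ℂ => s ^ i.e a b d) cofinite cofinite := by
    refine Tendsto.cofinite_of_finite_preimage_singleton fun c => ?_
    have h3 : (Polynomial.X ^ i.e a b d - Polynomial.C c : Polynomial ℂ) ≠ 0 :=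
      Polynomial.X_pow_sub_C_ne_zero (i.e_pos hd) c
    refine (Polynomial.finite_setOfPred_isRoot h3).subset fun s hs => ?_
    have hs' : s ^ i.e a b d = c := hs
    simp [Polynomial.IsRoot, hs']
  exact (h1.tendsto_cofinite.comp h2).mono_left (nhdsNE_le_cofinite t)

/-- The parametrization of a component of the part of the curve where the coordinate `w` at the
branch point avoids `[1, ∞]`: `w = t ^ e`, `y = ξ t ^ k (1 - t ^ e) ^ (B / d)`. -/
def star (hd : 0 < d) (i : Cusp) (ξ : ℂ) (hξ : ξ ^ d = i.κ b) : Chart a b d where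
  dom := {t | 1 - t ^ i.e a b d ∈ Complex.slitPlane}
  X t := i.M (t ^ i.e a b d)
  Y t := ξ * t ^ i.k a b d * (1 - t ^ i.e a b d) ^ ((i.B a b : ℂ) / d)
  merX t _ := by
    have h : MeromorphicAt (fun s : ℂ => s ^ i.e a b d) t := (MeromorphicAt.id t).pow _
    cases i
    · exact h
    · exact (MeromorphicAt.const 1 t).sub h
    · exact h.inv
  merY t ht := by
    refine ((MeromorphicAt.const ξ t).mul ((MeromorphicAt.id t).zpow _)).mul ?_
    refine AnalyticAt.meromorphicAt ?_
    exact AnalyticAt.cpow (by fun_prop) (by fun_prop) ht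
  onCurve t ht :=
    { tendsto := tendsto_M_pow hd i t
      eqn := by
        filter_upwards [eventually_ne_zero t] with s hs
        have hd0 : (d : ℂ) ≠ 0 := Nat.cast_ne_zero.2 hd.ne'
        have h1 : (s ^ i.k a b d) ^ d = (s ^ i.e a b d) ^ i.A a b := by
          rw [← zpow_natCast, ← zpow_mul, k_mul_d, mul_comm, zpow_mul, zpow_natCast]
        rw [M_eqn a b i (pow_ne_zero _ hs), mul_pow, mul_pow, hξ, h1, ← Complex.cpow_mul_nat,
          div_mul_cancel₀ _ hd0, Complex.cpow_natCast] }

section star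

variable (hd : 0 < d) (i : Cusp) (ξ : ℂ) (hξ : ξ ^ d = i.κ b)

theorem star_germ_wU (t : (i.star (a := a) hd ξ hξ).dom) :
    (i.star hd ξ hξ).germ hd t (i.wU a b d) =
      ((fun s => s ^ i.e a b d : ℂ → ℂ) : Germ (𝓝[≠] (t : ℂ)) ℂ) := by
  rw [Chart.germ, germ_wU]
  exact Germ.coe_eq.2 (Eventually.of_forall fun s => M_M i _)

theorem star_val_wU (t : (i.star (a := a) hd ξ hξ).dom) :
    ((i.star hd ξ hξ).place hd t).val (i.wU a b d) = (((t : ℂ) ^ i.e a b d : ℂ) : OnePoint ℂ) :=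
  Chart.place_val hd _ (g := fun s => s ^ i.e a b d) (star_germ_wU hd i ξ hξ t)
    (Continuous.continuousAt (by fun_prop))

theorem star_germ_yU_wU (t : (i.star (a := a) hd ξ hξ).dom) (m n : ℤ) :
    (i.star hd ξ hξ).germ hd t ↑(yU a b hd ^ m * i.wU a b d ^ n) =
      ((fun s => ξ ^ m * s ^ (m * i.k a b d + n * i.e a b d) *
        ((1 - s ^ i.e a b d) ^ ((i.B a b : ℂ) / d)) ^ m : ℂ → ℂ) : Germ (𝓝[≠] (t : ℂ)) ℂ) := by
  have h1 := evalGerm_zpow hd ((i.star hd ξ hξ).onCurve t t.2) (star_germ_wU hd i ξ hξ t) n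
  have h2 := evalGerm_zpow hd ((i.star hd ξ hξ).onCurve t t.2) (u := yU a b hd)
    (evalGerm_yK hd _) m
  rw [Chart.germ, Units.val_mul, map_mul, h1, h2]
  refine Germ.coe_eq.2 ?_
  filter_upwards [eventually_ne_zero (t : ℂ)] with s hs
  simp only [star, mul_zpow]
  rw [zpow_add₀ hs, ← zpow_mul, ← zpow_natCast, ← zpow_mul, mul_comm m, mul_comm n]
  ring

theorem star_val_yU_wU (t : (i.star (a := a) hd ξ hξ).dom) (m n : ℤ) (r : ℕ)
    (hr : m * i.k a b d + n * i.e a b d = r) :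
    ((i.star hd ξ hξ).place hd t).val ↑(yU a b hd ^ m * i.wU a b d ^ n) =
      ((ξ ^ m * (t : ℂ) ^ r * ((1 - (t : ℂ) ^ i.e a b d) ^ ((i.B a b : ℂ) / d)) ^ m : ℂ) :
        OnePoint ℂ) := by
  have h := star_germ_yU_wU hd i ξ hξ t m n
  rw [hr] at h
  simp only [zpow_natCast] at h
  refine Chart.place_val hd _ h ?_
  have ht : 1 - (t : ℂ) ^ i.e a b d ∈ Complex.slitPlane := t.2
  have h1 : ContinuousAt (fun s : ℂ => (1 - s ^ i.e a b d) ^ ((i.B a b : ℂ) / d)) t :=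
    ContinuousAt.cpow (by fun_prop) (by fun_prop) ht
  refine ContinuousAt.mul (by fun_prop) (h1.zpow₀ _ (Or.inl ?_))
  rw [Complex.cpow_ne_zero_iff]
  exact Or.inl (Complex.slitPlane_ne_zero ht)

/-- Changing the parameter by an `e`-th root of unity. -/
theorem star_place_mul (μ : ℂ) (hμ : μ ^ i.e a b d = 1) (ξ' : ℂ) (hξ' : ξ' ^ d = i.κ b)
    (h : ξ' = ξ * μ ^ i.k a b d) (t : (i.star (a := a) hd ξ' hξ').dom)
    (t' : (i.star (a := a) hd ξ hξ).dom) (ht : (t' : ℂ) = μ * t) :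
    (i.star hd ξ' hξ').place hd t = (i.star hd ξ hξ).place hd t' := by
  have hμ0 : μ ≠ 0 := by rintro rfl; rw [zero_pow (i.e_pos hd).ne'] at hμ; exact zero_ne_one hμ
  refine Chart.place_eq hd (fun s => μ * s) ?_ (Eventually.of_forall fun s => ?_)
    (Eventually.of_forall fun s => ?_)
  · rw [ht]
    refine tendsto_nhdsWithin_iff.2 ⟨?_, ?_⟩
    · exact (Continuous.tendsto (by fun_prop) _).mono_left nhdsWithin_le_nhds
    · filter_upwards [self_mem_nhdsWithin] with s hs hs'
      exact hs (mul_left_cancel₀ hμ0 hs')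
  · simp only [star, mul_pow, hμ, one_mul]
  · simp only [star, mul_pow, hμ, one_mul, h, mul_zpow]
    ring

/-- The deck transformation multiplies `ξ` by `ζ`. -/
theorem star_map_deck (ξ' : ℂ) (hξ' : ξ' ^ d = i.κ b) (h : ξ' = omega d * ξ)
    (t : (i.star (a := a) hd ξ hξ).dom) :
    ((i.star hd ξ hξ).place hd t).map (deck a b d) = (i.star hd ξ' hξ').place hd ⟨t, t.2⟩ := by
  refine Chart.map_deck_place hd rfl (Eventually.of_forall fun s => rfl)
    (Eventually.of_forall fun s => ?_)
  simp only [star, h]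
  ring

end star

end Cusp
end Cusps

/-! ### Multiplicities of eigenvalues of endomorphisms of finite order -/

section FiniteOrder

variable {V : Type*} [AddCommGroup V] [Module ℂ V]

theorem rootMultiplicity_charpoly_of_pow_eq_one [Module.Finite ℂ V] {T : Module.End ℂ V} {d : ℕ}
    (hd : 0 < d) (hT : T ^ d = 1) (μ : ℂ) :
    T.charpoly.rootMultiplicity μ = Module.finrank ℂ (T.eigenspace μ) := by
  have hss : T.IsSemisimple := by
    refine Module.End.isSemisimple_of_squarefree_aeval_eq_zero
      (p := Polynomial.X ^ d - Polynomial.C (1 : ℂ)) ?_ (by simp [hT])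
    exact (Polynomial.separable_X_pow_sub_C 1 (Nat.cast_ne_zero.2 hd.ne') one_ne_zero).squarefree
  rw [← LinearMap.finrank_maxGenEigenspace_eq,
    hss.isFinitelySemisimple.maxGenEigenspace_eq_eigenspace]

/-- An endomorphism of finite order with finite-dimensional eigenspaces acts on a finite-dimensional
space. -/
theorem finite_of_finite_eigenspace {T : Module.End ℂ V} {d : ℕ} (hd : 0 < d) (hT : T ^ d = 1)
    (h : ∀ j : ℕ, Module.Finite ℂ (T.eigenspace (omega d ^ j))) : Module.Finite ℂ V := by
  have h1 : ∀ j : ℕ, (T.eigenspace (omega d ^ j)).FG := fun j => Module.Finite.iff_fg.1 (h j)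
  have h2 : (⨆ j ∈ Finset.range d, T.eigenspace (omega d ^ j)).FG :=
    Submodule.fg_biSup _ _ fun j _ => h1 j
  refine ⟨?_⟩
  have h3 : (⊤ : Submodule ℂ V) ≤ ⨆ j ∈ Finset.range d, T.eigenspace (omega d ^ j) := by
    intro v _
    rw [← sum_eigenProj T hd v]
    refine Submodule.sum_mem _ fun j hj => ?_
    refine Submodule.mem_iSup_of_mem j (Submodule.mem_iSup_of_mem hj ?_)
    rw [Module.End.mem_eigenspace_iff]
    exact apply_eigenProj hT (by rw [← pow_mul, mul_comm, pow_mul, omega_pow, one_pow]) hd v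
  rwa [top_le_iff.1 h3] at h2

end FiniteOrder

/-! ### Values at places -/

section Places

variable {K : Type} [CommRing K] [Algebra ℂ K] (P : Place K)

namespace Place

theorem val_one : P.val 1 = ((1 : ℂ) : OnePoint ℂ) := by
  simpa using P.val_algebraMap 1

theorem val_zero : P.val 0 = ((0 : ℂ) : OnePoint ℂ) := by
  simpa using P.val_algebraMap 0

theorem val_pow {f : K} {u : ℂ} (h : P.val f = (u : OnePoint ℂ)) (n : ℕ) :
    P.val (f ^ n) = ((u ^ n : ℂ) : OnePoint ℂ) := by
  induction n with
  | zero => simpa using P.val_one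
  | succ n ih => rw [pow_succ, pow_succ]; exact P.val_mul _ _ _ _ ih h

theorem val_neg {f : K} {u : ℂ} (h : P.val f = (u : OnePoint ℂ)) :
    P.val (-f) = ((-u : ℂ) : OnePoint ℂ) := by
  have h1 := P.val_mul _ _ _ _ (P.val_algebraMap (-1)) h
  simpa using h1

theorem val_sub {f g : K} {u v : ℂ} (hf : P.val f = (u : OnePoint ℂ))
    (hg : P.val g = (v : OnePoint ℂ)) : P.val (f - g) = ((u - v : ℂ) : OnePoint ℂ) := by
  rw [sub_eq_add_neg, sub_eq_add_neg]
  exact P.val_add _ _ _ _ hf (P.val_neg hg)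

theorem val_inv {f : Kˣ} {u : ℂ} (h : P.val f = (u : OnePoint ℂ)) (hu : u ≠ 0) :
    P.val ↑f⁻¹ = ((u⁻¹ : ℂ) : OnePoint ℂ) := by
  rcases hv : P.val ↑f⁻¹ with _ | v
  · obtain ⟨g, hg, hfg⟩ := P.exists_of_pole _ hv
    have h1 := P.val_mul _ _ _ _ h hfg
    rw [← mul_assoc, Units.mul_inv, one_mul, hg] at h1
    exact absurd (OnePoint.coe_injective h1).symm (by simpa using hu)
  · have h1 := P.val_mul _ _ _ _ h hv
    rw [Units.mul_inv, P.val_one] at h1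
    have h2 : (1 : ℂ) = u * v := OnePoint.coe_injective h1
    exact congrArg (fun z : ℂ => (z : OnePoint ℂ)) (eq_inv_of_mul_eq_one_right h2.symm)

theorem val_inv_of_infty {f : Kˣ} (h : P.val f = OnePoint.infty) :
    P.val ↑f⁻¹ = ((0 : ℂ) : OnePoint ℂ) := by
  obtain ⟨g, hg, hfg⟩ := P.exists_of_pole _ h
  rcases hv : P.val ↑f⁻¹ with _ | v
  · obtain ⟨g', hg', hfg'⟩ := P.exists_of_pole _ hv
    have h1 := P.val_mul _ _ _ _ hfg hfg'
    have h2 := P.val_mul _ _ _ _ hg hg'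
    have h3 : (f * g) * (↑f⁻¹ * g') = g * g' := by
      rw [mul_mul_mul_comm, Units.mul_inv, one_mul]
    rw [h3, h2] at h1
    exact absurd (OnePoint.coe_injective h1) (by norm_num)
  · have h1 := P.val_mul _ _ _ _ hfg hv
    have h3 : (f * g) * (↑f⁻¹ : K) = g := by
      rw [mul_comm (f : K), mul_assoc, Units.mul_inv, mul_one]
    rw [h3, hg, one_mul] at h1
    exact h1.symm

theorem val_inv_of_zero {f : Kˣ} (h : P.val f = ((0 : ℂ) : OnePoint ℂ)) :
    P.val ↑f⁻¹ = OnePoint.infty := by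
  rcases hv : P.val ↑f⁻¹ with _ | v
  · rfl
  · have h1 := P.val_mul _ _ _ _ h hv
    rw [Units.mul_inv, P.val_one] at h1
    exact absurd (OnePoint.coe_injective h1) (by norm_num)

theorem val_zpow {f : Kˣ} {u : ℂ} (h : P.val f = (u : OnePoint ℂ)) (hu : u ≠ 0) (n : ℤ) :
    P.val ↑(f ^ n) = ((u ^ n : ℂ) : OnePoint ℂ) := by
  obtain ⟨m, rfl | rfl⟩ := n.eq_nat_or_neg
  · simpa using P.val_pow h m
  · rw [zpow_neg, zpow_neg, zpow_natCast, zpow_natCast, ← inv_pow, ← inv_pow,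
      Units.val_pow_eq_pow_val]
    exact P.val_pow (P.val_inv h hu) m

/-- The local rings are integrally closed under taking roots. -/
theorem mem_ring_of_pow {f : K} {n : ℕ} (hn : 0 < n) (h : f ^ n ∈ P.ring) : f ∈ P.ring := by
  rcases hv : P.val f with _ | v
  · obtain ⟨g, hg, hfg⟩ := P.exists_of_pole _ hv
    obtain ⟨u, hu⟩ := h
    have h1 := P.val_mul _ _ _ _ hu (P.val_pow hg n)
    rw [← mul_pow, P.val_pow hfg n, one_pow, zero_pow hn.ne', mul_zero] at h1
    exact absurd (OnePoint.coe_injective h1) one_ne_zero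
  · exact ⟨v, hv⟩

theorem val_ne_zero_of_pow {f : K} {n : ℕ} {u v : ℂ} (hn : 0 < n)
    (h : P.val (f ^ n) = (u : OnePoint ℂ)) (hu : u ≠ 0) (hv : P.val f = (v : OnePoint ℂ)) :
    v ≠ 0 := by
  rintro rfl
  rw [P.val_pow hv n, zero_pow hn.ne'] at h
  exact hu (OnePoint.coe_injective h).symm

end Place

end Places

/-! ### Rational differentials -/

section Forms

open KaehlerDifferential

variable {a b d : ℕ}

theorem D_mem_span_of_isUnit {S : Submodule (FunctionRing a b d) Ω[FunctionRing a b d⁄ℂ]}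
    {u v : FunctionRing a b d} (huv : u * v = 1) (hv : D ℂ _ v ∈ S) : D ℂ _ u ∈ S := by
  rw [Derivation.leibniz_of_mul_eq_one _ huv]
  exact S.smul_mem _ hv

/-- The differential of `x` generates all rational differentials. -/
theorem exists_eq_smul_D (hd : 0 < d) (ω : Ω[FunctionRing a b d⁄ℂ]) :
    ∃ h : FunctionRing a b d, ω = h • D ℂ _ (xK a b d) := by
  set S : Submodule (FunctionRing a b d) Ω[FunctionRing a b d⁄ℂ] :=
    Submodule.span _ {D ℂ _ (xK a b d)} with hS
  have hx : D ℂ _ (xK a b d) ∈ S := Submodule.mem_span_singleton_self _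
  have hmul : ∀ f g : FunctionRing a b d, D ℂ _ f ∈ S → D ℂ _ g ∈ S → D ℂ _ (f * g) ∈ S := by
    intro f g hf hg
    rw [Derivation.leibniz]
    exact S.add_mem (S.smul_mem _ hg) (S.smul_mem _ hf)
  have hpow : ∀ (f : FunctionRing a b d) (n : ℕ), D ℂ _ f ∈ S → D ℂ _ (f ^ n) ∈ S := by
    intro f n hf
    rw [Derivation.leibniz_pow]
    exact S.smul_of_tower_mem _ (S.smul_mem _ hf)
  have hpoly : ∀ p : Polynomial ℂ, D ℂ _ (algebraMap (RatFunc ℂ) (FunctionRing a b d)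
      (algebraMap _ _ p)) ∈ S := by
    intro p
    have : algebraMap (RatFunc ℂ) (FunctionRing a b d) (algebraMap _ _ p) =
        Polynomial.aeval (xK a b d) p := by
      rw [xK, Polynomial.aeval_algebraMap_apply, ← RatFunc.algebraMap_X,
        Polynomial.aeval_algebraMap_apply, Polynomial.aeval_X_left_apply]
    rw [this, Derivation.map_aeval]
    exact S.smul_mem _ hx
  have hrat : ∀ r : RatFunc ℂ, D ℂ _ (algebraMap (RatFunc ℂ) (FunctionRing a b d) r) ∈ S := by
    intro r
    rw [← RatFunc.num_div_denom r, div_eq_mul_inv, map_mul]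
    refine hmul _ _ (hpoly _) (D_mem_span_of_isUnit ?_ (hpoly r.denom))
    rw [← map_mul, inv_mul_cancel₀ (RatFunc.algebraMap_ne_zero r.denom_ne_zero), map_one]
  have hy : D ℂ _ (yK a b d) ∈ S := by
    have h1 : D ℂ _ (yK a b d ^ d) ∈ S := by
      rw [yK_pow, mul_comm]
      refine hmul _ _ (hpow _ _ ?_) (hpow _ _ hx)
      rw [map_sub, Derivation.map_one_eq_zero, sub_zero]
      exact hx
    rw [Derivation.leibniz_pow, ← Nat.cast_smul_eq_nsmul ℂ] at h1
    have h2 := S.smul_of_tower_mem ((d : ℂ)⁻¹) h1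
    rw [smul_smul, inv_mul_cancel₀ (Nat.cast_ne_zero.2 hd.ne'), one_smul] at h2
    have h3 := S.smul_mem (↑(yU a b hd ^ (d - 1))⁻¹ : FunctionRing a b d) h2
    have h4 : (↑(yU a b hd ^ (d - 1))⁻¹ : FunctionRing a b d) * yK a b d ^ (d - 1) = 1 :=
      Units.inv_mul (yU a b hd ^ (d - 1))
    rwa [smul_smul, h4, one_smul] at h3
  have hall : ∀ f : FunctionRing a b d, D ℂ _ f ∈ S := by
    intro f
    obtain ⟨c, rfl⟩ := exists_sum_yK hd f
    rw [map_sum]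
    refine S.sum_mem fun i _ => ?_
    rw [Algebra.smul_def]
    exact hmul _ _ (hrat _) (hpow _ _ hy)
  have htop : (⊤ : Submodule (FunctionRing a b d) Ω[FunctionRing a b d⁄ℂ]) ≤ S := by
    rw [← KaehlerDifferential.span_range_derivation, Submodule.span_le]
    rintro _ ⟨f, rfl⟩
    exact hall f
  obtain ⟨h, hh⟩ := Submodule.mem_span_singleton.1 (htop (Submodule.mem_top (x := ω)))
  exact ⟨h, hh.symm⟩

theorem pullback_deck_smul_D (h : FunctionRing a b d) :
    pullback (deck a b d) (h • D ℂ _ (xK a b d)) = deck a b d h • D ℂ _ (xK a b d) := by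
  rw [pullback_smul, pullback_D, deck_xK]

variable (a b) in
/-- The coefficient `y ^ j x ^ m (1 - x) ^ n`. -/
def coeffU (hd : 0 < d) (j m n : ℤ) : (FunctionRing a b d)ˣ :=
  yU a b hd ^ j * Cusp.zero.wU a b d ^ m * Cusp.one.wU a b d ^ n

namespace Cusp

variable (a b d) in
/-- The function `1 - w` for the coordinate `w` at a branch point, as a unit. -/
def oneSubU (i : Cusp) : (FunctionRing a b d)ˣ := (i.isUnit_one_sub_wU (a := a) (b := b) (d := d)).unit

/-- The order of `x ^ m (1 - x) ^ n dx` at the branch point. -/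
def ordAt (m n : ℤ) : Cusp → ℤ
  | zero => m
  | one => n
  | infty => -m - n - 2

/-- The order of `x ^ m (1 - x) ^ n dx` at the branch point where the coordinate is `1`. -/
def ordAtOne (m n : ℤ) : Cusp → ℤ
  | zero => n
  | one => m
  | infty => n

/-- The form `y ^ j x ^ m (1 - x) ^ n dx` in terms of the coordinate at a branch point. -/
theorem coeffU_smul_D (hd : 0 < d) (i : Cusp) (j m n : ℤ) : ∃ s : ℂˣ,
    (coeffU a b hd j m n : FunctionRing a b d) • D ℂ _ (xK a b d) =
      (s : ℂ) • (↑(yU a b hd ^ j * i.wU a b d ^ i.ordAt m n * i.oneSubU a b d ^ i.ordAtOne m n) :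
        FunctionRing a b d) • D ℂ _ (i.wU a b d : FunctionRing a b d) := by
  have hone : (one.wU a b d : FunctionRing a b d) = 1 - xK a b d := by simp [wU]
  cases i
  · refine ⟨1, ?_⟩
    have : zero.oneSubU a b d = one.wU a b d := Units.ext hone.symm
    rw [this]
    simp only [Units.val_one, one_smul]
    rfl
  · refine ⟨-1, ?_⟩
    have : one.oneSubU a b d = zero.wU a b d := Units.ext (by
      change 1 - (one.wU a b d : FunctionRing a b d) = xK a b d
      rw [hone]; ring)
    rw [this, hone, map_sub, Derivation.map_one_eq_zero, zero_sub, smul_neg, coeffU, ordAt, ordAtOne,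
      mul_right_comm]
    simp
  · refine ⟨(-1) ^ (n + 1), ?_⟩
    have hinf : infty.wU a b d = (zero.wU a b d)⁻¹ := rfl
    have h1 : infty.oneSubU a b d = -(one.wU a b d * (zero.wU a b d)⁻¹) := Units.ext (by
      rw [Units.val_neg, Units.val_mul]
      change 1 - (infty.wU a b d : FunctionRing a b d) = _
      rw [hone, sub_mul, one_mul, hinf]
      have : xK a b d * ↑(zero.wU a b d)⁻¹ = 1 := Units.mul_inv (zero.wU a b d)
      rw [this]; ring)
    have hD : D ℂ (FunctionRing a b d) (infty.wU a b d : FunctionRing a b d) =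
        -((↑(zero.wU a b d ^ (-2 : ℤ)) : FunctionRing a b d) • D ℂ _ (xK a b d)) := by
      have h2 : (infty.wU a b d : FunctionRing a b d) * xK a b d = 1 :=
        Units.inv_mul (zero.wU a b d)
      rw [Derivation.leibniz_of_mul_eq_one _ h2, neg_smul, hinf]
      congr 3
    rw [hD, smul_neg, smul_smul, ← Units.val_mul, ← neg_smul, ← algebraMap_smul (FunctionRing a b d)
      (((-1 : ℂˣ) ^ (n + 1) : ℂˣ) : ℂ), smul_smul]
    congr 1
    have h3 : algebraMap ℂ (FunctionRing a b d) (((-1 : ℂˣ) ^ (n + 1) : ℂˣ) : ℂ) =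
        (((-1 : (FunctionRing a b d)ˣ) ^ (n + 1) : (FunctionRing a b d)ˣ) : FunctionRing a b d) := by
      have : Units.map (algebraMap ℂ (FunctionRing a b d) : ℂ →* FunctionRing a b d) (-1) = -1 :=
        Units.ext (by simp)
      rw [← this, ← map_zpow]; rfl
    rw [h3, ← Units.val_neg, ← Units.val_mul]
    congr 1
    have h4 : (-(one.wU a b d * (zero.wU a b d)⁻¹)) = (-1) * (one.wU a b d * (zero.wU a b d)⁻¹) := by
      simp
    have h5 : ∀ z : (FunctionRing a b d)ˣ, -z = (-1) * z := by simp
    rw [h1, hinf, coeffU, h4, h5 (_ * zero.wU a b d ^ (-2 : ℤ))]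
    simp only [ordAt, ordAtOne, mul_zpow, inv_zpow']
    have hz : ((-1 : (FunctionRing a b d)ˣ)) ^ (n + 1) * (-1 * (-1) ^ n) = 1 := by
      rw [← zpow_one_add, ← zpow_add, add_comm 1 n, ← two_mul, zpow_mul]
      simp
    have hx : zero.wU a b d ^ (-(-m - n - 2)) * zero.wU a b d ^ (-n) * zero.wU a b d ^ (-2 : ℤ) =
        zero.wU a b d ^ m := by
      rw [← zpow_add, ← zpow_add]; congr 1; ring
    rw [← hx]
    generalize (-1 : (FunctionRing a b d)ˣ) ^ (n + 1) = r at hz ⊢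
    generalize (-1 : (FunctionRing a b d)ˣ) ^ n = r' at hz ⊢
    generalize (-1 : (FunctionRing a b d)ˣ) = r'' at hz ⊢
    generalize zero.wU a b d ^ (-(-m - n - 2)) = s1
    generalize zero.wU a b d ^ (-n) = s2
    generalize zero.wU a b d ^ (-2 : ℤ) = s3
    generalize one.wU a b d ^ n = s4
    generalize yU a b hd ^ j = s5
    calc _ = r * (r'' * r') * (s5 * (s1 * s2 * s3) * s4) := by rw [hz, one_mul]
      _ = _ := by simp only [mul_comm, mul_left_comm]

/-- The form `y ^ j w ^ m (1 - w) ^ n dw` is regular at a point over the branch point, provided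
that its order there is not negative. -/
theorem smul_D_wU_mem (hd : 0 < d) (i : Cusp) (P : Place (FunctionRing a b d))
    (hP : P.val (i.wU a b d) = ((0 : ℂ) : OnePoint ℂ)) (j m n : ℤ)
    (h : 0 ≤ j * i.k a b d + m * i.e a b d + i.e a b d - 1) :
    (↑(yU a b hd ^ j * i.wU a b d ^ m * i.oneSubU a b d ^ n) :
        FunctionRing a b d) • D ℂ _ (i.wU a b d : FunctionRing a b d) ∈
      Submodule.span P.ring (D ℂ (FunctionRing a b d) '' (P.ring : Set (FunctionRing a b d))) := by
  set w := i.wU a b d with hw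
  set y := yU a b hd with hy
  set e := i.e a b d with he
  set k := i.k a b d with hk
  have hbez : i.p a b d * k + i.q a b d * e = 1 := i.bezout hd
  set p := i.p a b d
  set q := i.q a b d
  -- `t` is a uniformizer at `P`, and `η` is a unit of the local ring
  set t : (FunctionRing a b d)ˣ := y ^ p * w ^ q with ht
  set η : (FunctionRing a b d)ˣ := y ^ (e : ℤ) * w ^ (-k) with hη
  have hte : t ^ (e : ℤ) = w * η ^ p := by
    rw [ht, hη, mul_zpow, mul_zpow, ← zpow_mul, ← zpow_mul, ← zpow_mul, ← zpow_mul,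
      mul_left_comm, ← zpow_one_add, mul_comm p]
    congr 2
    linear_combination hbez
  have hyt : y = t ^ k * η ^ q := by
    rw [ht, hη, mul_zpow, mul_zpow, ← zpow_mul, ← zpow_mul, ← zpow_mul, ← zpow_mul,
      mul_mul_mul_comm, ← zpow_add, ← zpow_add]
    have h1 : p * k + e * q = 1 := by linear_combination hbez
    have h2 : q * k + -k * q = 0 := by ring
    rw [h1, h2, zpow_one, zpow_zero, mul_one]
  clear_value t η
  have hwt : w = t ^ (e : ℤ) * η ^ (-p) := by
    rw [hte, mul_assoc, ← zpow_add, add_neg_cancel, zpow_zero, mul_one]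
  have hone : P.val (i.oneSubU a b d) = ((1 : ℂ) : OnePoint ℂ) := by
    have := P.val_sub P.val_one hP
    rwa [sub_zero] at this
  have hηg : P.val ((η : FunctionRing a b d) ^ i.g a b d) = ((i.κ b : ℂ) : OnePoint ℂ) := by
    have h1 : (η : FunctionRing a b d) ^ i.g a b d =
        algebraMap ℂ _ (i.κ b) * (i.oneSubU a b d : FunctionRing a b d) ^ i.B a b := by
      have h2 : η ^ i.g a b d = y ^ d * w ^ (-i.A a b) := by
        rw [hη, mul_pow, ← zpow_natCast, ← zpow_natCast, ← zpow_mul, ← zpow_mul, ← zpow_natCast]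
        congr 2
        · exact_mod_cast i.e_mul_g
        · rw [neg_mul, i.k_mul_g]
      rw [← Units.val_pow_eq_pow_val, h2, Units.val_mul, Units.val_pow_eq_pow_val, yU_pow hd i,
        mul_right_comm, mul_assoc _ _ (↑(w ^ (-i.A a b)) : FunctionRing a b d), ← Units.val_mul,
        ← zpow_add, add_neg_cancel, zpow_zero, Units.val_one, mul_one]
      rfl
    rw [h1]
    have := P.val_mul _ _ _ _ (P.val_algebraMap (i.κ b)) (P.val_pow hone (i.B a b))
    rwa [one_pow, mul_one] at this
  obtain ⟨v, hv⟩ := P.mem_ring_of_pow (i.g_pos hd) ⟨_, hηg⟩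
  have hv0 : v ≠ 0 := P.val_ne_zero_of_pow (i.g_pos hd) hηg (i.κ_ne_zero b) hv
  have hηm : ∀ n : ℤ, (↑(η ^ n) : FunctionRing a b d) ∈ P.ring := fun n =>
    ⟨_, P.val_zpow hv hv0 n⟩
  have htm : (t : FunctionRing a b d) ∈ P.ring := by
    refine P.mem_ring_of_pow (i.e_pos (a := a) (b := b) hd) ?_
    rw [← Units.val_pow_eq_pow_val, ← zpow_natCast, hte, Units.val_mul]
    exact mul_mem ⟨_, hP⟩ (hηm p)
  -- the differential of `w = t ^ e η⁻ᵖ`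
  obtain ⟨c, hc⟩ : ∃ c : ℕ, j * k + m * e + e - 1 = (c : ℤ) :=
    ⟨_, (Int.toNat_of_nonneg h).symm⟩
  set ρ : FunctionRing a b d := ↑(η ^ (-p)) with hρ
  have hDw : D ℂ _ (w : FunctionRing a b d) = (t : FunctionRing a b d) ^ (e - 1) •
      ((t : FunctionRing a b d) • D ℂ _ ρ + ρ • e • D ℂ _ (t : FunctionRing a b d)) := by
    rw [hwt, Units.val_mul, zpow_natCast, Units.val_pow_eq_pow_val, Derivation.leibniz,
      Derivation.leibniz_pow, smul_add, smul_smul, ← pow_succ, Nat.sub_add_cancel (i.e_pos hd),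
      smul_comm e ((t : FunctionRing a b d) ^ (e - 1)), smul_comm ρ]
  have hcoef : (↑(y ^ j * w ^ m * i.oneSubU a b d ^ n) : FunctionRing a b d) *
      (t : FunctionRing a b d) ^ (e - 1) =
      (t : FunctionRing a b d) ^ c * (↑(η ^ (q * j - p * m)) * ↑(i.oneSubU a b d ^ n)) := by
    rw [← Units.val_pow_eq_pow_val, ← Units.val_pow_eq_pow_val, ← Units.val_mul, ← Units.val_mul,
      ← Units.val_mul]
    congr 1
    have h1 : y ^ j * w ^ m = t ^ (k * j + e * m) * η ^ (q * j - p * m) := by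
      conv_lhs => rw [hwt, hyt]
      rw [mul_zpow, mul_zpow, ← zpow_mul, ← zpow_mul, ← zpow_mul, ← zpow_mul,
        mul_mul_mul_comm, ← zpow_add, ← zpow_add]
      congr 2; ring
    have h2 : t ^ c = t ^ (k * j + e * m) * t ^ (e - 1) := by
      rw [← zpow_natCast, ← zpow_natCast, ← zpow_add, ← hc, Nat.cast_sub (i.e_pos hd)]
      congr 1; push_cast; ring
    rw [h1, h2]
    simp only [mul_comm, mul_left_comm, mul_assoc]
  have hDin : ∀ f ∈ P.ring, D ℂ _ f ∈ Submodule.span P.ring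
      (D ℂ (FunctionRing a b d) '' (P.ring : Set (FunctionRing a b d))) :=
    fun f hf => Submodule.subset_span ⟨f, hf, rfl⟩
  have hsm : ∀ f ∈ P.ring, ∀ ω ∈ Submodule.span P.ring
      (D ℂ (FunctionRing a b d) '' (P.ring : Set (FunctionRing a b d))), f • ω ∈
      Submodule.span P.ring (D ℂ (FunctionRing a b d) '' (P.ring : Set (FunctionRing a b d))) :=
    fun f hf ω hω => Submodule.smul_mem _ (⟨f, hf⟩ : P.ring) hω
  rw [hDw, smul_smul, hcoef]
  refine hsm _ (mul_mem (pow_mem htm c) (mul_mem (hηm _) ⟨_, P.val_zpow hone one_ne_zero n⟩)) _ ?_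
  refine Submodule.add_mem _ (hsm _ htm _ (hDin _ (hηm _))) (hsm _ (hηm _) _ ?_)
  rw [← Nat.cast_smul_eq_nsmul P.ring]
  exact Submodule.smul_mem _ _ (hDin _ htm)

end Cusp

/-- The form `y ^ j x ^ m (1 - x) ^ n dx` is holomorphic if its orders at all points over the three
branch points are not negative. -/
theorem coeffU_smul_D_mem (hd : 0 < d) (j m n : ℤ)
    (h : ∀ i : Cusp, 0 ≤ j * i.k a b d + i.ordAt m n * i.e a b d + i.e a b d - 1) :
    (coeffU a b hd j m n : FunctionRing a b d) • D ℂ _ (xK a b d) ∈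
      holomorphicForms (FunctionRing a b d) := by
  simp only [holomorphicForms, Submodule.mem_iInf, Submodule.restrictScalars_mem]
  intro P
  by_cases hi : ∃ i : Cusp, P.val (i.wU a b d) = ((0 : ℂ) : OnePoint ℂ)
  · obtain ⟨i, hi⟩ := hi
    obtain ⟨s, hs⟩ := i.coeffU_smul_D (a := a) (b := b) hd j m n
    rw [hs, ← algebraMap_smul P.ring]
    exact Submodule.smul_mem _ _ (i.smul_D_wU_mem hd P hi j _ _ (h i))
  · push Not at hi
    rcases hx : P.val (xK a b d) with _ | u
    · exact absurd (P.val_inv_of_infty (f := Cusp.zero.wU a b d) hx) (hi Cusp.infty)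
    · have hu0 : u ≠ 0 := by rintro rfl; exact hi Cusp.zero hx
      have h1 : P.val (Cusp.one.wU a b d) = ((1 - u : ℂ) : OnePoint ℂ) := by
        have : (Cusp.one.wU a b d : FunctionRing a b d) = 1 - xK a b d := by simp [Cusp.wU]
        rw [this]
        exact P.val_sub P.val_one hx
      have hu1 : 1 - u ≠ 0 := by intro h0; rw [h0] at h1; exact hi Cusp.one h1
      have hy : P.val ((yU a b hd : FunctionRing a b d) ^ d) =
          ((u ^ a * (u - 1) ^ b : ℂ) : OnePoint ℂ) := by
        have : (yU a b hd : FunctionRing a b d) = yK a b d := rfl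
        rw [this, yK_pow]
        exact P.val_mul _ _ _ _ (P.val_pow hx a) (P.val_pow (P.val_sub hx P.val_one) b)
      obtain ⟨v, hv⟩ := P.mem_ring_of_pow hd ⟨_, hy⟩
      have hv0 : v ≠ 0 := P.val_ne_zero_of_pow hd hy
        (mul_ne_zero (pow_ne_zero _ hu0) (pow_ne_zero _ (by
          intro h0; exact hu1 (by linear_combination -h0)))) hv
      have hmem : (coeffU a b hd j m n : FunctionRing a b d) ∈ P.ring := by
        rw [coeffU, Units.val_mul, Units.val_mul]
        exact mul_mem (mul_mem ⟨_, P.val_zpow hv hv0 j⟩ ⟨_, P.val_zpow (f := Cusp.zero.wU a b d) hx hu0 m⟩)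
          ⟨_, P.val_zpow h1 hu1 n⟩
      exact Submodule.smul_mem _ (⟨_, hmem⟩ : P.ring) (Submodule.subset_span ⟨_, ⟨u, hx⟩, rfl⟩)

end Forms

/-! ### Differentials in the local parameter of a chart -/

section LocalForms

open KaehlerDifferential Filter Topology

variable {a b d : ℕ}

theorem germ_deriv_congr {F G : ℂ → ℂ} {t : ℂ}
    (h : (F : Germ (𝓝[≠] t) ℂ) = (G : Germ (𝓝[≠] t) ℂ)) :
    ((deriv F : ℂ → ℂ) : Germ (𝓝[≠] t) ℂ) = ((deriv G : ℂ → ℂ) : Germ (𝓝[≠] t) ℂ) := by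
  have h0 : ∀ᶠ s in 𝓝[≠] t, F s = G s := Germ.coe_eq.1 h
  refine Germ.coe_eq.2 ?_
  filter_upwards [eventually_eventually_nhdsWithin.2 h0, self_mem_nhdsWithin] with s hs hst
  have h1 : 𝓝[≠] t ≥ 𝓝 s ⊓ 𝓝[≠] t := inf_le_right
  refine EventuallyEq.deriv_eq ?_
  rwa [(isOpen_compl_singleton (x := t)).nhdsWithin_eq hst] at hs

/-- The expression `F(t)`, for `ω = F(t) dt`, of a rational differential in the parameter `t`. -/
theorem Chart.exists_formGerm (hd : 0 < d) (c : Chart a b d) (t : c.dom) :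
    ∃ Λ : Ω[FunctionRing a b d⁄ℂ] →+ Germ (𝓝[≠] (t : ℂ)) ℂ,
      (∀ f ω, Λ (f • ω) = c.germ hd t f * Λ ω) ∧
      ∀ f, Λ (D ℂ _ f) =
        ((deriv (fun s => evalK f (c.X s) (c.Y s)) : ℂ → ℂ) : Germ (𝓝[≠] (t : ℂ)) ℂ) := by
  let _ : Module (FunctionRing a b d) (Germ (𝓝[≠] (t : ℂ)) ℂ) := Module.compHom _ (c.germ hd t)
  have hsmul : ∀ (f : FunctionRing a b d) (z : Germ (𝓝[≠] (t : ℂ)) ℂ), f • z = c.germ hd t f * z :=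
    fun f z => rfl
  have hconst : ∀ (r : ℂ) (z : Germ (𝓝[≠] (t : ℂ)) ℂ),
      c.germ hd t (algebraMap ℂ _ r) * z = r • z := by
    intro r z
    rw [Chart.germ, evalGerm_const]
    induction z using Germ.inductionOn with
    | h f => rfl
  have : IsScalarTower ℂ (FunctionRing a b d) (Germ (𝓝[≠] (t : ℂ)) ℂ) := ⟨fun r f z => by
    rw [hsmul, hsmul, Algebra.smul_def, map_mul, mul_assoc, hconst]⟩
  have hdiff : ∀ f : FunctionRing a b d, ∀ᶠ s in 𝓝[≠] (t : ℂ),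
      DifferentiableAt ℂ (fun s => evalK f (c.X s) (c.Y s)) s := fun f =>
    (meromorphicAt_evalK (c.merX t t.2) (c.merY t t.2) f).eventually_analyticAt.mono
      fun s hs => hs.differentiableAt
  let δ : FunctionRing a b d → Germ (𝓝[≠] (t : ℂ)) ℂ := fun f =>
    ((deriv (fun s => evalK f (c.X s) (c.Y s)) : ℂ → ℂ) : Germ (𝓝[≠] (t : ℂ)) ℂ)
  have hadd : ∀ f g, δ (f + g) = δ f + δ g := by
    intro f g
    refine (germ_deriv_congr (map_add (c.germ hd t) f g)).trans (Germ.coe_eq.2 ?_)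
    filter_upwards [hdiff f, hdiff g] with s h1 h2
    exact deriv_add h1 h2
  have hmul : ∀ f g, δ (f * g) = f • δ g + g • δ f := by
    intro f g
    refine (germ_deriv_congr (map_mul (c.germ hd t) f g)).trans (Germ.coe_eq.2 ?_)
    filter_upwards [hdiff f, hdiff g] with s h1 h2
    refine (deriv_mul h1 h2).trans ?_
    ring
  have hc : ∀ r : ℂ, δ (algebraMap ℂ _ r) = 0 := by
    intro r
    refine (germ_deriv_congr (evalGerm_const hd (c.onCurve t t.2) r)).trans (Germ.coe_eq.2 ?_)
    exact Eventually.of_forall fun s => deriv_const s r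
  let Δ : Derivation ℂ (FunctionRing a b d) (Germ (𝓝[≠] (t : ℂ)) ℂ) := Derivation.mk'
    { toFun := δ
      map_add' := hadd
      map_smul' := fun r f => by
        rw [Algebra.smul_def, hmul, hc, smul_zero, add_zero, hsmul, hconst]; rfl } hmul
  refine ⟨Δ.liftKaehlerDifferential.toAddMonoidHom, fun f ω => ?_, fun f => ?_⟩
  · exact Δ.liftKaehlerDifferential.map_smul f ω
  · exact Δ.liftKaehlerDifferential_comp_D f

/-- A holomorphic differential has no pole in the parameter of a chart. -/
theorem Chart.exists_tendsto_formGerm (hd : 0 < d) (c : Chart a b d) (t : c.dom)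
    {Λ : Ω[FunctionRing a b d⁄ℂ] →+ Germ (𝓝[≠] (t : ℂ)) ℂ}
    (h1 : ∀ f ω, Λ (f • ω) = c.germ hd t f * Λ ω)
    (h2 : ∀ f, Λ (D ℂ _ f) =
        ((deriv (fun s => evalK f (c.X s) (c.Y s)) : ℂ → ℂ) : Germ (𝓝[≠] (t : ℂ)) ℂ))
    {ω : Ω[FunctionRing a b d⁄ℂ]} (hω : ω ∈ holomorphicForms (FunctionRing a b d)) :
    ∃ z : ℂ, (Λ ω).Tendsto (𝓝 z) := by
  simp only [holomorphicForms, Submodule.mem_iInf, Submodule.restrictScalars_mem] at hω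
  have hval : ∀ f ∈ (c.place hd t).ring, ∃ u : ℂ,
      Tendsto (fun s => evalK f (c.X s) (c.Y s)) (𝓝[≠] (t : ℂ)) (𝓝 u) := by
    rintro f ⟨u, hu⟩
    have := c.tendsto_place hd t f
    rw [hu] at this
    exact ⟨u, tendsto_coe_onePoint.1 this⟩
  refine Submodule.span_induction ?_ ?_ ?_ ?_ (hω (c.place hd t))
  · rintro _ ⟨f, hf, rfl⟩
    obtain ⟨u, hu⟩ := hval f hf
    have hm := meromorphicAt_evalK (c.merX t t.2) (c.merY t t.2) f
    obtain ⟨G, hG, hFG⟩ : ∃ G : ℂ → ℂ, AnalyticAt ℂ G t ∧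
        ∀ᶠ s in 𝓝[≠] (t : ℂ), evalK f (c.X s) (c.Y s) = G s := by
      have h0 : 0 ≤ meromorphicOrderAt (fun s => evalK f (c.X s) (c.Y s)) t :=
        (tendsto_nhds_iff_meromorphicOrderAt_nonneg hm).1 ⟨u, hu⟩
      refine ⟨toMeromorphicNFAt (fun s => evalK f (c.X s) (c.Y s)) t, ?_, ?_⟩
      · have h3 := meromorphicNFAt_toMeromorphicNFAt (f := fun s => evalK f (c.X s) (c.Y s)) (x := t)
        rw [← h3.meromorphicOrderAt_nonneg_iff_analyticAt,
          meromorphicOrderAt_congr hm.eq_nhdsNE_toMeromorphicNFAt.symm]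
        exact h0
      · exact hm.eq_nhdsNE_toMeromorphicNFAt
    refine ⟨deriv G t, ?_⟩
    rw [h2, germ_deriv_congr (Germ.coe_eq.2 hFG)]
    exact hG.deriv.continuousAt.tendsto.mono_left nhdsWithin_le_nhds
  · rw [map_zero]
    exact ⟨0, tendsto_const_nhds⟩
  · rintro x y _ _ ⟨z, hz⟩ ⟨z', hz'⟩
    rw [map_add]
    refine ⟨z + z', ?_⟩
    revert hz hz'
    induction Λ x using Germ.inductionOn with
    | h f => induction Λ y using Germ.inductionOn with
      | h g => exact fun hz hz' => Tendsto.add hz hz'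
  · rintro ⟨f, hf⟩ x _ ⟨z, hz⟩
    obtain ⟨u, hu⟩ := hval f hf
    refine ⟨u * z, ?_⟩
    have : Λ ((⟨f, hf⟩ : (c.place hd t).ring) • x) = c.germ hd t f * Λ x := h1 f x
    rw [this]
    revert hz
    induction Λ x using Germ.inductionOn with
    | h g => exact fun hz => Tendsto.mul hu hz

/-- The order condition on the coefficient `r` of a holomorphic form `r y ^ j x ^ m (1 - x) ^ n dx`
at the points with parameter `t` in the star around a branch point. -/
theorem Cusp.exists_tendsto_of_mem (hd : 0 < d) (i : Cusp) (j m n : ℤ) (r : RatFunc ℂ)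
    (h : (algebraMap (RatFunc ℂ) (FunctionRing a b d) r * ↑(coeffU a b hd j m n)) •
      D ℂ _ (xK a b d) ∈ holomorphicForms (FunctionRing a b d)) {t : ℂ}
    (ht : 1 - t ^ i.e a b d ∈ Complex.slitPlane) : ∃ z : ℂ,
    Tendsto (fun s : ℂ => s ^ (j * i.k a b d + i.ordAt m n * i.e a b d + i.e a b d - 1) *
      (r.num.eval (i.M (s ^ i.e a b d)) / r.denom.eval (i.M (s ^ i.e a b d)))) (𝓝[≠] t) (𝓝 z) := by
  obtain ⟨ξ, hξ⟩ : ∃ ξ : ℂ, ξ ^ d = i.κ b := IsAlgClosed.exists_pow_nat_eq _ hd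
  have hξ0 : ξ ≠ 0 := by
    rintro rfl; rw [zero_pow hd.ne'] at hξ; exact i.κ_ne_zero b hξ.symm
  set e := i.e a b d with he
  have he0 : (e : ℂ) ≠ 0 := Nat.cast_ne_zero.2 (i.e_pos hd).ne'
  set c := i.star (a := a) hd ξ hξ with hc
  let τ : c.dom := ⟨t, ht⟩
  obtain ⟨Λ, h1, h2⟩ := c.exists_formGerm hd τ
  obtain ⟨z, hz⟩ := c.exists_tendsto_formGerm hd τ h1 h2 h
  obtain ⟨s₀, hs₀⟩ := i.coeffU_smul_D (a := a) (b := b) hd j m n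
  have hu : c.germ hd τ (i.oneSubU a b d : FunctionRing a b d) =
      ((fun s => 1 - s ^ e : ℂ → ℂ) : Germ (𝓝[≠] t) ℂ) := by
    have : (i.oneSubU a b d : FunctionRing a b d) = 1 - i.wU a b d := rfl
    rw [this, map_sub, map_one, star_germ_wU]
    rfl
  have hDw : Λ (D ℂ _ (i.wU a b d : FunctionRing a b d)) =
      ((fun s => e * s ^ (e - 1) : ℂ → ℂ) : Germ (𝓝[≠] t) ℂ) := by
    rw [h2]
    refine (germ_deriv_congr (star_germ_wU hd i ξ hξ τ)).trans ?_
    refine congrArg (fun F : ℂ → ℂ => (F : Germ (𝓝[≠] t) ℂ)) (funext fun s => ?_)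
    simp [he]
  have hω : Λ ((algebraMap (RatFunc ℂ) (FunctionRing a b d) r * ↑(coeffU a b hd j m n)) •
      D ℂ _ (xK a b d)) = ((fun s => r.num.eval (i.M (s ^ e)) / r.denom.eval (i.M (s ^ e)) *
        (s₀ * (ξ ^ j * s ^ (j * i.k a b d + i.ordAt m n * e) *
        ((1 - s ^ e) ^ ((i.B a b : ℂ) / d)) ^ j * (1 - s ^ e) ^ i.ordAtOne m n *
        (e * s ^ (e - 1)))) : ℂ → ℂ) :
          Germ (𝓝[≠] t) ℂ) := by
    rw [mul_smul, hs₀, ← algebraMap_smul (FunctionRing a b d) (s₀ : ℂ), h1, h1, h1, hDw,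
      Units.val_mul, map_mul, star_germ_yU_wU, evalGerm_zpow hd _ hu, evalGerm_ratFunc,
      evalGerm_const]
    rfl
  rw [hω] at hz
  have hz' : Tendsto _ (𝓝[≠] t) (𝓝 z) := hz
  have ht0 : 1 - t ^ e ≠ 0 := Complex.slitPlane_ne_zero ht
  have hcp : ContinuousAt (fun s : ℂ => (1 - s ^ e) ^ ((i.B a b : ℂ) / d)) t :=
    ContinuousAt.cpow (by fun_prop) (by fun_prop) ht
  have hcp0 : (1 - t ^ e) ^ ((i.B a b : ℂ) / d) ≠ 0 := by
    rw [Complex.cpow_ne_zero_iff]; exact Or.inl ht0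
  have hQ : ContinuousAt (fun s : ℂ => s₀ * (ξ ^ j * ((1 - s ^ e) ^ ((i.B a b : ℂ) / d)) ^ j *
      (1 - s ^ e) ^ i.ordAtOne m n * e)) t := by
    refine ContinuousAt.mul continuousAt_const (ContinuousAt.mul ?_ continuousAt_const)
    refine ContinuousAt.mul (ContinuousAt.mul continuousAt_const (hcp.zpow₀ _ (Or.inl hcp0))) ?_
    exact ContinuousAt.zpow₀ (by fun_prop) _ (Or.inl ht0)
  have hQ0 : (s₀ : ℂ) * (ξ ^ j * ((1 - t ^ e) ^ ((i.B a b : ℂ) / d)) ^ j *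
      (1 - t ^ e) ^ i.ordAtOne m n * e) ≠ 0 :=
    mul_ne_zero s₀.ne_zero (mul_ne_zero (mul_ne_zero (mul_ne_zero (zpow_ne_zero _ hξ0)
      (zpow_ne_zero _ hcp0)) (zpow_ne_zero _ ht0)) he0)
  have hQt := (hQ.tendsto.mono_left (nhdsWithin_le_nhds (s := {t}ᶜ)))
  refine ⟨_, (hz'.div hQt hQ0).congr' ?_⟩
  filter_upwards [eventually_ne_zero t, hQt.eventually_ne hQ0] with s hs hsQ
  have h3 : s ^ (j * i.k a b d + i.ordAt m n * e + e - 1) =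
      s ^ (j * i.k a b d + i.ordAt m n * e) * s ^ (e - 1) := by
    rw [← zpow_natCast, ← zpow_add₀ hs, Nat.cast_sub (i.e_pos hd)]
    congr 1; push_cast; ring
  rw [h3]
  simp only [Pi.div_apply]
  rw [div_eq_iff hsQ]
  ring

/-- A coefficient whose form is regular over the finite part of the line is a polynomial. -/
theorem Cusp.denom_eval_ne_zero (hd : 0 < d) (i : Cusp) (hi : i ≠ infty) (j m n : ℤ) (r : RatFunc ℂ)
    (h : (algebraMap (RatFunc ℂ) (FunctionRing a b d) r * ↑(coeffU a b hd j m n)) •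
      D ℂ _ (xK a b d) ∈ holomorphicForms (FunctionRing a b d))
    (hneg : j * i.k a b d + i.ordAt m n * i.e a b d ≤ 0) {w : ℂ}
    (hw : 1 - w ∈ Complex.slitPlane) : r.denom.eval (i.M w) ≠ 0 := by
  intro h0
  obtain ⟨t, rfl⟩ : ∃ t : ℂ, t ^ i.e a b d = w := IsAlgClosed.exists_pow_nat_eq _ (i.e_pos hd)
  obtain ⟨z, hz⟩ := i.exists_tendsto_of_mem hd j m n r h hw
  set e := i.e a b d with he
  have he1 : 1 ≤ e := i.e_pos hd
  obtain ⟨ε, hM⟩ : ∃ ε : ℂ, ∀ u v : ℂ, i.M u - i.M v = ε * (u - v) := by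
    cases i
    · exact ⟨1, fun u v => by simp [M]⟩
    · exact ⟨-1, fun u v => by simp [M]⟩
    · exact absurd rfl hi
  have hMc : Continuous i.M := by
    cases i
    · exact continuous_id
    · exact continuous_const.sub continuous_id
    · exact absurd rfl hi
  -- a pole of the coefficient would be compensated by the factor `x - x₀`
  have h1 : Tendsto (fun s : ℂ => (s ^ e - t ^ e) *
      s ^ (-(j * i.k a b d + i.ordAt m n * e + e - 1))) (𝓝[≠] t) (𝓝 0) := by
    rcases eq_or_ne t 0 with rfl | ht
    · obtain ⟨N, hN⟩ : ∃ N : ℕ, 1 - (j * i.k a b d + i.ordAt m n * e) = N :=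
        ⟨_, (Int.toNat_of_nonneg (by linarith)).symm⟩
      have hN0 : N ≠ 0 := by rintro rfl; push_cast at hN; linarith
      have h2 : Tendsto (fun s : ℂ => s ^ N) (𝓝[≠] 0) (𝓝 0) := by
        have : Tendsto (fun s : ℂ => s ^ N) (𝓝 0) (𝓝 (0 ^ N)) := (continuous_pow N).tendsto 0
        rw [zero_pow hN0] at this
        exact this.mono_left nhdsWithin_le_nhds
      refine h2.congr' ?_
      filter_upwards [self_mem_nhdsWithin] with s hs
      rw [zero_pow (by omega), sub_zero, ← zpow_natCast, ← zpow_natCast, ← zpow_add₀ hs, ← hN]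
      congr 1; ring
    · have h2 : ContinuousAt (fun s : ℂ => (s ^ e - t ^ e) *
          s ^ (-(j * i.k a b d + i.ordAt m n * e + e - 1))) t :=
        ContinuousAt.mul (by fun_prop) (continuousAt_id.zpow₀ _ (Or.inl ht))
      have h3 := h2.tendsto.mono_left (nhdsWithin_le_nhds (s := {t}ᶜ))
      simpa using h3
  obtain ⟨q, hq⟩ := Polynomial.dvd_iff_isRoot.2 h0
  have hcof := tendsto_M_pow (a := a) (b := b) hd i t
  have hq0 : q ≠ 0 := by rintro rfl; exact r.denom_ne_zero (by rw [hq, mul_zero])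
  have hx : Tendsto (fun s : ℂ => i.M (s ^ e)) (𝓝[≠] t) (𝓝 (i.M (t ^ e))) := by
    have : Continuous fun s : ℂ => i.M (s ^ e) := hMc.comp (continuous_pow e)
    exact (this.tendsto t).mono_left nhdsWithin_le_nhds
  have h4 : Tendsto (fun s : ℂ => q.eval (i.M (s ^ e)) * (ε *
      (((s ^ e - t ^ e) * s ^ (-(j * i.k a b d + i.ordAt m n * e + e - 1))) *
      (s ^ (j * i.k a b d + i.ordAt m n * e + e - 1) *
      (r.num.eval (i.M (s ^ e)) / r.denom.eval (i.M (s ^ e))))))) (𝓝[≠] t) (𝓝 0) := by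
    have := ((q.continuous.tendsto _).comp hx).mul ((h1.mul hz).const_mul ε)
    simpa using this
  have h5 : Tendsto (fun s : ℂ => r.num.eval (i.M (s ^ e))) (𝓝[≠] t) (𝓝 0) := by
    refine h4.congr' ?_
    filter_upwards [eventually_ne_zero t, hcof.eventually (eventually_eval_ne_zero r.denom_ne_zero)]
      with s hs hden
    rw [mul_assoc (s ^ e - t ^ e), zpow_neg, inv_mul_cancel_left₀ (zpow_ne_zero _ hs),
      ← mul_assoc ε, ← hM]
    have h6 : r.denom.eval (i.M (s ^ e)) = (i.M (s ^ e) - i.M (t ^ e)) * q.eval (i.M (s ^ e)) := by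
      conv_lhs => rw [hq]
      simp
    rw [← he] at hden
    rw [← mul_assoc, mul_comm (q.eval _), ← h6, mul_div_cancel₀ _ hden]
  have h7 : r.num.eval (i.M (t ^ e)) = 0 :=
    tendsto_nhds_unique ((r.num.continuous.tendsto _).comp hx) h5
  have h8 := RatFunc.isCoprime_num_denom r
  obtain ⟨u, v, huv⟩ := h8
  have h9 := congrArg (Polynomial.eval (i.M (t ^ e))) huv
  rw [Polynomial.eval_add, Polynomial.eval_mul, Polynomial.eval_mul, h7, h0] at h9
  simp at h9

/-- The coefficient of a holomorphic form is a polynomial, whose degree is bounded by the order of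
the form at the points over `∞`. -/
theorem exists_polynomial_of_mem (hd : 0 < d) (j m n : ℤ) (r : RatFunc ℂ) (hr : r ≠ 0)
    (h : (algebraMap (RatFunc ℂ) (FunctionRing a b d) r * ↑(coeffU a b hd j m n)) •
      D ℂ _ (xK a b d) ∈ holomorphicForms (FunctionRing a b d))
    (h0 : j * Cusp.zero.k a b d + m * Cusp.zero.e a b d ≤ 0)
    (h1 : j * Cusp.one.k a b d + n * Cusp.one.e a b d ≤ 0) :
    ∃ p : Polynomial ℂ, r = algebraMap _ _ p ∧ (p.natDegree : ℤ) * Cusp.infty.e a b d ≤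
      j * Cusp.infty.k a b d + Cusp.infty.ordAt m n * Cusp.infty.e a b d +
        Cusp.infty.e a b d - 1 := by
  have hroot : ∀ x : ℂ, r.denom.eval x ≠ 0 := by
    intro x
    by_cases hx : 1 - x ∈ Complex.slitPlane
    · exact Cusp.zero.denom_eval_ne_zero hd (by simp) j m n r h h0 hx
    · have hx' : 1 - (1 - x) ∈ Complex.slitPlane := by
        rw [Complex.mem_slitPlane_iff, not_or] at hx
        simp only [Complex.sub_re, Complex.one_re, Complex.sub_im, Complex.one_im] at hx
        rw [sub_sub_cancel, Complex.mem_slitPlane_iff]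
        left; linarith [hx.1]
      have := Cusp.one.denom_eval_ne_zero hd (by simp) j m n r h h1 hx'
      simpa [Cusp.M] using this
  have hden : r.denom = 1 := by
    refine (Polynomial.Monic.natDegree_eq_zero (RatFunc.monic_denom r)).1 ?_
    by_contra hne
    obtain ⟨x, hx⟩ := IsAlgClosed.exists_root r.denom
      (fun hdeg => hne (Polynomial.natDegree_eq_of_degree_eq_some hdeg))
    exact hroot x hx
  refine ⟨r.num, ?_, ?_⟩
  · conv_lhs => rw [← RatFunc.num_div_denom r, hden, map_one, div_one]
  set e := Cusp.infty.e a b d with he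
  set N := j * Cusp.infty.k a b d + Cusp.infty.ordAt m n * e + e - 1 with hN
  by_contra! hlt
  obtain ⟨z, hz⟩ := Cusp.infty.exists_tendsto_of_mem hd j m n r h (t := 0) (by
    rw [zero_pow (Cusp.infty.e_pos hd).ne', sub_zero]; exact Complex.one_mem_slitPlane)
  rw [hden, ← hN, ← he] at hz
  obtain ⟨c, hc⟩ : ∃ c : ℕ, (r.num.natDegree : ℤ) * e - N = c :=
    ⟨_, (Int.toNat_of_nonneg (by linarith)).symm⟩
  have hc0 : c ≠ 0 := by rintro rfl; push_cast at hc; linarith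
  have hpow : Tendsto (fun s : ℂ => s ^ c) (𝓝[≠] 0) (𝓝 0) := by
    have : Tendsto (fun s : ℂ => s ^ c) (𝓝 0) (𝓝 (0 ^ c)) := (continuous_pow c).tendsto 0
    rw [zero_pow hc0] at this
    exact this.mono_left nhdsWithin_le_nhds
  have h2 := hpow.mul hz
  rw [zero_mul] at h2
  have h3 : Tendsto (fun s : ℂ => r.num.reverse.eval (s ^ e)) (𝓝[≠] 0) (𝓝 0) := by
    refine h2.congr' ?_
    filter_upwards [self_mem_nhdsWithin] with s hs
    have hs0 : s ≠ 0 := hs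
    rw [Polynomial.eval_one, div_one, ← mul_assoc, ← zpow_natCast, ← zpow_add₀ hs0, ← hc,
      sub_add_cancel]
    have := invertibleOfNonzero (inv_ne_zero (pow_ne_zero e hs0))
    have h4 := Polynomial.eval₂_reverse_mul_pow (RingHom.id ℂ) ((s ^ e)⁻¹) r.num
    rw [invOf_eq_inv, inv_inv, inv_pow, mul_inv_eq_iff_eq_mul₀ (by positivity)] at h4
    rw [mul_comm, mul_comm _ (e : ℤ), zpow_mul, zpow_natCast, zpow_natCast]
    exact h4.symm
  have h5 : Tendsto (fun s : ℂ => r.num.reverse.eval (s ^ e)) (𝓝[≠] 0)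
      (𝓝 (r.num.reverse.eval (0 ^ e))) := by
    have : Continuous fun s : ℂ => r.num.reverse.eval (s ^ e) :=
      r.num.reverse.continuous.comp (continuous_pow e)
    exact (this.tendsto 0).mono_left nhdsWithin_le_nhds
  have h6 := tendsto_nhds_unique h5 h3
  rw [zero_pow (Cusp.infty.e_pos hd).ne', ← Polynomial.coeff_zero_eq_eval_zero,
    Polynomial.coeff_zero_reverse, Polynomial.leadingCoeff_eq_zero, RatFunc.num_eq_zero_iff] at h6
  exact hr h6

end LocalForms

/-! ### Holomorphic forms -/

section HolomorphicForms

open KaehlerDifferential Filter Topology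

variable {a b d : ℕ}

theorem D_xK_ne_zero (hd : 0 < d) : D ℂ (FunctionRing a b d) (xK a b d) ≠ 0 := by
  intro h0
  obtain ⟨ξ, hξ⟩ : ∃ ξ : ℂ, ξ ^ d = Cusp.zero.κ b := IsAlgClosed.exists_pow_nat_eq _ hd
  have he := Cusp.zero.e_pos (a := a) (b := b) hd
  let t : (Cusp.zero.star (a := a) hd ξ hξ).dom := ⟨0, by
    change 1 - (0 : ℂ) ^ _ ∈ Complex.slitPlane
    rw [zero_pow he.ne', sub_zero]; exact Complex.one_mem_slitPlane⟩
  obtain ⟨Λ, h1, h2⟩ := (Cusp.zero.star (a := a) hd ξ hξ).exists_formGerm hd t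
  have h3 := h2 (xK a b d)
  rw [h0, map_zero] at h3
  have h3 := h3.trans (germ_deriv_congr (Cusp.star_germ_wU hd Cusp.zero ξ hξ t))
  have h4 : ∀ᶠ s in 𝓝[≠] (0 : ℂ), 0 = deriv (fun s : ℂ => s ^ Cusp.zero.e a b d) s :=
    Germ.coe_eq.1 h3
  obtain ⟨s, hs, hs0⟩ := (h4.and self_mem_nhdsWithin).exists
  simp only [deriv_pow_field] at hs
  exact mul_ne_zero (Nat.cast_ne_zero.2 he.ne') (pow_ne_zero _ hs0) hs.symm

theorem Cusp.deck_wU_zpow (i : Cusp) (l : ℤ) :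
    deck a b d ↑(i.wU a b d ^ l) = ↑(i.wU a b d ^ l) := by
  have h1 : Units.map (deck a b d : FunctionRing a b d →* FunctionRing a b d)
      (i.wU a b d) = i.wU a b d := Units.ext i.deck_wU
  have h2 := congrArg (fun u => ((u ^ l : (FunctionRing a b d)ˣ) : FunctionRing a b d)) h1
  simp only [← map_zpow] at h2
  exact h2

theorem pullback_deck_pow_smul_D (k : ℕ) (h : FunctionRing a b d) :
    (pullback (deck a b d) ^ k) (h • D ℂ _ (xK a b d)) =
      (deckLin a b d ^ k) h • D ℂ _ (xK a b d) := by
  induction k with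
  | zero => rfl
  | succ k ih =>
    rw [pow_succ', Module.End.mul_apply, ih, pullback_deck_smul_D, pow_succ', Module.End.mul_apply]
    rfl

theorem pullbackHolomorphic_deck_pow_coe (k : ℕ) (ω : holomorphicForms (FunctionRing a b d)) :
    (((pullbackHolomorphic (deck a b d) ^ k) ω : holomorphicForms (FunctionRing a b d)) :
      Ω[FunctionRing a b d⁄ℂ]) = (pullback (deck a b d) ^ k) ω := by
  induction k with
  | zero => rfl
  | succ k ih =>
    rw [pow_succ', Module.End.mul_apply, pow_succ', Module.End.mul_apply, ← ih]
    rfl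

theorem pullbackHolomorphic_deck_pow_self (hd : 0 < d) :
    pullbackHolomorphic (deck a b d) ^ d = 1 := by
  ext ω
  obtain ⟨h, hh⟩ := exists_eq_smul_D hd (ω : Ω[FunctionRing a b d⁄ℂ])
  rw [pullbackHolomorphic_deck_pow_coe, hh, pullback_deck_pow_smul_D, deckLin_pow_self]
  exact hh.symm

/-- A form in an eigenspace of the deck transformation is a multiple of any given form in the same
eigenspace by a rational function of `x`. -/
theorem exists_ratFunc_of_pullback_eq (hd : 0 < d) (j m n : ℤ) {ω : Ω[FunctionRing a b d⁄ℂ]}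
    (hω : pullback (deck a b d) ω = omega d ^ j • ω) : ∃ r : RatFunc ℂ,
    ω = (algebraMap (RatFunc ℂ) (FunctionRing a b d) r * ↑(coeffU a b hd j m n)) •
      D ℂ _ (xK a b d) := by
  have hμ : (omega d ^ j) ^ d = 1 := by
    rw [← zpow_natCast, ← zpow_mul, mul_comm, zpow_mul, zpow_natCast, omega_pow, one_zpow]
  obtain ⟨h, hh⟩ := exists_eq_smul_D hd ω
  set f := eigenProj (deckLin a b d) d (omega d ^ j) h with hf
  have hf1 : deck a b d f = omega d ^ j • f := apply_eigenProj deckLin_pow_self hμ hd h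
  have hωf : ω = f • D ℂ _ (xK a b d) := by
    rw [← eigenProj_eq_self hd hμ hω, hf, eigenProj_apply, eigenProj_apply, smul_assoc,
      Finset.sum_smul]
    congr 1
    refine Finset.sum_congr rfl fun k _ => ?_
    rw [smul_assoc, hh, pullback_deck_pow_smul_D]
  have hg : deck a b d (f * ↑(Cusp.zero.wU a b d ^ (-m)) * ↑(Cusp.one.wU a b d ^ (-n))) =
      omega d ^ j • (f * ↑(Cusp.zero.wU a b d ^ (-m)) * ↑(Cusp.one.wU a b d ^ (-n))) := by
    rw [map_mul, map_mul, Cusp.deck_wU_zpow, Cusp.deck_wU_zpow, hf1, smul_mul_assoc, smul_mul_assoc]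
  obtain ⟨r, hr⟩ := exists_eq_smul_of_deck_eq hd j hg
  refine ⟨r, ?_⟩
  rw [hωf, coeffU, Units.val_mul, Units.val_mul, ← mul_assoc, ← mul_assoc, ← hr,
    mul_right_comm _ _ (↑(Cusp.zero.wU a b d ^ m) : FunctionRing a b d), mul_assoc f,
    ← Units.val_mul, ← zpow_add, neg_add_cancel, mul_assoc, ← Units.val_mul, ← zpow_add,
    neg_add_cancel]
  simp

/-! #### The dimensions of the eigenspaces -/

/-- The number `-([-aj/d] + [-bj/d] + [(a+b)j/d] + 1)`. -/
def multiplicity (a b d : ℕ) (j : ℤ) : ℤ :=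
  -((-(a * j)) / d + (-(b * j)) / d + ((a + b) * j) / d + 1)

theorem Cusp.mul_k_add_le_iff (hd : 0 < d) (i : Cusp) (j m : ℤ) (x : ℤ) :
    x * i.e a b d < j * i.k a b d + m * i.e a b d ↔ x * d < j * i.A a b + m * d := by
  have hd' : (0 : ℤ) < d := by exact_mod_cast hd
  have he' : (0 : ℤ) < i.e a b d := by exact_mod_cast i.e_pos hd
  have hk := i.k_mul_d (a := a) (b := b) (d := d)
  rw [← mul_lt_mul_iff_left₀ hd', ← mul_lt_mul_iff_left₀ (b := x * d) he']
  have : (j * i.k a b d + m * i.e a b d) * d = (j * i.A a b + m * d) * i.e a b d := by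
    linear_combination j * hk
  rw [this, mul_right_comm x]

theorem ediv_bounds (hd : 0 < d) (x : ℤ) : x / d * d ≤ x ∧ x < (x / d + 1) * d := by
  have hd' : (0 : ℤ) < d := by exact_mod_cast hd
  exact ⟨Int.ediv_mul_le x hd'.ne', Int.lt_ediv_add_one_mul_self x hd'⟩

theorem multiplicity_le_one (hd : 0 < d) (j : ℤ) : multiplicity a b d j ≤ 1 := by
  have hd' : (0 : ℤ) < d := by exact_mod_cast hd
  have h1 := ediv_bounds hd (-(a * j))
  have h2 := ediv_bounds hd (-(b * j))
  have h3 := ediv_bounds hd ((a + b) * j)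
  rw [multiplicity]
  by_contra! h
  nlinarith

theorem multiplicity_nonneg (hd : 0 < d) (j : ℤ) (h : ¬ ((d : ℤ) ∣ a * j ∧ (d : ℤ) ∣ b * j)) :
    0 ≤ multiplicity a b d j := by
  have hd' : (0 : ℤ) < d := by exact_mod_cast hd
  have h1 := ediv_bounds hd (-(a * j))
  have h2 := ediv_bounds hd (-(b * j))
  have h3 := ediv_bounds hd ((a + b) * j)
  rw [multiplicity]
  by_contra! h0
  -- the three roundings add up to zero, so that none of them rounds
  have h4 : 0 ≤ ((-(a * j)) / d + (-(b * j)) / d + ((a + b) * j) / d) * (d : ℤ) :=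
    mul_nonneg (by linarith) hd'.le
  refine h ⟨?_, ?_⟩
  · refine (dvd_neg).1 ⟨(-(a * j)) / d, ?_⟩
    linarith
  · refine (dvd_neg).1 ⟨(-(b * j)) / d, ?_⟩
    linarith

theorem multiplicity_of_dvd (hd : 0 < d) (j : ℤ) (h : (d : ℤ) ∣ a * j ∧ (d : ℤ) ∣ b * j) :
    multiplicity a b d j = -1 := by
  have hd' : (d : ℤ) ≠ 0 := by exact_mod_cast hd.ne'
  obtain ⟨⟨u, hu⟩, ⟨v, hv⟩⟩ := h
  rw [multiplicity, add_mul, hu, hv, ← mul_add, ← mul_neg, ← mul_neg,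
    Int.mul_ediv_cancel_left _ hd', Int.mul_ediv_cancel_left _ hd', Int.mul_ediv_cancel_left _ hd']
  ring

variable (a b) in
/-- The holomorphic form `y ^ j x ^ [-aj/d] (1 - x) ^ [-bj/d] dx`. -/
def eigenform (hd : 0 < d) (j : ℤ) : Ω[FunctionRing a b d⁄ℂ] :=
  (coeffU a b hd j ((-(a * j)) / d) ((-(b * j)) / d) : FunctionRing a b d) • D ℂ _ (xK a b d)

theorem eigenform_ne_zero (hd : 0 < d) (j : ℤ) : eigenform a b hd j ≠ 0 := by
  intro h
  have h1 := congrArg (fun ω => (↑(coeffU a b hd j ((-(a * j)) / d) ((-(b * j)) / d))⁻¹ :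
    FunctionRing a b d) • ω) h
  simp only [eigenform, smul_smul, Units.inv_mul, one_smul, smul_zero] at h1
  exact D_xK_ne_zero hd h1

theorem pullback_eigenform (hd : 0 < d) (j : ℤ) :
    pullback (deck a b d) (eigenform a b hd j) = omega d ^ j • eigenform a b hd j := by
  rw [eigenform, pullback_deck_smul_D, ← algebraMap_smul (FunctionRing a b d) (omega d ^ j),
    smul_smul]
  congr 1
  rw [coeffU, Units.val_mul, Units.val_mul, map_mul, map_mul, Cusp.deck_wU_zpow, Cusp.deck_wU_zpow, deck_yU_zpow, mul_assoc,
    mul_assoc, mul_assoc]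

theorem eigenform_mem (hd : 0 < d) (j : ℤ) (hj : multiplicity a b d j = 1) :
    eigenform a b hd j ∈ holomorphicForms (FunctionRing a b d) := by
  have h1 := ediv_bounds hd (-(a * j))
  have h2 := ediv_bounds hd (-(b * j))
  have h3 := ediv_bounds hd ((a + b) * j)
  rw [multiplicity] at hj
  refine coeffU_smul_D_mem hd j _ _ fun i => ?_
  have key : (-1 : ℤ) * i.e a b d < j * i.k a b d +
      i.ordAt ((-(a * j)) / d) ((-(b * j)) / d) * i.e a b d := by
    rw [i.mul_k_add_le_iff hd]
    cases i <;> simp only [Cusp.A, Cusp.ordAt] <;> nlinarith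
  linarith

/-- A form in the eigenspace for `ζ ^ j` which is holomorphic is a multiple of the standard one. -/
theorem eq_smul_eigenform (hd : 0 < d) (j : ℤ) {ω : Ω[FunctionRing a b d⁄ℂ]}
    (hω : ω ∈ holomorphicForms (FunctionRing a b d))
    (hT : pullback (deck a b d) ω = omega d ^ j • ω) (h0 : ω ≠ 0) :
    0 < multiplicity a b d j ∧ ∃ c : ℂ, ω = c • eigenform a b hd j := by
  obtain ⟨r, rfl⟩ := exists_ratFunc_of_pullback_eq hd j ((-(a * j)) / d) ((-(b * j)) / d) hT
  have hr : r ≠ 0 := by rintro rfl; simp at h0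
  have h1 := ediv_bounds hd (-(a * j))
  have h2 := ediv_bounds hd (-(b * j))
  have h3 := ediv_bounds hd ((a + b) * j)
  have hz : ∀ i : Cusp, i ≠ Cusp.infty → j * i.k a b d +
      i.ordAt ((-(a * j)) / d) ((-(b * j)) / d) * i.e a b d ≤ 0 := by
    intro i hi
    by_contra! hlt
    have h4 := (i.mul_k_add_le_iff (a := a) (b := b) hd j
      (i.ordAt ((-(a * j)) / d) ((-(b * j)) / d)) 0).1 (by rwa [zero_mul])
    cases i
    · simp only [Cusp.A, Cusp.ordAt] at h4; linarith
    · simp only [Cusp.A, Cusp.ordAt] at h4; linarith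
    · exact hi rfl
  obtain ⟨p, rfl, hp⟩ := exists_polynomial_of_mem hd j _ _ r hr hω (hz Cusp.zero (by simp))
    (hz Cusp.one (by simp))
  have h5 := (Cusp.infty.mul_k_add_le_iff (a := a) (b := b) hd j
    (Cusp.infty.ordAt ((-(a * j)) / d) ((-(b * j)) / d) + 1) p.natDegree).1 (by linarith)
  simp only [Cusp.A, Cusp.ordAt] at h5
  have hd' : (0 : ℤ) < d := by exact_mod_cast hd
  have h6 : (p.natDegree : ℤ) < multiplicity a b d j := by
    rw [multiplicity]
    refine lt_of_mul_lt_mul_right ?_ hd'.le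
    linarith
  have h7 := multiplicity_le_one (a := a) (b := b) hd j
  have h8 : p.natDegree = 0 := by omega
  refine ⟨by omega, p.coeff 0, ?_⟩
  rw [eigenform, mul_smul, ← algebraMap_smul (FunctionRing a b d) (p.coeff 0)]
  congr 1
  conv_lhs => rw [Polynomial.eq_C_of_natDegree_eq_zero h8]
  rw [RatFunc.algebraMap_C]
  rfl

theorem mem_eigenspace_iff (j : ℤ) (ω : holomorphicForms (FunctionRing a b d)) :
    ω ∈ (pullbackHolomorphic (deck a b d)).eigenspace (omega d ^ j) ↔
      pullback (deck a b d) ω = omega d ^ j • (ω : Ω[FunctionRing a b d⁄ℂ]) := by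
  rw [Module.End.mem_eigenspace_iff, ← Subtype.coe_inj]
  rfl

theorem eigenspace_eq_bot (hd : 0 < d) (j : ℤ) (hj : multiplicity a b d j ≠ 1) :
    (pullbackHolomorphic (deck a b d)).eigenspace (omega d ^ j) = ⊥ := by
  refine (Submodule.eq_bot_iff _).2 fun ω hω => ?_
  rw [mem_eigenspace_iff] at hω
  by_contra h0
  have h1 := (eq_smul_eigenform hd j ω.2 hω (fun h => h0 (Subtype.ext h))).1
  have h2 := multiplicity_le_one (a := a) (b := b) hd j
  omega

theorem eigenspace_eq_span (hd : 0 < d) (j : ℤ) (hj : multiplicity a b d j = 1) :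
    (pullbackHolomorphic (deck a b d)).eigenspace (omega d ^ j) =
      Submodule.span ℂ {⟨eigenform a b hd j, eigenform_mem hd j hj⟩} := by
  refine le_antisymm (fun ω hω => ?_) ?_
  · rw [mem_eigenspace_iff] at hω
    rcases eq_or_ne (ω : Ω[FunctionRing a b d⁄ℂ]) 0 with h0 | h0
    · rw [Subtype.ext h0 (a1 := ω) (a2 := 0)]
      exact Submodule.zero_mem _
    · obtain ⟨-, c, hc⟩ := eq_smul_eigenform hd j ω.2 hω h0
      exact Submodule.mem_span_singleton.2 ⟨c, Subtype.ext hc.symm⟩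
  · rw [Submodule.span_singleton_le_iff_mem, mem_eigenspace_iff]
    exact pullback_eigenform hd j

theorem finite_holomorphicForms (hd : 0 < d) :
    Module.Finite ℂ (holomorphicForms (FunctionRing a b d)) := by
  refine finite_of_finite_eigenspace hd (pullbackHolomorphic_deck_pow_self hd) fun j => ?_
  rw [← zpow_natCast]
  by_cases hj : multiplicity a b d j = 1
  · rw [eigenspace_eq_span hd j hj]
    infer_instance
  · rw [eigenspace_eq_bot hd j hj]
    infer_instance

theorem finrank_eigenspace (hd : 0 < d) (j : ℤ) :
    Module.finrank ℂ ((pullbackHolomorphic (deck a b d)).eigenspace (omega d ^ j)) =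
      if multiplicity a b d j = 1 then 1 else 0 := by
  split_ifs with hj
  · rw [eigenspace_eq_span hd j hj]
    refine finrank_span_singleton fun h => ?_
    exact eigenform_ne_zero (a := a) (b := b) hd j (congrArg Subtype.val h)
  · rw [eigenspace_eq_bot hd j hj, finrank_bot]

/-- The multiplicities of the eigenvalues of the deck transformation on holomorphic forms. -/
theorem rootMultiplicity_holomorphicForms (hd : 0 < d)
    [Module.Finite ℂ (holomorphicForms (FunctionRing a b d))] (j : ℤ) :
    (pullbackHolomorphic (deck a b d)).charpoly.rootMultiplicity
      (Complex.exp (2 * Real.pi * Complex.I * j / d)) =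
        if multiplicity a b d j = 1 then 1 else 0 := by
  have h : Complex.exp (2 * Real.pi * Complex.I * j / d) = omega d ^ j := by
    rw [omega, ← Complex.exp_int_mul]
    congr 1; ring
  rw [h, rootMultiplicity_charpoly_of_pow_eq_one hd (pullbackHolomorphic_deck_pow_self hd),
    finrank_eigenspace hd]

theorem multiplicity_eq_floor (j : ℤ) : multiplicity a b d j =
    -(⌊-((a * j : ℚ) / d)⌋ + ⌊-((b * j : ℚ) / d)⌋ + ⌊((a + b) * j : ℚ) / d⌋ + 1) := by
  have h : ∀ x : ℤ, ⌊(x : ℚ) / d⌋ = x / d := fun x => Rat.floor_intCast_div_natCast x d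
  have h1 := h (-(a * j))
  have h2 := h (-(b * j))
  have h3 := h ((a + b) * j)
  push_cast at h1 h2 h3
  rw [neg_div] at h1 h2
  rw [multiplicity, h1, h2, h3]

end HolomorphicForms

/-! ### The deck transformations act transitively on the fibres of `x` -/

section Transitivity

variable {a b d : ℕ}

namespace Place

variable (P Q : Place (FunctionRing a b d))

theorem val_aeval {K : Type} [CommRing K] [Algebra ℂ K] (P : Place K) {f : K} {u : ℂ}
    (h : P.val f = (u : OnePoint ℂ)) (p : Polynomial ℂ) :
    P.val (Polynomial.aeval f p) = ((p.eval u : ℂ) : OnePoint ℂ) := by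
  induction p using Polynomial.induction_on' with
  | add p q hp hq =>
    rw [map_add, Polynomial.eval_add]
    exact P.val_add _ _ _ _ hp hq
  | monomial n c =>
    rw [Polynomial.aeval_monomial, Polynomial.eval_monomial]
    exact P.val_mul _ _ _ _ (P.val_algebraMap c) (P.val_pow h n)

theorem algebraMap_polynomial (p : Polynomial ℂ) :
    algebraMap (RatFunc ℂ) (FunctionRing a b d) (algebraMap _ _ p) =
      Polynomial.aeval (xK a b d) p := by
  rw [xK, Polynomial.aeval_algebraMap_apply, ← RatFunc.algebraMap_X,
    Polynomial.aeval_algebraMap_apply, Polynomial.aeval_X_left_apply]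

/-- A nonzero polynomial in `x` as a unit. -/
def polyU (a b d : ℕ) {p : Polynomial ℂ} (hp : p ≠ 0) : (FunctionRing a b d)ˣ :=
  ((IsUnit.mk0 _ (RatFunc.algebraMap_ne_zero hp)).map
    (algebraMap (RatFunc ℂ) (FunctionRing a b d))).unit

theorem coe_polyU {p : Polynomial ℂ} (hp : p ≠ 0) :
    (polyU a b d hp : FunctionRing a b d) = Polynomial.aeval (xK a b d) p :=
  algebraMap_polynomial p

theorem algebraMap_mul_polyU (r : RatFunc ℂ) :
    algebraMap (RatFunc ℂ) (FunctionRing a b d) r * polyU a b d r.denom_ne_zero =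
      Polynomial.aeval (xK a b d) r.num := by
  rw [← algebraMap_polynomial]
  change _ * algebraMap (RatFunc ℂ) (FunctionRing a b d) _ = _
  rw [← map_mul]
  congr 1
  rw [← eq_div_iff (RatFunc.algebraMap_ne_zero r.denom_ne_zero)]
  exact (RatFunc.num_div_denom r).symm

theorem aeval_mul_pow_reverse (p : Polynomial ℂ) :
    Polynomial.aeval (xK a b d) p * (Cusp.infty.wU a b d : FunctionRing a b d) ^ p.natDegree =
      Polynomial.aeval (Cusp.infty.wU a b d : FunctionRing a b d) p.reverse := by
  have h1 : xK a b d * (Cusp.infty.wU a b d : FunctionRing a b d) = 1 :=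
    (isUnit_xK (a := a) (b := b) (d := d)).mul_val_inv
  have h2 : (Cusp.infty.wU a b d : FunctionRing a b d) * xK a b d = 1 := by rw [mul_comm, h1]
  let _ : Invertible (xK a b d) := ⟨_, h2, h1⟩
  have h3 := Polynomial.eval₂_reverse_mul_pow (algebraMap ℂ (FunctionRing a b d)) (xK a b d) p
  have h4 : (⅟(xK a b d)) = (Cusp.infty.wU a b d : FunctionRing a b d) := rfl
  rw [h4] at h3
  rw [Polynomial.aeval_def, Polynomial.aeval_def, ← h3, mul_assoc, ← mul_pow, h1, one_pow, mul_one]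

/-- Whether a rational function of `x` is finite at a point depends only on the value of `x`. -/
theorem algebraMap_mem_ring (h : P.val (xK a b d) = Q.val (xK a b d)) {r : RatFunc ℂ}
    (hr : algebraMap (RatFunc ℂ) (FunctionRing a b d) r ∈ Q.ring) :
    algebraMap (RatFunc ℂ) (FunctionRing a b d) r ∈ P.ring := by
  rcases eq_or_ne r 0 with rfl | hr0
  · rw [map_zero]; exact zero_mem _
  obtain ⟨v, hv⟩ := hr
  have hnd := algebraMap_mul_polyU (a := a) (b := b) (d := d) r
  have hrinv : algebraMap (RatFunc ℂ) (FunctionRing a b d) r =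
      Polynomial.aeval (xK a b d) r.num * ↑(polyU a b d r.denom_ne_zero)⁻¹ := by
    rw [← hnd, mul_assoc, Units.mul_inv, mul_one]
  rcases hx : Q.val (xK a b d) with _ | u
  · have hw : Q.val (Cusp.infty.wU a b d) = ((0 : ℂ) : OnePoint ℂ) :=
      Q.val_inv_of_infty (f := Cusp.zero.wU a b d) hx
    have hw' : P.val (Cusp.infty.wU a b d) = ((0 : ℂ) : OnePoint ℂ) :=
      P.val_inv_of_infty (f := Cusp.zero.wU a b d) (h.trans hx)
    have hrev : ∀ p : Polynomial ℂ, p.reverse.eval 0 = p.leadingCoeff := fun p => by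
      rw [← Polynomial.coeff_zero_eq_eval_zero, Polynomial.coeff_zero_reverse]
    have h1 := aeval_mul_pow_reverse (a := a) (b := b) (d := d) r.num
    have h2 := aeval_mul_pow_reverse (a := a) (b := b) (d := d) r.denom
    set w := Cusp.infty.wU a b d with hwdef
    -- compare the orders of the numerator and of the denominator at `∞`
    have hle : r.num.natDegree ≤ r.denom.natDegree := by
      by_contra! hlt
      have h3 : Polynomial.aeval (w : FunctionRing a b d) r.num.reverse =
          algebraMap (RatFunc ℂ) (FunctionRing a b d) r *
            Polynomial.aeval (w : FunctionRing a b d) r.denom.reverse *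
              (w : FunctionRing a b d) ^ (r.num.natDegree - r.denom.natDegree) := by
        rw [← h1, ← h2, ← hnd, coe_polyU, mul_assoc, mul_assoc, mul_assoc, ← pow_add,
          Nat.add_sub_cancel' hlt.le]
      have h4 := Q.val_mul _ _ _ _ (Q.val_mul _ _ _ _ hv (Q.val_aeval hw r.denom.reverse))
        (Q.val_pow hw (r.num.natDegree - r.denom.natDegree))
      rw [← h3, Q.val_aeval hw, zero_pow (by omega), mul_zero, hrev] at h4
      have h5 : r.num.leadingCoeff = 0 := OnePoint.coe_injective h4
      rw [Polynomial.leadingCoeff_eq_zero, RatFunc.num_eq_zero_iff] at h5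
      exact hr0 h5
    set D : (FunctionRing a b d)ˣ := polyU a b d r.denom_ne_zero * w ^ r.denom.natDegree with hD
    have hDval : P.val (D : FunctionRing a b d) = ((1 : ℂ) : OnePoint ℂ) := by
      rw [hD, Units.val_mul, coe_polyU, Units.val_pow_eq_pow_val, h2, P.val_aeval hw', hrev]
      rw [(RatFunc.monic_denom r).leadingCoeff]
    have h6 : algebraMap (RatFunc ℂ) (FunctionRing a b d) r =
        Polynomial.aeval (w : FunctionRing a b d) r.num.reverse *
          (w : FunctionRing a b d) ^ (r.denom.natDegree - r.num.natDegree) * ↑D⁻¹ := by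
      rw [← h1, mul_assoc (Polynomial.aeval (xK a b d) r.num), ← pow_add, Nat.add_sub_cancel' hle,
        Units.eq_mul_inv_iff_mul_eq, hD, Units.val_mul, ← mul_assoc, hnd, Units.val_pow_eq_pow_val]
    rw [h6]
    exact mul_mem (mul_mem ⟨_, P.val_aeval hw' _⟩ ⟨_, P.val_pow hw' _⟩)
      ⟨_, P.val_inv hDval one_ne_zero⟩
  · have hx' := h.trans hx
    have hden : r.denom.eval u ≠ 0 := by
      intro h0
      have h1 := Q.val_mul _ _ _ _ hv (Q.val_aeval hx r.denom)
      rw [← coe_polyU r.denom_ne_zero, hnd, Q.val_aeval hx, h0, mul_zero] at h1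
      have h2 : r.num.eval u = 0 := OnePoint.coe_injective h1
      obtain ⟨s, t, hst⟩ := RatFunc.isCoprime_num_denom r
      have h9 := congrArg (Polynomial.eval u) hst
      rw [Polynomial.eval_add, Polynomial.eval_mul, Polynomial.eval_mul, h2, h0] at h9
      simp at h9
    have h3 : P.val (polyU a b d r.denom_ne_zero : FunctionRing a b d) =
        ((r.denom.eval u : ℂ) : OnePoint ℂ) := by
      rw [coe_polyU]; exact P.val_aeval hx' _
    rw [hrinv]
    exact mul_mem ⟨_, P.val_aeval hx' _⟩ ⟨_, P.val_inv h3 hden⟩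

variable {P Q}

/-- A function which is finite on the orbit of `Q` is finite at `P`, if `x(P) = x(Q)`. -/
theorem mem_ring_of_orbit (hd : 0 < d) (h : P.val (xK a b d) = Q.val (xK a b d))
    {f : FunctionRing a b d} (hf : ∀ k : ℕ, (deck a b d ^ k) f ∈ Q.ring) : f ∈ P.ring := by
  rw [← sum_eigenProj (deckLin a b d) hd f]
  refine sum_mem fun j _ => ?_
  have hμ : (omega d ^ j) ^ d = 1 := by rw [← pow_mul, mul_comm, pow_mul, omega_pow, one_pow]
  set g := eigenProj (deckLin a b d) d (omega d ^ j) f with hg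
  have hT : deck a b d g = omega d ^ j • g := apply_eigenProj deckLin_pow_self hμ hd f
  have hgQ : g ∈ Q.ring := by
    rw [hg, eigenProj_apply]
    refine Subalgebra.smul_mem _ (sum_mem fun k _ => Subalgebra.smul_mem _ ?_ _) _
    rw [deckLin_pow_apply]
    exact hf k
  have hgd : deck a b d (g ^ d) = g ^ d := by
    rw [map_pow, hT, smul_pow, hμ, one_smul]
  obtain ⟨r, hr⟩ := exists_algebraMap_of_deck_eq hd hgd
  refine P.mem_ring_of_pow hd ?_
  rw [hr]
  refine algebraMap_mem_ring P Q h ?_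
  rw [← hr]
  exact pow_mem hgQ d

theorem val_eq_of_val_inv_eq {K : Type} [CommRing K] [Algebra ℂ K] {P Q : Place K} {u : Kˣ} {v : ℂ}
    (hP : P.val ↑u⁻¹ = (v : OnePoint ℂ)) (hQ : Q.val ↑u⁻¹ = (v : OnePoint ℂ)) :
    P.val u = Q.val u := by
  rcases eq_or_ne v 0 with rfl | hv
  · have h1 := P.val_inv_of_zero hP
    have h2 := Q.val_inv_of_zero hQ
    rw [inv_inv] at h1 h2
    rw [h1, h2]
  · have h1 := P.val_inv hP hv
    have h2 := Q.val_inv hQ hv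
    rw [inv_inv] at h1 h2
    rw [h1, h2]

theorem val_add_const {K : Type} [CommRing K] [Algebra ℂ K] {P Q : Place K} {f : K}
    (h : P.val f = Q.val f) (c : ℂ) :
    P.val (f + algebraMap ℂ _ c) = Q.val (f + algebraMap ℂ _ c) := by
  have aux : ∀ P : Place K, P.val f = OnePoint.infty →
      P.val (f + algebraMap ℂ _ c) = OnePoint.infty := by
    intro P hP
    rcases hv : P.val (f + algebraMap ℂ _ c) with _ | v
    · rfl
    · have h1 := P.val_sub hv (P.val_algebraMap c)
      rw [add_sub_cancel_right, hP] at h1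
      exact absurd h1 (OnePoint.infty_ne_coe _)
  rcases hv : Q.val f with _ | v
  · rw [aux P (h.trans hv), aux Q hv]
  · rw [P.val_add _ _ _ _ (h.trans hv) (P.val_algebraMap c),
      Q.val_add _ _ _ _ hv (Q.val_algebraMap c)]

theorem deck_prod_orbit (f : FunctionRing a b d) :
    deck a b d (∏ k ∈ Finset.range d, (deck a b d ^ k) f) =
      ∏ k ∈ Finset.range d, (deck a b d ^ k) f := by
  rw [map_prod]
  have h1 : ∀ k, deck a b d ((deck a b d ^ k) f) = (deck a b d ^ (k + 1)) f := by
    intro k; rw [pow_succ', AlgEquiv.mul_apply]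
  simp only [h1]
  rcases Nat.eq_zero_or_pos d with rfl | hd
  · simp
  -- reindex by the cyclic shift
  refine Finset.prod_bij (fun k _ => (k + 1) % d) (fun k _ => Finset.mem_range.2 (Nat.mod_lt _ hd))
    (fun k hk l hl hkl => ?_) (fun k hk => ?_) (fun k _ => ?_)
  · rw [Finset.mem_range] at hk hl
    have : k ≡ l [MOD d] := Nat.ModEq.add_right_cancel' 1 hkl
    exact Nat.ModEq.eq_of_lt_of_lt this hk hl
  · rw [Finset.mem_range] at hk
    refine ⟨(k + (d - 1)) % d, Finset.mem_range.2 (Nat.mod_lt _ hd), ?_⟩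
    rw [Nat.mod_add_mod, add_assoc, Nat.sub_add_cancel hd, Nat.add_mod_right, Nat.mod_eq_of_lt hk]
  · conv_lhs => rw [← Nat.div_add_mod (k + 1) d]
    rw [pow_add, pow_mul, deck_pow_self, one_pow, one_mul]

/-- Two points with the same value of `x` differ by a deck transformation. -/
theorem exists_eq_map_deck_pow (hd : 0 < d) (h : P.val (xK a b d) = Q.val (xK a b d)) :
    ∃ k : ℕ, P = Q.map (deck a b d ^ k) := by
  classical
  -- the functions that are finite on the orbit of `Q`, and those that vanish at `P`
  let m : Submodule ℂ (FunctionRing a b d) :=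
    { carrier := {f | (∀ k : ℕ, (deck a b d ^ k) f ∈ Q.ring) ∧ P.val f = ((0 : ℂ) : OnePoint ℂ)}
      add_mem' := fun {f g} hf hg => ⟨fun k => by rw [map_add]; exact add_mem (hf.1 k) (hg.1 k), by
        simpa using P.val_add _ _ _ _ hf.2 hg.2⟩
      zero_mem' := ⟨fun k => by rw [map_zero]; exact zero_mem _, P.val_zero⟩
      smul_mem' := fun c f hf => ⟨fun k => by
          rw [map_smul]; exact Subalgebra.smul_mem _ (hf.1 k) c, by
        rw [Algebra.smul_def]
        simpa using P.val_mul _ _ _ _ (P.val_algebraMap c) hf.2⟩ }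
  let S : ℕ → Submodule ℂ m := fun k =>
    { carrier := {f | Q.val ((deck a b d ^ k) (f : FunctionRing a b d)) = ((0 : ℂ) : OnePoint ℂ)}
      add_mem' := fun {f g} hf hg => by
        have := Q.val_add _ _ _ _ hf hg
        rw [← map_add, add_zero] at this
        exact this
      zero_mem' := by
        change Q.val ((deck a b d ^ k) 0) = _
        rw [map_zero]; exact Q.val_zero
      smul_mem' := fun c f hf => by
        have := Q.val_mul _ _ _ _ (Q.val_algebraMap c) hf
        rw [mul_zero, ← Algebra.smul_def, ← map_smul] at this
        exact this }
  have hcover : ∃ k ∈ Finset.range d, S k = ⊤ := by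
    by_contra! hne
    have h1 := Subspace.biUnion_ne_univ_of_top_notMem (s := (Finset.range d).image S) (by
      rw [Finset.mem_image]
      rintro ⟨k, hk, hk'⟩
      exact hne k hk hk')
    obtain ⟨⟨f, hfQ, hfP⟩, hf⟩ := (Set.ne_univ_iff_exists_notMem _).1 h1
    simp only [Finset.mem_image, Set.mem_iUnion, not_exists] at hf
    have hval : ∀ k : ℕ, k < d → ∃ v : ℂ, v ≠ 0 ∧ Q.val ((deck a b d ^ k) f) = (v : OnePoint ℂ) := by
      intro k hk
      obtain ⟨v, hv⟩ := hfQ k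
      refine ⟨v, ?_, hv⟩
      rintro rfl
      exact hf (S k) ⟨k, Finset.mem_range.2 hk, rfl⟩ hv
    -- the norm of `f` is a nonzero rational function of `x`, so that `f` is invertible
    obtain ⟨r, hr⟩ := exists_algebraMap_of_deck_eq hd (deck_prod_orbit f)
    have hprod : ∀ n ≤ d, ∃ v : ℂ, v ≠ 0 ∧
        Q.val (∏ k ∈ Finset.range n, (deck a b d ^ k) f) = (v : OnePoint ℂ) := by
      intro n
      induction n with
      | zero => exact fun _ => ⟨1, one_ne_zero, by rw [Finset.range_zero, Finset.prod_empty]; exact Q.val_one⟩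
      | succ n ih =>
        intro hn
        obtain ⟨v, hv0, hv⟩ := ih (by omega)
        obtain ⟨w, hw0, hw⟩ := hval n (by omega)
        refine ⟨v * w, mul_ne_zero hv0 hw0, ?_⟩
        rw [Finset.prod_range_succ]
        exact Q.val_mul _ _ _ _ hv hw
    obtain ⟨v, hv0, hv⟩ := hprod d le_rfl
    have hr0 : r ≠ 0 := by
      rintro rfl
      rw [hr, map_zero, Q.val_zero] at hv
      exact hv0 (OnePoint.coe_injective hv).symm
    have hfu : IsUnit f := by
      have h2 : IsUnit (∏ k ∈ Finset.range d, (deck a b d ^ k) f) := by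
        rw [hr]; exact (IsUnit.mk0 r hr0).map _
      have h3 : f ∣ ∏ k ∈ Finset.range d, (deck a b d ^ k) f := by
        have := Finset.dvd_prod_of_mem (fun k => (deck a b d ^ k) f) (Finset.mem_range.2 hd)
        simpa using this
      exact isUnit_of_dvd_unit h3 h2
    obtain ⟨u, rfl⟩ := hfu
    have hinv : (↑u⁻¹ : FunctionRing a b d) ∈ P.ring := by
      refine mem_ring_of_orbit hd h fun k => ?_
      obtain ⟨w, hw0, hw⟩ := hval (k % d) (Nat.mod_lt _ hd)
      have hk : deck a b d ^ k = deck a b d ^ (k % d) := by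
        conv_lhs => rw [← Nat.div_add_mod k d]
        rw [pow_add, pow_mul, deck_pow_self, one_pow, one_mul]
      rw [hk]
      exact ⟨_, Q.val_inv (f := Units.map ((deck a b d ^ (k % d) :
        FunctionRing a b d ≃ₐ[ℂ] FunctionRing a b d) : FunctionRing a b d →* FunctionRing a b d) u)
        hw hw0⟩
    obtain ⟨w, hw⟩ := hinv
    have h4 := P.val_mul _ _ _ _ hfP hw
    rw [Units.mul_inv, P.val_one, zero_mul] at h4
    exact one_ne_zero (OnePoint.coe_injective h4)
  obtain ⟨k, hk, hS⟩ := hcover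
  have hsame : ∀ f : FunctionRing a b d, (∀ k : ℕ, (deck a b d ^ k) f ∈ Q.ring) →
      ∃ v : ℂ, P.val f = (v : OnePoint ℂ) ∧ Q.val ((deck a b d ^ k) f) = (v : OnePoint ℂ) := by
    intro f hf
    obtain ⟨v, hv⟩ := mem_ring_of_orbit hd h hf
    refine ⟨v, hv, ?_⟩
    have h1 : f - algebraMap ℂ _ v ∈ m := by
      refine ⟨fun l => ?_, ?_⟩
      · rw [map_sub, AlgEquiv.commutes]
        exact sub_mem (hf l) (Subalgebra.algebraMap_mem _ _)
      · simpa using P.val_sub hv (P.val_algebraMap v)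
    have h2 : (⟨_, h1⟩ : m) ∈ S k := hS ▸ Submodule.mem_top
    have h3 : Q.val ((deck a b d ^ k) (f - algebraMap ℂ _ v)) = ((0 : ℂ) : OnePoint ℂ) := h2
    have h4 := Q.val_add _ _ _ _ h3 (Q.val_algebraMap v)
    rw [map_sub, AlgEquiv.commutes, sub_add_cancel, zero_add] at h4
    exact h4
  refine ⟨k, Place.ext (funext fun f => ?_)⟩
  change P.val f = Q.val ((deck a b d ^ k) f)
  -- `(f - c)⁻¹` is finite on the whole orbit for a suitable constant `c`
  obtain ⟨c, hc, u, hu⟩ := exists_isUnit_sub hd f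
    ((fun l => (Q.val ((deck a b d ^ l) f)).elim 0 id) '' (Finset.range d : Set ℕ))
    (Set.Finite.image _ (Finset.finite_toSet _))
  have hfu : f = u + algebraMap ℂ _ c := by rw [hu]; ring
  have hmap : ∀ l : ℕ, (deck a b d ^ l) (↑u : FunctionRing a b d) =
      (deck a b d ^ l) f - algebraMap ℂ _ c := by
    intro l; rw [hu, map_sub, AlgEquiv.commutes]
  have hinvQ : ∀ l : ℕ, (deck a b d ^ l) (↑u⁻¹ : FunctionRing a b d) ∈ Q.ring := by
    intro l
    set U := Units.map ((deck a b d ^ l : FunctionRing a b d ≃ₐ[ℂ] FunctionRing a b d) :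
      FunctionRing a b d →* FunctionRing a b d) u with hU
    have hUv : (U : FunctionRing a b d) = (deck a b d ^ l) f - algebraMap ℂ _ c := hmap l
    have hl : deck a b d ^ l = deck a b d ^ (l % d) := by
      conv_lhs => rw [← Nat.div_add_mod l d]
      rw [pow_add, pow_mul, deck_pow_self, one_pow, one_mul]
    change (↑U⁻¹ : FunctionRing a b d) ∈ Q.ring
    rcases hv : Q.val ((deck a b d ^ l) f) with _ | v
    · have h1 : Q.val (U : FunctionRing a b d) = OnePoint.infty := by
        rcases hw : Q.val (U : FunctionRing a b d) with _ | w
        · rfl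
        · have h2 := Q.val_add _ _ _ _ hw (Q.val_algebraMap c)
          rw [hUv, sub_add_cancel, hv] at h2
          exact absurd h2 (OnePoint.infty_ne_coe _)
      exact ⟨_, Q.val_inv_of_infty h1⟩
    · have h1 := Q.val_sub hv (Q.val_algebraMap c)
      rw [← hUv] at h1
      refine ⟨_, Q.val_inv h1 ?_⟩
      intro h0
      refine hc ⟨l % d, Finset.mem_coe.2 (Finset.mem_range.2 (Nat.mod_lt _ hd)), ?_⟩
      simp only [← hl, hv]
      exact sub_eq_zero.1 h0
  obtain ⟨v, hv1, hv2⟩ := hsame _ hinvQ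
  have h5 : P.val (u : FunctionRing a b d) = (Q.map (deck a b d ^ k)).val u :=
    val_eq_of_val_inv_eq hv1 hv2
  have h6 := val_add_const h5 c
  rw [← hfu] at h6
  exact h6

end Place

end Transitivity

/-! ### The stars around the branch points, and primitives of cocycles on them -/

section Stars

open Filter Topology

instance : PreconnectedSpace (stdSimplex ℝ (Fin 2)) :=
  isPreconnected_iff_preconnectedSpace.1 (convex_stdSimplex ℝ (Fin 2)).isPreconnected

instance : Nonempty (stdSimplex ℝ (Fin 2)) := ⟨stdSimplex.vertex 0⟩

theorem finite_setOf_pow_eq {n : ℕ} (hn : 0 < n) (κ : ℂ) : {z : ℂ | z ^ n = κ}.Finite := by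
  have h3 : (Polynomial.X ^ n - Polynomial.C κ : Polynomial ℂ) ≠ 0 :=
    Polynomial.X_pow_sub_C_ne_zero hn κ
  refine (Polynomial.finite_setOfPred_isRoot h3).subset fun s hs => ?_
  have hs' : s ^ n = κ := hs
  simp [Polynomial.IsRoot, hs']

/-- A continuous root of a constant is constant on connected spaces. -/
theorem eq_of_pow_eq_const {Y : Type*} [TopologicalSpace Y] [PreconnectedSpace Y] {F : Y → ℂ}
    (hF : Continuous F) {n : ℕ} (hn : 0 < n) {κ : ℂ} (h : ∀ u, F u ^ n = κ) (u v : Y) :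
    F u = F v := by
  by_contra hne
  have h1 : (Set.range F).Infinite := (isPreconnected_range hF).infinite_of_nontrivial
    ⟨F u, ⟨u, rfl⟩, F v, ⟨v, rfl⟩, hne⟩
  exact h1 ((finite_setOf_pow_eq hn κ).subset (by rintro _ ⟨w, rfl⟩; exact h w))

theorem Place.continuous_val {K : Type} [CommRing K] [Algebra ℂ K] (f : K) :
    Continuous fun P : Place K => P.val f :=
  (continuous_apply f).comp continuous_induced_dom

theorem continuous_of_val_eq {K : Type} [CommRing K] [Algebra ℂ K] {Y : Type*} [TopologicalSpace Y]
    {γ : Y → Place K} (hγ : Continuous γ) {f : K} {F : Y → ℂ}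
    (h : ∀ u, (γ u).val f = (F u : OnePoint ℂ)) : Continuous F := by
  rw [OnePoint.isOpenEmbedding_coe.isInducing.continuous_iff]
  exact ((Place.continuous_val f).comp hγ).congr h

variable {a b d : ℕ}

theorem Place.map_deck_pow_succ (P : Place (FunctionRing a b d)) (k : ℕ) :
    P.map (deck a b d ^ (k + 1)) = (P.map (deck a b d ^ k)).map (deck a b d) := by
  refine Place.ext (funext fun f => ?_)
  change P.val _ = P.val _
  rw [pow_succ, AlgEquiv.mul_apply]

namespace Cusp

variable (a b d) in
/-- The part of the curve where the coordinate `w` at the branch point avoids `[1, ∞]`. -/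
def nbhd (i : Cusp) : Set (Place (FunctionRing a b d)) :=
  {P | ∃ u : ℂ, P.val (i.wU a b d) = (u : OnePoint ℂ) ∧ 1 - u ∈ Complex.slitPlane}

theorem isOpen_nbhd (i : Cusp) : IsOpen (i.nbhd a b d) := by
  have h1 : IsOpen ((fun u : ℂ => (u : OnePoint ℂ)) '' {u | 1 - u ∈ Complex.slitPlane}) :=
    OnePoint.isOpenEmbedding_coe.isOpenMap _ (Complex.isOpen_slitPlane.preimage (by fun_prop))
  convert h1.preimage (Place.continuous_val (i.wU a b d : FunctionRing a b d)) using 1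
  ext P
  constructor
  · rintro ⟨u, hu, hu'⟩; exact ⟨u, hu', hu.symm⟩
  · rintro ⟨u, hu', hu⟩; exact ⟨u, hu.symm, hu'⟩

theorem exists_mem_nbhd (P : Place (FunctionRing a b d)) : ∃ i : Cusp, P ∈ i.nbhd a b d := by
  rcases hx : P.val (xK a b d) with _ | u
  · exact ⟨infty, 0, P.val_inv_of_infty (f := zero.wU a b d) hx, by
      rw [sub_zero]; exact Complex.one_mem_slitPlane⟩
  · by_cases hu : 1 - u ∈ Complex.slitPlane
    · exact ⟨zero, u, hx, hu⟩
    · refine ⟨one, 1 - u, ?_, ?_⟩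
      · have : (one.wU a b d : FunctionRing a b d) = 1 - xK a b d := by simp [wU]
        rw [this]
        exact P.val_sub P.val_one hx
      · rw [Complex.mem_slitPlane_iff, not_or] at hu
        simp only [Complex.sub_re, Complex.one_re] at hu
        rw [sub_sub_cancel, Complex.mem_slitPlane_iff]
        left; linarith [hu.1]

theorem map_deck_mem_nbhd {i : Cusp} {P : Place (FunctionRing a b d)} (hP : P ∈ i.nbhd a b d) :
    P.map (deck a b d) ∈ i.nbhd a b d := by
  obtain ⟨u, hu, hu'⟩ := hP
  refine ⟨u, ?_, hu'⟩
  change P.val (deck a b d (i.wU a b d)) = _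
  rw [deck_wU, hu]

theorem val_xK_eq (i : Cusp) {P Q : Place (FunctionRing a b d)} {u : ℂ}
    (hP : P.val (i.wU a b d) = (u : OnePoint ℂ)) (hQ : Q.val (i.wU a b d) = (u : OnePoint ℂ)) :
    P.val (xK a b d) = Q.val (xK a b d) := by
  cases i
  · exact hP.trans hQ.symm
  · have : xK a b d = 1 - (one.wU a b d : FunctionRing a b d) := by simp [wU]
    rw [this, P.val_sub P.val_one hP, Q.val_sub Q.val_one hQ]
  · exact Place.val_eq_of_val_inv_eq (u := zero.wU a b d) hP hQ

section

variable (hd : 0 < d) (i : Cusp)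

theorem star_map_deck_pow (ξ : ℂ) (hξ : ξ ^ d = i.κ b) (t : (i.star (a := a) hd ξ hξ).dom) (k : ℕ)
    (ξ' : ℂ) (hξ' : ξ' ^ d = i.κ b) (h : ξ' = omega d ^ k * ξ) :
    ((i.star hd ξ hξ).place hd t).map (deck a b d ^ k) = (i.star hd ξ' hξ').place hd ⟨t, t.2⟩ := by
  induction k generalizing ξ' with
  | zero =>
    rw [pow_zero, one_mul] at h
    subst h
    rfl
  | succ k ih =>
    have hk : (omega d ^ k * ξ) ^ d = i.κ b := by
      rw [mul_pow, ← pow_mul, mul_comm k, pow_mul, omega_pow, one_pow, one_mul, hξ]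
    rw [Place.map_deck_pow_succ, ih _ hk rfl, star_map_deck hd i _ hk _ hξ' (by rw [h]; ring)]

/-- Every point of the star is on one of the parametrizations. -/
theorem exists_star_place_eq {P : Place (FunctionRing a b d)} (hP : P ∈ i.nbhd a b d) :
    ∃ (ξ : ℂ) (hξ : ξ ^ d = i.κ b) (t : (i.star (a := a) hd ξ hξ).dom),
      P = (i.star hd ξ hξ).place hd t := by
  obtain ⟨u, hu, hu'⟩ := hP
  obtain ⟨ξ, hξ⟩ : ∃ ξ : ℂ, ξ ^ d = i.κ b := IsAlgClosed.exists_pow_nat_eq _ hd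
  obtain ⟨t, rfl⟩ : ∃ t : ℂ, t ^ i.e a b d = u := IsAlgClosed.exists_pow_nat_eq _ (i.e_pos hd)
  obtain ⟨k, hk⟩ := Place.exists_eq_map_deck_pow hd
    (i.val_xK_eq hu (i.star_val_wU hd ξ hξ ⟨t, hu'⟩))
  have hξ' : (omega d ^ k * ξ) ^ d = i.κ b := by
    rw [mul_pow, ← pow_mul, mul_comm k, pow_mul, omega_pow, one_pow, one_mul, hξ]
  exact ⟨_, hξ', _, hk.trans (i.star_map_deck_pow hd ξ hξ ⟨t, hu'⟩ k _ hξ' rfl)⟩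

theorem star_place_mem_nbhd (ξ : ℂ) (hξ : ξ ^ d = i.κ b) (t : (i.star (a := a) hd ξ hξ).dom) :
    (i.star hd ξ hξ).place hd t ∈ i.nbhd a b d :=
  ⟨_, i.star_val_wU hd ξ hξ t, t.2⟩

theorem ne_zero_of_pow_eq_κ {ξ : ℂ} (hd : 0 < d) (hξ : ξ ^ d = i.κ b) : ξ ≠ 0 := by
  rintro rfl; rw [zero_pow hd.ne'] at hξ; exact i.κ_ne_zero b hξ.symm

theorem star_val_eta (ξ : ℂ) (hξ : ξ ^ d = i.κ b) (t : (i.star (a := a) hd ξ hξ).dom) :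
    ((i.star hd ξ hξ).place hd t).val
      ↑(yU a b hd ^ (i.e a b d : ℤ) * i.wU a b d ^ (-i.k a b d)) =
      ((ξ ^ i.e a b d * ((1 - (t : ℂ) ^ i.e a b d) ^ ((i.B a b : ℂ) / d)) ^ i.e a b d : ℂ) :
        OnePoint ℂ) := by
  have := i.star_val_yU_wU hd ξ hξ t (i.e a b d) (-i.k a b d) 0 (by push_cast; ring)
  rw [this, pow_zero, mul_one, zpow_natCast, zpow_natCast]

theorem star_val_tau (ξ : ℂ) (hξ : ξ ^ d = i.κ b) (t : (i.star (a := a) hd ξ hξ).dom) :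
    ((i.star hd ξ hξ).place hd t).val
      ↑(yU a b hd ^ (i.p a b d : ℤ) * i.wU a b d ^ (i.q a b d)) =
      ((ξ ^ i.p a b d * (t : ℂ) * ((1 - (t : ℂ) ^ i.e a b d) ^ ((i.B a b : ℂ) / d)) ^ i.p a b d : ℂ) :
        OnePoint ℂ) := by
  have := i.star_val_yU_wU hd ξ hξ t (i.p a b d) (i.q a b d) 1 (by rw [i.bezout hd]; rfl)
  rw [this, pow_one]

theorem star_place_eq_of {ξ ξ' : ℂ} (hξ : ξ ^ d = i.κ b) (hξ' : ξ' ^ d = i.κ b)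
    (t : (i.star (a := a) hd ξ hξ).dom) (t' : (i.star (a := a) hd ξ' hξ').dom)
    (h1 : ξ' ^ i.e a b d = ξ ^ i.e a b d)
    (h2 : ξ' ^ i.p a b d * t' = ξ ^ i.p a b d * t) :
    (i.star hd ξ' hξ').place hd t' = (i.star hd ξ hξ).place hd t := by
  have hξ0 := i.ne_zero_of_pow_eq_κ hd hξ
  have hξ0' := i.ne_zero_of_pow_eq_κ hd hξ'
  have hr : (ξ' / ξ) ^ i.e a b d = 1 := by
    rw [div_pow, h1, div_self (pow_ne_zero _ hξ0)]
  refine i.star_place_mul hd ξ hξ ((ξ' / ξ) ^ i.p a b d) ?_ ξ' hξ' ?_ t' t ?_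
  · rw [← zpow_natCast, ← zpow_mul, mul_comm, zpow_mul, zpow_natCast, hr, one_zpow]
  · rw [← zpow_mul, eq_sub_of_add_eq (i.bezout (a := a) (b := b) hd), zpow_sub₀ (div_ne_zero hξ0' hξ0),
      mul_comm (i.q a b d), zpow_mul _ (i.e a b d : ℤ), zpow_natCast, hr, one_zpow, div_one, zpow_one,
      mul_div_cancel₀ _ hξ0]
  · rw [div_zpow, div_mul_eq_mul_div, h2, mul_div_cancel_left₀ _ (zpow_ne_zero _ hξ0)]

theorem star_cpow_ne_zero {t : ℂ} (ht : 1 - t ^ i.e a b d ∈ Complex.slitPlane) :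
    (1 - t ^ i.e a b d) ^ ((i.B a b : ℂ) / d) ≠ 0 := by
  rw [Complex.cpow_ne_zero_iff]
  exact Or.inl (Complex.slitPlane_ne_zero ht)

theorem star_place_eq_iff {ξ ξ' : ℂ} (hξ : ξ ^ d = i.κ b) (hξ' : ξ' ^ d = i.κ b)
    (t : (i.star (a := a) hd ξ hξ).dom) (t' : (i.star (a := a) hd ξ' hξ').dom) :
    (i.star hd ξ' hξ').place hd t' = (i.star hd ξ hξ).place hd t ↔
      ξ' ^ i.e a b d = ξ ^ i.e a b d ∧ ξ' ^ i.p a b d * t' = ξ ^ i.p a b d * t := by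
  refine ⟨fun h => ?_, fun h => i.star_place_eq_of hd hξ hξ' t t' h.1 h.2⟩
  have hw := i.star_val_wU hd ξ' hξ' t'
  have he := i.star_val_eta hd ξ' hξ' t'
  have ht := i.star_val_tau hd ξ' hξ' t'
  rw [h, star_val_wU] at hw
  rw [h, star_val_eta] at he
  rw [h, star_val_tau] at ht
  have hw' : (t : ℂ) ^ i.e a b d = (t' : ℂ) ^ i.e a b d := OnePoint.coe_injective hw
  rw [hw'] at he ht
  have h0 := i.star_cpow_ne_zero (a := a) (b := b) (d := d) (t := t') t'.2
  have he' := OnePoint.coe_injective he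
  have ht' := OnePoint.coe_injective ht
  exact ⟨(mul_right_cancel₀ (pow_ne_zero _ h0) he').symm,
    (mul_right_cancel₀ (zpow_ne_zero _ h0) ht').symm⟩

/-- A connected family of points of a star lifts to one of the parametrizations. -/
theorem exists_lift {Y : Type*} [TopologicalSpace Y] [PreconnectedSpace Y] [Nonempty Y]
    (γ : C(Y, Place (FunctionRing a b d))) (hγ : ∀ u, γ u ∈ i.nbhd a b d) :
    ∃ (ξ : ℂ) (hξ : ξ ^ d = i.κ b) (δ : C(Y, (i.star (a := a) hd ξ hξ).dom)),
      ∀ u, γ u = (i.star hd ξ hξ).place hd (δ u) := by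
  choose ξ hξ t ht using fun u => i.exists_star_place_eq hd (hγ u)
  set W : Y → ℂ := fun u => (t u : ℂ) ^ i.e a b d with hW
  set c : Y → ℂ := fun u => (1 - (t u : ℂ) ^ i.e a b d) ^ ((i.B a b : ℂ) / d) with hc
  have hWc : Continuous W := continuous_of_val_eq γ.continuous fun u => by
    rw [ht u, star_val_wU]
  have hslit : ∀ u, 1 - W u ∈ Complex.slitPlane := fun u => (t u).2
  have hcc : Continuous c := Continuous.cpow (continuous_const.sub hWc) continuous_const hslit
  have hc0 : ∀ u, c u ≠ 0 := fun u => i.star_cpow_ne_zero (t u).2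
  have hE : Continuous fun u => ξ u ^ i.e a b d * c u ^ i.e a b d :=
    continuous_of_val_eq γ.continuous fun u => by rw [ht u, star_val_eta]
  have hτ : Continuous fun u => ξ u ^ i.p a b d * t u * c u ^ i.p a b d :=
    continuous_of_val_eq γ.continuous fun u => by rw [ht u, star_val_tau]
  have hη : Continuous fun u => ξ u ^ i.e a b d := by
    refine (hE.div (hcc.pow (i.e a b d)) fun u => pow_ne_zero _ (hc0 u)).congr fun u => ?_
    exact mul_div_cancel_right₀ _ (pow_ne_zero _ (hc0 u))
  have hconst : ∀ u v, ξ u ^ i.e a b d = ξ v ^ i.e a b d := by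
    refine eq_of_pow_eq_const hη (i.g_pos (a := a) (b := b) hd) (κ := i.κ b) fun u => ?_
    rw [← pow_mul, i.e_mul_g, hξ]
  obtain ⟨u₀⟩ := ‹Nonempty Y›
  have hξ0 := i.ne_zero_of_pow_eq_κ hd (hξ u₀)
  have hδc : Continuous fun u => (ξ u₀ ^ i.p a b d)⁻¹ * (ξ u ^ i.p a b d * t u) := by
    refine continuous_const.mul ?_
    refine (hτ.div (hcc.zpow₀ (i.p a b d) fun u => Or.inl (hc0 u))
      fun u => zpow_ne_zero _ (hc0 u)).congr fun u => ?_
    exact mul_div_cancel_right₀ _ (zpow_ne_zero _ (hc0 u))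
  have hdom : ∀ u, (ξ u₀ ^ i.p a b d)⁻¹ * (ξ u ^ i.p a b d * t u) ∈
      (i.star (a := a) hd (ξ u₀) (hξ u₀)).dom := by
    intro u
    have h1 : ((ξ u₀ ^ i.p a b d)⁻¹ * (ξ u ^ i.p a b d * t u)) ^ i.e a b d =
        (t u : ℂ) ^ i.e a b d := by
      have h2 : ∀ z : ℂ, (z ^ i.p a b d) ^ i.e a b d = (z ^ i.e a b d) ^ i.p a b d := fun z => by
        rw [← zpow_natCast, ← zpow_natCast, ← zpow_mul, ← zpow_mul, mul_comm]
      rw [mul_pow, mul_pow, inv_pow, h2, h2, hconst u u₀,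
        inv_mul_cancel_left₀ (zpow_ne_zero _ (pow_ne_zero _ hξ0))]
    change 1 - _ ∈ Complex.slitPlane
    rw [h1]
    exact hslit u
  refine ⟨ξ u₀, hξ u₀, ⟨fun u => ⟨_, hdom u⟩, hδc.subtype_mk _⟩, fun u => ?_⟩
  rw [ht u]
  refine i.star_place_eq_of hd (hξ u₀) (hξ u) _ _ (hconst u u₀) ?_
  simp only [ContinuousMap.coe_mk]
  rw [mul_inv_cancel_left₀ (zpow_ne_zero _ hξ0)]

theorem smul_mem_star_dom {s : ℝ} (h0 : 0 ≤ s) (h1 : s ≤ 1) {t : ℂ}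
    (ht : 1 - t ^ i.e a b d ∈ Complex.slitPlane) :
    1 - ((s : ℂ) * t) ^ i.e a b d ∈ Complex.slitPlane := by
  have h2 := Complex.starConvex_one_slitPlane ht (a := 1 - s ^ i.e a b d) (b := s ^ i.e a b d)
    (sub_nonneg.2 (pow_le_one₀ h0 h1)) (pow_nonneg h0 _) (by ring)
  convert h2 using 1
  simp only [Complex.real_smul]
  push_cast
  ring

/-- The ray from the centre of a star to the point with parameter `t`. -/
def ray (ξ : ℂ) (hξ : ξ ^ d = i.κ b) (t : (i.star (a := a) hd ξ hξ).dom) :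
    C(stdSimplex ℝ (Fin 2), Place (FunctionRing a b d)) where
  toFun u := (i.star hd ξ hξ).place hd
    ⟨((u.1 1 : ℝ) : ℂ) * t, i.smul_mem_star_dom (u.2.1 1) (stdSimplex.le_one u 1) t.2⟩
  continuous_toFun := by
    refine ((i.star hd ξ hξ).continuous_place hd).comp (Continuous.subtype_mk ?_ _)
    exact (Complex.continuous_ofReal.comp ((continuous_apply 1).comp continuous_subtype_val)).mul
      continuous_const

theorem ray_eq {ξ ξ' : ℂ} (hξ : ξ ^ d = i.κ b) (hξ' : ξ' ^ d = i.κ b)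
    (t : (i.star (a := a) hd ξ hξ).dom) (t' : (i.star (a := a) hd ξ' hξ').dom)
    (h : (i.star hd ξ' hξ').place hd t' = (i.star hd ξ hξ).place hd t) :
    i.ray hd ξ' hξ' t' = i.ray hd ξ hξ t := by
  rw [star_place_eq_iff] at h
  refine ContinuousMap.ext fun u => ?_
  simp only [ray, ContinuousMap.coe_mk]
  rw [star_place_eq_iff]
  refine ⟨h.1, ?_⟩
  linear_combination ((u.1 1 : ℝ) : ℂ) * h.2

variable {φ : C(stdSimplex ℝ (Fin 2), Place (FunctionRing a b d)) → ℂ}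

/-- Every cocycle has a primitive on a star: its integral along the rays. -/
theorem exists_primitive (hd : 0 < d) (h : IsCocycle φ) : ∃ f : Place (FunctionRing a b d) → ℂ,
    ∀ γ : C(stdSimplex ℝ (Fin 2), Place (FunctionRing a b d)), (∀ u, γ u ∈ i.nbhd a b d) →
      φ γ = f (γ (stdSimplex.vertex 1)) - f (γ (stdSimplex.vertex 0)) := by
  classical
  let f : Place (FunctionRing a b d) → ℂ := fun P =>
    if hP : P ∈ i.nbhd a b d then φ (i.ray hd _ _ (i.exists_star_place_eq hd hP).choose_spec.choose_spec.choose)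
    else 0
  have hf : ∀ (ξ : ℂ) (hξ : ξ ^ d = i.κ b) (t : (i.star (a := a) hd ξ hξ).dom),
      f ((i.star hd ξ hξ).place hd t) = φ (i.ray hd ξ hξ t) := by
    intro ξ hξ t
    have hP := i.star_place_mem_nbhd hd ξ hξ t
    simp only [f, dif_pos hP]
    congr 1
    exact i.ray_eq hd _ _ _ _ (i.exists_star_place_eq hd hP).choose_spec.choose_spec.choose_spec.symm
  refine ⟨f, fun γ hγ => ?_⟩
  obtain ⟨ξ, hξ, δ, hδ⟩ := i.exists_lift hd γ hγ
  -- the cone over the path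
  let H : C(ℝ × ℝ, Place (FunctionRing a b d)) :=
    { toFun := fun z => (i.star hd ξ hξ).place hd
        ⟨((Set.projIcc (0 : ℝ) 1 zero_le_one z.1 : ℝ) : ℂ) * lineOf δ z.2,
          i.smul_mem_star_dom (Set.projIcc (0 : ℝ) 1 zero_le_one z.1).2.1
            (Set.projIcc (0 : ℝ) 1 zero_le_one z.1).2.2 (lineOf δ z.2).2⟩
      continuous_toFun := by
        refine ((i.star hd ξ hξ).continuous_place hd).comp (Continuous.subtype_mk ?_ _)
        refine (Complex.continuous_ofReal.comp (continuous_subtype_val.comp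
          (continuous_projIcc.comp continuous_fst))).mul ?_
        exact continuous_subtype_val.comp ((lineOf δ).continuous.comp continuous_snd) }
  have hsum : ∀ u : stdSimplex ℝ (Fin 2), u.1 0 + u.1 1 = 1 := fun u => by
    have := u.2.2; rwa [Fin.sum_univ_two] at this
  have hline : ∀ u : stdSimplex ℝ (Fin 2), lineOf δ (u.1 1) = δ u := fun u => by
    have h1 := congrArg (fun F : C(stdSimplex ℝ (Fin 2), _) => F u) (lineOf_comp_seg δ)
    simpa [seg] using h1
  have hproj : ∀ u : stdSimplex ℝ (Fin 2), ((Set.projIcc (0 : ℝ) 1 zero_le_one (u.1 1) : ℝ)) = u.1 1 :=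
    fun u => by rw [Set.projIcc_of_mem zero_le_one ⟨u.2.1 1, stdSimplex.le_one u 1⟩]
  have hline1 : lineOf δ 1 = δ (stdSimplex.vertex 1) := by
    rw [← hline (stdSimplex.vertex 1)]; simp
  have hline0 : lineOf δ 0 = δ (stdSimplex.vertex 0) := by
    rw [← hline (stdSimplex.vertex 0)]; simp
  have e1 : H.comp (seg ((1 : ℝ), (0 : ℝ)) (1, 1)) = γ := by
    refine ContinuousMap.ext fun u => ?_
    rw [hδ u]
    simp only [H, seg, ContinuousMap.comp_apply, ContinuousMap.coe_mk]
    congr 1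
    refine Subtype.ext ?_
    simp [hsum, hline]
  have e2 : H.comp (seg ((0 : ℝ), (1 : ℝ)) (1, 1)) = i.ray hd ξ hξ (δ (stdSimplex.vertex 1)) := by
    refine ContinuousMap.ext fun u => ?_
    simp only [H, seg, ray, ContinuousMap.comp_apply, ContinuousMap.coe_mk]
    congr 1
    refine Subtype.ext ?_
    simp [hsum, hproj, hline1]
  have e3 : H.comp (seg ((0 : ℝ), (0 : ℝ)) (1, 0)) = i.ray hd ξ hξ (δ (stdSimplex.vertex 0)) := by
    refine ContinuousMap.ext fun u => ?_
    simp only [H, seg, ray, ContinuousMap.comp_apply, ContinuousMap.coe_mk]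
    congr 1
    refine Subtype.ext ?_
    simp [hproj, hline0]
  have e4 : φ (H.comp (seg ((0 : ℝ), (0 : ℝ)) (0, 1))) = 0 := by
    have : H.comp (seg ((0 : ℝ), (0 : ℝ)) (0, 1)) = .const _ (H (0, 0)) := by
      refine ContinuousMap.ext fun u => ?_
      simp only [H, seg, ContinuousMap.comp_apply, ContinuousMap.coe_mk, ContinuousMap.const_apply]
      congr 1
      refine Subtype.ext ?_
      simp
    rw [this, h.const]
  have h1 := h.seg_add H ((0 : ℝ), (0 : ℝ)) (1, 0) (1, 1)
  have h2 := h.seg_add H ((0 : ℝ), (0 : ℝ)) (0, 1) (1, 1)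
  rw [e1, e3] at h1
  rw [e2, e4] at h2
  rw [hδ, hδ, hf, hf]
  linear_combination h1 - h2

end

end Cusp

end Stars

/-! ### The sheets over the overlaps of two stars -/

section Sheets

open Filter Topology Complex

theorem segment_mem_slitPlane {p s : ℝ} (hp : 0 < p) (h0 : 0 ≤ s) (h1 : s ≤ 1) {z : ℂ}
    (hz : z ∈ slitPlane) : ((1 - s : ℝ) : ℂ) * p + (s : ℂ) * z ∈ slitPlane := by
  rw [mem_slitPlane_iff] at hz ⊢
  simp only [add_re, mul_re, ofReal_re, ofReal_im, zero_mul, sub_zero, add_im, mul_im, mul_zero,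
    add_zero, zero_add]
  rcases h0.eq_or_lt with rfl | h0
  · left; simpa using hp
  · rcases hz with hz | hz
    · left; nlinarith [mul_pos h0 hz, mul_nonneg (sub_nonneg.2 h1) hp.le]
    · right; exact mul_ne_zero h0.ne' hz

theorem one_sub_inv_notMem_slitPlane {x : ℂ} (h : 1 - x⁻¹ ∉ slitPlane) :
    ∃ r : ℝ, 0 < r ∧ r ≤ 1 ∧ x = r := by
  rw [mem_slitPlane_iff, not_or, not_not, not_lt] at h
  simp only [sub_re, one_re, sub_im, one_im, zero_sub, neg_eq_zero] at h
  have h1 : 1 ≤ (x⁻¹).re := by linarith [h.1]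
  refine ⟨((x⁻¹).re)⁻¹, by positivity, inv_le_one_of_one_le₀ h1, ?_⟩
  have h2 : x⁻¹ = ((x⁻¹).re : ℂ) := Complex.ext rfl (by simpa using h.2)
  rw [ofReal_inv, ← h2, inv_inv]

namespace Cusp

/-- The sign by which `x` is multiplied to move its cut away from a region. -/
def sign0 : Cusp → ℤ
  | zero => 1
  | one => -1
  | infty => 1

/-- The sign by which `x - 1` is multiplied to move its cut away from a region. -/
def sign1 : Cusp → ℤ
  | zero => 1
  | one => -1
  | infty => -1

/-- The value of `log s` on the upper half plane, for a sign `s`. -/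
def logSign (s : ℤ) : ℂ := if s = 1 then 0 else Real.pi * I

theorem exp_logSign {s : ℤ} (hs : s = 1 ∨ s = -1) : exp (logSign s) = s := by
  rcases hs with rfl | rfl <;> simp [logSign, exp_pi_mul_I]

theorem sign0_eq (r : Cusp) : r.sign0 = 1 ∨ r.sign0 = -1 := by cases r <;> simp [sign0]

theorem sign1_eq (r : Cusp) : r.sign1 = 1 ∨ r.sign1 = -1 := by cases r <;> simp [sign1]

/-- The part of the `x`-line, a plane with a slit or a double slit, over which the stars around the
two branch points other than `r` overlap. -/
def region (r : Cusp) : Set ℂ :=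
  {x | (r.sign0 : ℂ) * x ∈ slitPlane ∧ (r.sign1 : ℂ) * (x - 1) ∈ slitPlane}

theorem isOpen_region (r : Cusp) : IsOpen r.region :=
  (isOpen_slitPlane.preimage (by fun_prop : Continuous fun x : ℂ => (r.sign0 : ℂ) * x)).inter
    (isOpen_slitPlane.preimage (by fun_prop : Continuous fun x : ℂ => (r.sign1 : ℂ) * (x - 1)))

theorem ne_zero_of_mem_region {r : Cusp} {x : ℂ} (hx : x ∈ r.region) : x ≠ 0 :=
  right_ne_zero_of_mul (slitPlane_ne_zero hx.1)

theorem sub_one_ne_zero_of_mem_region {r : Cusp} {x : ℂ} (hx : x ∈ r.region) : x - 1 ≠ 0 :=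
  right_ne_zero_of_mul (slitPlane_ne_zero hx.2)

variable (a b d : ℕ)

/-- A branch of `(x ^ a (x - 1) ^ b) ^ (1 / d)` on the region; on the upper half plane the three
branches agree. -/
def branch (r : Cusp) (x : ℂ) : ℂ :=
  exp ((a * (log (r.sign0 * x) + logSign r.sign0) +
    b * (log (r.sign1 * (x - 1)) + logSign r.sign1)) / d)

variable {a b d}

theorem branch_ne_zero (r : Cusp) (x : ℂ) : r.branch a b d x ≠ 0 := exp_ne_zero _

theorem branch_pow (hd : 0 < d) {r : Cusp} {x : ℂ} (hx : x ∈ r.region) :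
    r.branch a b d x ^ d = x ^ a * (x - 1) ^ b := by
  have h : ∀ (s : ℤ) (z : ℂ), (s = 1 ∨ s = -1) → z ≠ 0 → exp (log (s * z) + logSign s) = z := by
    intro s z hs hz
    have hs0 : (s : ℂ) ≠ 0 := by rcases hs with rfl | rfl <;> simp
    have hss : (s : ℂ) * s = 1 := by rcases hs with rfl | rfl <;> simp
    rw [exp_add, exp_log (mul_ne_zero hs0 hz), exp_logSign hs, mul_right_comm, hss, one_mul]
  rw [branch, ← exp_nat_mul, mul_div_cancel₀ _ (Nat.cast_ne_zero.2 hd.ne'), exp_add, exp_nat_mul,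
    exp_nat_mul, h _ _ r.sign0_eq (ne_zero_of_mem_region hx),
    h _ _ r.sign1_eq (sub_one_ne_zero_of_mem_region hx)]

theorem differentiableAt_branch {r : Cusp} {x : ℂ} (hx : x ∈ r.region) :
    DifferentiableAt ℂ (r.branch a b d) x := by
  have h0 : DifferentiableAt ℂ (fun x : ℂ => log (r.sign0 * x)) x :=
    DifferentiableAt.clog (by fun_prop) hx.1
  have h1 : DifferentiableAt ℂ (fun x : ℂ => log (r.sign1 * (x - 1))) x :=
    DifferentiableAt.clog (by fun_prop) hx.2
  unfold branch
  exact (((h0.add_const _).const_mul _).add ((h1.add_const _).const_mul _)).div_const _ |>.cexp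

theorem log_neg_of_im_pos {x : ℂ} (hx : 0 < x.im) : log (-x) + Real.pi * I = log x := by
  refine Complex.ext ?_ ?_
  · simp [log_re]
  · simp [log_im, arg_neg_eq_arg_sub_pi_of_im_pos hx]

theorem log_neg_of_im_neg {x : ℂ} (hx : x.im < 0) :
    log (-x) + Real.pi * I = log x + 2 * Real.pi * I := by
  refine Complex.ext ?_ ?_
  · simp [log_re]
  · simp [log_im, arg_neg_eq_arg_add_pi_of_im_neg hx]; ring

theorem branch_of_im_pos (r : Cusp) {x : ℂ} (hx : 0 < x.im) :
    r.branch a b d x = infty.branch a b d x := by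
  have h : ∀ (s : ℤ) (z : ℂ), (s = 1 ∨ s = -1) → 0 < z.im → log (s * z) + logSign s = log z := by
    rintro s z (rfl | rfl) hz
    · simp [logSign]
    · have := log_neg_of_im_pos hz
      simpa [logSign] using this
  have hx' : 0 < (x - 1).im := by simpa using hx
  rw [branch, branch, h _ _ r.sign0_eq hx, h _ _ infty.sign0_eq hx, h _ _ r.sign1_eq hx',
    h _ _ infty.sign1_eq hx']

theorem branch_one_of_im_neg {x : ℂ} (hx : x.im < 0) :
    one.branch a b d x = omega d ^ a * infty.branch a b d x := by
  have h1 := log_neg_of_im_neg hx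
  rw [branch, branch, omega, ← exp_nat_mul, ← exp_add]
  congr 1
  simp only [sign0, sign1, logSign, Int.cast_neg, Int.cast_one, one_mul, neg_mul, if_true]
  norm_num
  rw [h1]
  ring

theorem branch_infty_of_im_neg {x : ℂ} (hx : x.im < 0) :
    infty.branch a b d x = omega d ^ b * zero.branch a b d x := by
  have h1 := log_neg_of_im_neg (x := x - 1) (by simpa using hx)
  rw [neg_sub] at h1
  rw [branch, branch, omega, ← exp_nat_mul, ← exp_add]
  congr 1
  simp only [sign0, sign1, logSign, Int.cast_neg, Int.cast_one, one_mul, neg_mul, if_true, neg_sub]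
  norm_num
  rw [h1]
  ring

/-- The sheet over a region on which `y` is `v` times the chosen branch. -/
def sheet (hd : 0 < d) (r : Cusp) (v : ℂ) (hv : v ^ d = 1) : Chart a b d where
  dom := r.region
  X := id
  Y x := v * r.branch a b d x
  merX t _ := MeromorphicAt.id t
  merY t ht := by
    refine (MeromorphicAt.const v t).mul (AnalyticAt.meromorphicAt ?_)
    refine DifferentiableOn.analyticAt (s := r.region) (fun x hx => ?_) (r.isOpen_region.mem_nhds ht)
    exact (differentiableAt_branch hx).differentiableWithinAt
  onCurve t ht :=
    { tendsto := nhdsNE_le_cofinite t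
      eqn := by
        filter_upwards [nhdsWithin_le_nhds (r.isOpen_region.mem_nhds ht)] with x hx
        rw [mul_pow, hv, one_mul, branch_pow hd hx]
        rfl }

section sheet

variable (hd : 0 < d) (r : Cusp) (v : ℂ) (hv : v ^ d = 1)

theorem sheet_val_xK (x : (r.sheet (a := a) (b := b) hd v hv).dom) :
    ((r.sheet hd v hv).place hd x).val (xK a b d) = ((x : ℂ) : OnePoint ℂ) :=
  Chart.place_val hd _ (g := id) (evalGerm_xK hd _) continuousAt_id

theorem sheet_val_yK (x : (r.sheet (a := a) (b := b) hd v hv).dom) :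
    ((r.sheet hd v hv).place hd x).val (yK a b d) = ((v * r.branch a b d x : ℂ) : OnePoint ℂ) :=
  Chart.place_val hd _ (evalGerm_yK hd _)
    (continuousAt_const.mul (differentiableAt_branch x.2).continuousAt)

theorem sheet_map_deck_pow (k : ℕ) (v' : ℂ) (hv' : v' ^ d = 1) (h : v' = omega d ^ k * v)
    (x : (r.sheet (a := a) (b := b) hd v hv).dom) :
    ((r.sheet hd v hv).place hd x).map (deck a b d ^ k) =
      (r.sheet hd v' hv').place hd ⟨x, x.2⟩ := by
  induction k generalizing v' with
  | zero =>
    rw [pow_zero, one_mul] at h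
    subst h
    rfl
  | succ k ih =>
    have hk : (omega d ^ k * v) ^ d = 1 := by
      rw [mul_pow, ← pow_mul, mul_comm k, pow_mul, omega_pow, one_pow, one_mul, hv]
    rw [Place.map_deck_pow_succ, ih _ hk rfl]
    refine Chart.map_deck_place hd rfl (Eventually.of_forall fun s => rfl)
      (Eventually.of_forall fun s => ?_)
    simp only [sheet, h]
    ring

end sheet

variable (a b d) in
/-- The part of the curve over a region. -/
def overlap (r : Cusp) : Set (Place (FunctionRing a b d)) :=
  {P | ∃ x ∈ r.region, P.val (xK a b d) = (x : OnePoint ℂ)}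

theorem isOpen_overlap (r : Cusp) : IsOpen (r.overlap a b d) := by
  have h1 : IsOpen ((fun u : ℂ => (u : OnePoint ℂ)) '' r.region) :=
    OnePoint.isOpenEmbedding_coe.isOpenMap _ r.isOpen_region
  convert h1.preimage (Place.continuous_val (xK a b d)) using 1
  ext P
  constructor
  · rintro ⟨u, hu, hu'⟩; exact ⟨u, hu, hu'.symm⟩
  · rintro ⟨u, hu, hu'⟩; exact ⟨u, hu, hu'.symm⟩

theorem mem_nbhd_one_iff {P : Place (FunctionRing a b d)} :
    P ∈ one.nbhd a b d ↔ ∃ x ∈ slitPlane, P.val (xK a b d) = (x : OnePoint ℂ) := by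
  have h1 : (one.wU a b d : FunctionRing a b d) = 1 - xK a b d := by simp [wU]
  have h2 : xK a b d = 1 - (one.wU a b d : FunctionRing a b d) := by rw [h1]; ring
  constructor
  · rintro ⟨u, hu, hu'⟩
    refine ⟨1 - u, hu', ?_⟩
    rw [h2]
    exact P.val_sub P.val_one hu
  · rintro ⟨x, hx, hP⟩
    refine ⟨1 - x, ?_, by rwa [sub_sub_cancel]⟩
    rw [h1]
    exact P.val_sub P.val_one hP

theorem mem_nbhd_zero_iff {P : Place (FunctionRing a b d)} :
    P ∈ zero.nbhd a b d ↔ ∃ x : ℂ, 1 - x ∈ slitPlane ∧ P.val (xK a b d) = (x : OnePoint ℂ) :=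
  exists_congr fun _ => and_comm

theorem mem_nbhd_infty_iff {P : Place (FunctionRing a b d)} {x : ℂ}
    (hP : P.val (xK a b d) = (x : OnePoint ℂ)) :
    P ∈ infty.nbhd a b d ↔ x ≠ 0 ∧ 1 - x⁻¹ ∈ slitPlane := by
  constructor
  · rintro ⟨u, hu, hu'⟩
    have hx : x ≠ 0 := by
      rintro rfl
      have h1 := P.val_inv_of_zero (f := zero.wU a b d) hP
      exact OnePoint.infty_ne_coe _ (h1.symm.trans hu)
    refine ⟨hx, ?_⟩
    have h2 := P.val_inv (f := zero.wU a b d) hP hx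
    rw [show u = x⁻¹ from OnePoint.coe_injective (hu.symm.trans h2)] at hu'
    exact hu'
  · rintro ⟨hx, hx'⟩
    exact ⟨x⁻¹, P.val_inv (f := zero.wU a b d) hP hx, hx'⟩

theorem overlap_infty : infty.overlap a b d = zero.nbhd a b d ∩ one.nbhd a b d := by
  ext P
  have h1 : ∀ x : ℂ, (-1 : ℂ) * (x - 1) = 1 - x := fun x => by ring
  constructor
  · rintro ⟨x, ⟨hx0, hx1⟩, hP⟩
    simp only [sign0, sign1, Int.cast_one, one_mul, Int.cast_neg, h1] at hx0 hx1
    exact ⟨mem_nbhd_zero_iff.2 ⟨x, hx1, hP⟩, mem_nbhd_one_iff.2 ⟨x, hx0, hP⟩⟩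
  · rintro ⟨h0, h1'⟩
    obtain ⟨x, hx1, hP⟩ := mem_nbhd_zero_iff.1 h0
    obtain ⟨x', hx0, hP'⟩ := mem_nbhd_one_iff.1 h1'
    obtain rfl : x = x' := OnePoint.coe_injective (hP.symm.trans hP')
    refine ⟨x, ⟨?_, ?_⟩, hP⟩
    · simpa only [sign0, Int.cast_one, one_mul] using hx0
    · simpa only [sign1, Int.cast_neg, Int.cast_one, h1] using hx1

theorem overlap_one : one.overlap a b d = zero.nbhd a b d ∩ infty.nbhd a b d := by
  ext P
  have h1 : ∀ x : ℂ, (-1 : ℂ) * (x - 1) = 1 - x := fun x => by ring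
  constructor
  · rintro ⟨x, hx, hP⟩
    have hx0 := ne_zero_of_mem_region hx
    obtain ⟨hx0', hx1⟩ := hx
    simp only [sign0, sign1, Int.cast_one, Int.cast_neg, h1, neg_mul, one_mul] at hx0' hx1
    refine ⟨mem_nbhd_zero_iff.2 ⟨x, by simpa using hx1, hP⟩, (mem_nbhd_infty_iff hP).2 ⟨hx0, ?_⟩⟩
    by_contra hn
    obtain ⟨r, hr0, -, rfl⟩ := one_sub_inv_notMem_slitPlane hn
    rw [neg_ofReal_mem_slitPlane] at hx0'
    linarith
  · rintro ⟨h0, hi⟩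
    obtain ⟨x, hx1, hP⟩ := mem_nbhd_zero_iff.1 h0
    obtain ⟨hx0, hx2⟩ := (mem_nbhd_infty_iff hP).1 hi
    refine ⟨x, ⟨?_, ?_⟩, hP⟩
    · simp only [sign0, Int.cast_neg, Int.cast_one, neg_mul, one_mul]
      by_contra hn
      rw [mem_slitPlane_iff, not_or, not_not, not_lt] at hn
      simp only [neg_re, neg_im, neg_eq_zero, Left.neg_nonpos_iff] at hn
      obtain ⟨r, rfl⟩ : ∃ r : ℝ, x = r := ⟨x.re, Complex.ext rfl (by simpa using hn.2)⟩
      rw [ofReal_re] at hn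
      rw [← ofReal_one, ← ofReal_sub, ofReal_mem_slitPlane] at hx1
      rw [← ofReal_one, ← ofReal_inv, ← ofReal_sub, ofReal_mem_slitPlane] at hx2
      have hr : 0 < r := lt_of_le_of_ne hn.1 (by rintro rfl; simp at hx0)
      have : r⁻¹ < 1 := by linarith
      have h3 := (inv_lt_one₀ hr).1 this
      linarith
    · simpa only [sign1, Int.cast_neg, Int.cast_one, h1] using hx1

theorem overlap_zero : zero.overlap a b d = one.nbhd a b d ∩ infty.nbhd a b d := by
  ext P
  constructor
  · rintro ⟨x, hx, hP⟩
    have hx0 := ne_zero_of_mem_region hx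
    obtain ⟨hx0', hx1⟩ := hx
    simp only [sign0, sign1, Int.cast_one, one_mul] at hx0' hx1
    refine ⟨mem_nbhd_one_iff.2 ⟨x, hx0', hP⟩, (mem_nbhd_infty_iff hP).2 ⟨hx0, ?_⟩⟩
    by_contra hn
    obtain ⟨r, hr0, hr1, rfl⟩ := one_sub_inv_notMem_slitPlane hn
    rw [← ofReal_one, ← ofReal_sub, ofReal_mem_slitPlane] at hx1
    linarith
  · rintro ⟨h0, hi⟩
    obtain ⟨x, hx1, hP⟩ := mem_nbhd_one_iff.1 h0
    obtain ⟨hx0, hx2⟩ := (mem_nbhd_infty_iff hP).1 hi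
    refine ⟨x, ⟨?_, ?_⟩, hP⟩
    · simpa only [sign0, Int.cast_one, one_mul] using hx1
    · simp only [sign1, Int.cast_one, one_mul]
      by_contra hn
      rw [mem_slitPlane_iff, not_or, not_not, not_lt] at hn
      simp only [sub_re, one_re, sub_im, one_im, sub_zero, tsub_le_iff_right, zero_add] at hn
      obtain ⟨r, rfl⟩ : ∃ r : ℝ, x = r := ⟨x.re, Complex.ext rfl (by simpa using hn.2)⟩
      rw [ofReal_re] at hn
      rw [ofReal_mem_slitPlane] at hx1
      rw [← ofReal_one, ← ofReal_inv, ← ofReal_sub, ofReal_mem_slitPlane] at hx2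
      have : r⁻¹ < 1 := by linarith
      have h3 := (inv_lt_one₀ hx1).1 this
      linarith [hn.1]

theorem im_ne_zero_of_mem {x : ℂ} (h1 : x ∈ one.region) (h2 : x ∈ infty.region) : x.im ≠ 0 := by
  intro h0
  have h3 := h1.1
  have h4 := h2.1
  simp only [sign0, Int.cast_neg, Int.cast_one, neg_mul, one_mul] at h3 h4
  rw [mem_slitPlane_iff] at h3 h4
  simp only [neg_re, neg_im, h0] at h3 h4
  simp at h3 h4
  linarith

theorem mem_region_of_im_ne_zero (r : Cusp) {x : ℂ} (h : x.im ≠ 0) : x ∈ r.region := by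
  constructor <;> rw [mem_slitPlane_iff] <;> right <;> cases r <;> simpa [sign0, sign1] using h

/-! #### Labels of the sheets -/

/-- The value of a finite point of the Riemann sphere. -/
def finPart (z : OnePoint ℂ) : ℂ := z.elim 0 id

theorem finPart_coe (z : ℂ) : finPart (z : OnePoint ℂ) = z := rfl

theorem continuousAt_finPart (z : ℂ) : ContinuousAt finPart (z : OnePoint ℂ) := by
  rw [OnePoint.continuousAt_coe]
  exact continuousAt_id

variable (a b d) in
/-- The label of the sheet through a point, with respect to the branch of `y` over a region. -/
def label (r : Cusp) (P : Place (FunctionRing a b d)) : ℂ :=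
  finPart (P.val (yK a b d)) / r.branch a b d (finPart (P.val (xK a b d)))

theorem label_sheet (hd : 0 < d) (r : Cusp) (v : ℂ) (hv : v ^ d = 1)
    (x : (r.sheet (a := a) (b := b) hd v hv).dom) :
    r.label a b d ((r.sheet hd v hv).place hd x) = v := by
  rw [label, sheet_val_xK, sheet_val_yK, finPart_coe, finPart_coe,
    mul_div_cancel_right₀ _ (r.branch_ne_zero _)]

theorem sheet_mem_overlap (hd : 0 < d) (r : Cusp) (v : ℂ) (hv : v ^ d = 1)
    (x : (r.sheet (a := a) (b := b) hd v hv).dom) : (r.sheet hd v hv).place hd x ∈ r.overlap a b d :=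
  ⟨x, x.2, sheet_val_xK hd r v hv x⟩

/-- Every point over a region lies on one of the sheets. -/
theorem exists_sheet_eq (hd : 0 < d) (r : Cusp) {P : Place (FunctionRing a b d)}
    (hP : P ∈ r.overlap a b d) : ∃ (k : ℕ) (hk : (omega d ^ k) ^ d = 1)
      (x : (r.sheet (a := a) (b := b) hd (omega d ^ k) hk).dom),
      P = (r.sheet hd (omega d ^ k) hk).place hd x ∧ P.val (xK a b d) = ((x : ℂ) : OnePoint ℂ) := by
  obtain ⟨x, hx, hPx⟩ := hP
  obtain ⟨k, hk⟩ := Place.exists_eq_map_deck_pow hd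
    (hPx.trans (r.sheet_val_xK hd 1 (one_pow d) ⟨x, hx⟩).symm)
  have h1 : (omega d ^ k) ^ d = 1 := by rw [← pow_mul, mul_comm, pow_mul, omega_pow, one_pow]
  refine ⟨k, h1, ⟨x, hx⟩, hk.trans ?_, hPx⟩
  exact r.sheet_map_deck_pow hd 1 (one_pow d) k _ h1 (mul_one _).symm ⟨x, hx⟩

theorem label_pow (hd : 0 < d) (r : Cusp) {P : Place (FunctionRing a b d)}
    (hP : P ∈ r.overlap a b d) : r.label a b d P ^ d = 1 := by
  obtain ⟨k, hk, x, rfl, -⟩ := r.exists_sheet_eq hd hP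
  rw [label_sheet, hk]

theorem label_map_deck (hd : 0 < d) (r : Cusp) {P : Place (FunctionRing a b d)}
    (hP : P ∈ r.overlap a b d) :
    r.label a b d (P.map (deck a b d)) = omega d * r.label a b d P := by
  obtain ⟨k, hk, x, rfl, -⟩ := r.exists_sheet_eq hd hP
  have h1 : (omega d ^ (k + 1)) ^ d = 1 := by rw [← pow_mul, mul_comm, pow_mul, omega_pow, one_pow]
  have h2 := r.sheet_map_deck_pow (a := a) (b := b) hd _ hk 1 _ h1 (by rw [pow_succ']; ring) x
  rw [pow_one] at h2
  rw [h2, label_sheet, label_sheet, pow_succ']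

theorem map_deck_mem_overlap {r : Cusp} {P : Place (FunctionRing a b d)}
    (hP : P ∈ r.overlap a b d) : P.map (deck a b d) ∈ r.overlap a b d := by
  obtain ⟨x, hx, hPx⟩ := hP
  refine ⟨x, hx, ?_⟩
  change P.val (deck a b d (xK a b d)) = _
  rw [deck_xK, hPx]

/-- The label is locally constant. -/
theorem eventually_label_eq (hd : 0 < d) (r : Cusp) {P : Place (FunctionRing a b d)}
    (hP : P ∈ r.overlap a b d) : ∀ᶠ Q in 𝓝 P, r.label a b d Q = r.label a b d P := by
  obtain ⟨k, hk, x, hPx, hx⟩ := r.exists_sheet_eq hd hP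
  have hy : P.val (yK a b d) = _ := (congrArg (fun Q => Q.val (yK a b d)) hPx).trans
    (sheet_val_yK hd r _ hk x)
  have h1 : ContinuousAt (fun Q : Place (FunctionRing a b d) => finPart (Q.val (yK a b d))) P := by
    refine ContinuousAt.comp (g := finPart) ?_ (Place.continuous_val _).continuousAt
    rw [hy]; exact continuousAt_finPart _
  have h2 : ContinuousAt (fun Q : Place (FunctionRing a b d) => finPart (Q.val (xK a b d))) P := by
    refine ContinuousAt.comp (g := finPart) ?_ (Place.continuous_val _).continuousAt
    rw [hx]; exact continuousAt_finPart _
  have h3 : ContinuousAt (fun Q : Place (FunctionRing a b d) =>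
      r.branch a b d (finPart (Q.val (xK a b d)))) P := by
    refine ContinuousAt.comp (g := r.branch a b d) ?_ h2
    rw [hx, finPart_coe]
    exact (differentiableAt_branch x.2).continuousAt
  have h4 : ContinuousAt (r.label a b d) P := h1.div h3 (r.branch_ne_zero _)
  -- the possible values of the label form a finite set
  have h5 : ({z : ℂ | z ^ d = 1} \ {r.label a b d P}).Finite :=
    (finite_setOf_pow_eq hd 1).subset Set.sdiff_subset
  have h6 := h4.eventually (h5.isClosed.isOpen_compl.mem_nhds (by simp))
  filter_upwards [h6, r.isOpen_overlap.mem_nhds hP] with Q hQ hQ'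
  by_contra hne
  exact hQ ⟨label_pow hd r hQ', hne⟩

/-- The base point of a region. -/
def base : Cusp → ℝ
  | zero => 2
  | one => -1
  | infty => 1 / 2

theorem segment_mem_region (r : Cusp) {x : ℂ} (hx : x ∈ r.region) {s : ℝ} (h0 : 0 ≤ s)
    (h1 : s ≤ 1) : ((1 - s : ℝ) : ℂ) * r.base + s * x ∈ r.region := by
  have hp0 : 0 < (r.sign0 : ℝ) * r.base := by cases r <;> norm_num [sign0, base]
  have hp1 : 0 < (r.sign1 : ℝ) * (r.base - 1) := by cases r <;> norm_num [sign1, base]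
  constructor
  · have := segment_mem_slitPlane hp0 h0 h1 hx.1
    convert this using 1
    push_cast; ring
  · have := segment_mem_slitPlane hp1 h0 h1 hx.2
    convert this using 1
    push_cast; ring

theorem base_mem_region (r : Cusp) : (r.base : ℂ) ∈ r.region := by
  have h : ((3 : ℂ) + I).im ≠ 0 := by simp
  simpa using r.segment_mem_region (r.mem_region_of_im_ne_zero h) le_rfl zero_le_one

/-- A difference of two primitives is constant on each sheet. -/
theorem sub_eq_of_primitive (hd : 0 < d) (r : Cusp)
    {φ : C(stdSimplex ℝ (Fin 2), Place (FunctionRing a b d)) → ℂ}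
    {f f' : Place (FunctionRing a b d) → ℂ}
    (hf : ∀ γ : C(stdSimplex ℝ (Fin 2), Place (FunctionRing a b d)), (∀ u, γ u ∈ r.overlap a b d) →
      φ γ = f (γ (stdSimplex.vertex 1)) - f (γ (stdSimplex.vertex 0)))
    (hf' : ∀ γ : C(stdSimplex ℝ (Fin 2), Place (FunctionRing a b d)), (∀ u, γ u ∈ r.overlap a b d) →
      φ γ = f' (γ (stdSimplex.vertex 1)) - f' (γ (stdSimplex.vertex 0)))
    (v : ℂ) (hv : v ^ d = 1) (x : (r.sheet (a := a) (b := b) hd v hv).dom) :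
    f ((r.sheet hd v hv).place hd x) - f' ((r.sheet hd v hv).place hd x) =
      f ((r.sheet hd v hv).place hd ⟨r.base, r.base_mem_region⟩) -
        f' ((r.sheet hd v hv).place hd ⟨r.base, r.base_mem_region⟩) := by
  let γ : C(stdSimplex ℝ (Fin 2), Place (FunctionRing a b d)) :=
    { toFun := fun u => (r.sheet hd v hv).place hd
        ⟨((1 - u.1 1 : ℝ) : ℂ) * r.base + (u.1 1 : ℝ) * x,
          r.segment_mem_region x.2 (u.2.1 1) (stdSimplex.le_one u 1)⟩
      continuous_toFun := by
        refine ((r.sheet hd v hv).continuous_place hd).comp (Continuous.subtype_mk ?_ _)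
        have h : Continuous fun u : stdSimplex ℝ (Fin 2) => u.1 1 :=
          (continuous_apply 1).comp continuous_subtype_val
        exact ((continuous_ofReal.comp (continuous_const.sub h)).mul continuous_const).add
          ((continuous_ofReal.comp h).mul continuous_const) }
  have hγ : ∀ u, γ u ∈ r.overlap a b d := fun u => sheet_mem_overlap hd r v hv _
  have h1 : γ (stdSimplex.vertex 1) = (r.sheet hd v hv).place hd x := by
    simp only [γ, ContinuousMap.coe_mk]
    congr 1
    exact Subtype.ext (by simp)
  have h0 : γ (stdSimplex.vertex 0) = (r.sheet hd v hv).place hd ⟨r.base, r.base_mem_region⟩ := by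
    simp only [γ, ContinuousMap.coe_mk]
    congr 1
    exact Subtype.ext (by simp)
  have e1 := hf γ hγ
  have e2 := hf' γ hγ
  rw [h0, h1] at e1 e2
  linear_combination e2 - e1

end Cusp

end Sheets

/-! ### Eigencocycles: averaging over a self-map of finite order -/

section Equivariance

open CategoryTheory

variable {X : Type} [TopologicalSpace X]

/-- The function `f` is a primitive of the 1-cochain `φ` on `U`. -/
def IsPrimitiveOn (U : Set X) (φ : C(stdSimplex ℝ (Fin 2), X) → ℂ) (f : X → ℂ) : Prop :=
  ∀ γ : C(stdSimplex ℝ (Fin 2), X), (∀ u, γ u ∈ U) →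
    φ γ = f (γ (stdSimplex.vertex 1)) - f (γ (stdSimplex.vertex 0))

theorem IsPrimitiveOn.mono {U V : Set X} {φ : C(stdSimplex ℝ (Fin 2), X) → ℂ} {f : X → ℂ}
    (h : IsPrimitiveOn U φ f) (hV : V ⊆ U) : IsPrimitiveOn V φ f := fun γ hγ =>
  h γ fun u => hV (hγ u)

theorem IsPrimitiveOn.add {U : Set X} {φ ψ : C(stdSimplex ℝ (Fin 2), X) → ℂ} {f g : X → ℂ}
    (h : IsPrimitiveOn U φ f) (h' : IsPrimitiveOn U ψ g) : IsPrimitiveOn U (φ + ψ) (f + g) := by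
  intro γ hγ
  simp only [Pi.add_apply, h γ hγ, h' γ hγ]
  ring

theorem IsPrimitiveOn.smul {U : Set X} {φ : C(stdSimplex ℝ (Fin 2), X) → ℂ} {f : X → ℂ}
    (h : IsPrimitiveOn U φ f) (c : ℂ) : IsPrimitiveOn U (c • φ) (c • f) := by
  intro γ hγ
  simp only [Pi.smul_apply, h γ hγ, smul_eq_mul]
  ring

theorem IsCocycle.add {φ ψ : C(stdSimplex ℝ (Fin 2), X) → ℂ} (h : IsCocycle φ) (h' : IsCocycle ψ) :
    IsCocycle (φ + ψ) := by
  intro s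
  have h1 := h s
  have h2 := h' s
  simp only [Pi.add_apply]
  linear_combination h1 + h2

theorem IsCocycle.smul {φ : C(stdSimplex ℝ (Fin 2), X) → ℂ} (h : IsCocycle φ) (c : ℂ) :
    IsCocycle (c • φ) := by
  intro s
  have h1 := h s
  simp only [Pi.smul_apply, smul_eq_mul]
  linear_combination c * h1

/-- Pull-back of 1-cochains under a self-map. -/
def pullCochain (σ : C(X, X)) :
    (C(stdSimplex ℝ (Fin 2), X) → ℂ) →ₗ[ℂ] (C(stdSimplex ℝ (Fin 2), X) → ℂ) :=
  LinearMap.funLeft ℂ ℂ fun γ => σ.comp γ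

/-- Pull-back of functions under a self-map. -/
def pullFun (σ : C(X, X)) : (X → ℂ) →ₗ[ℂ] (X → ℂ) := LinearMap.funLeft ℂ ℂ σ

variable (X) in
/-- The dual of `H₁(X, ℂ)`. -/
abbrev DualH1 : Type := (chains X).homology 1 ⟶ ModuleCat.of ℂ ℂ

/-- Pull-back of linear forms on `H₁(X, ℂ)` under a self-map. -/
def pullDual (σ : C(X, X)) : DualH1 X →ₗ[ℂ] DualH1 X :=
  Linear.leftComp ℂ _ (HomologicalComplex.homologyMap (chainsMap σ) 1)

theorem IsCocycle.pull (σ : C(X, X)) {φ : C(stdSimplex ℝ (Fin 2), X) → ℂ} (h : IsCocycle φ) :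
    IsCocycle (pullCochain σ φ) := fun s => h (σ.comp s)

theorem Represents.pull (σ : C(X, X)) {φ : C(stdSimplex ℝ (Fin 2), X) → ℂ} {θ : DualH1 X}
    (h : Represents φ θ) : Represents (pullCochain σ φ) (pullDual σ θ) := h.comp σ

theorem IsPrimitiveOn.pull {σ : C(X, X)} {U : Set X} (hU : ∀ x ∈ U, σ x ∈ U)
    {φ : C(stdSimplex ℝ (Fin 2), X) → ℂ} {f : X → ℂ} (h : IsPrimitiveOn U φ f) :
    IsPrimitiveOn U (pullCochain σ φ) (pullFun σ f) := fun γ hγ =>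
  h (σ.comp γ) fun u => hU _ (hγ u)

/-- A relation between two spaces which is stable under linear combinations and under a pair of
endomorphisms is stable under the projections to their eigenspaces. -/
theorem eigenProj_induction {V W : Type*} [AddCommGroup V] [Module ℂ V] [AddCommGroup W]
    [Module ℂ W] (P : V → W → Prop) (hadd : ∀ v v' w w', P v w → P v' w' → P (v + v') (w + w'))
    (hsmul : ∀ (c : ℂ) v w, P v w → P (c • v) (c • w)) (h0 : P 0 0) {S : V →ₗ[ℂ] V}
    {T : W →ₗ[ℂ] W} (hST : ∀ v w, P v w → P (S v) (T w)) (d : ℕ) (μ : ℂ) {v : V} {w : W}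
    (h : P v w) : P (eigenProj S d μ v) (eigenProj T d μ w) := by
  have hk : ∀ k : ℕ, P ((S ^ k) v) ((T ^ k) w) := by
    intro k
    induction k with
    | zero => exact h
    | succ k ih => rw [pow_succ', pow_succ']; exact hST _ _ ih
  rw [eigenProj_apply, eigenProj_apply]
  refine hsmul _ _ _ ?_
  induction d with
  | zero => simpa using h0
  | succ d ih =>
    rw [Finset.sum_range_succ, Finset.sum_range_succ]
    exact hadd _ _ _ _ ih (hsmul _ _ _ (hk d))

theorem pullFun_pow_apply (σ : C(X, X)) (k : ℕ) (f : X → ℂ) (x : X) :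
    (pullFun σ ^ k) f x = f (σ^[k] x) := by
  induction k generalizing f with
  | zero => rfl
  | succ k ih =>
    rw [pow_succ, Module.End.mul_apply, ih, Function.iterate_succ_apply']
    rfl

theorem pullFun_pow (σ : C(X, X)) {d : ℕ} (h : σ^[d] = id) : pullFun σ ^ d = 1 :=
  LinearMap.ext fun f => funext fun x => by rw [pullFun_pow_apply, h]; rfl

/-- Averaging does not change a function where it is already an eigenfunction. -/
theorem eigenProj_pullFun_eq (σ : C(X, X)) {d : ℕ} (hd : 0 < d) {μ : ℂ} (hμ : μ ^ d = 1)
    {f g : X → ℂ} {U : Set X} (hU : ∀ x ∈ U, σ x ∈ U) (hfg : ∀ x ∈ U, f x = g x)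
    (hg : ∀ x ∈ U, g (σ x) = μ * g x) {x : X} (hx : x ∈ U) :
    eigenProj (pullFun σ) d μ f x = g x := by
  have hμ0 : μ ≠ 0 := by rintro rfl; rw [zero_pow hd.ne'] at hμ; exact zero_ne_one hμ
  have h1 : ∀ k, σ^[k] x ∈ U ∧ g (σ^[k] x) = μ ^ k * g x := by
    intro k
    induction k with
    | zero => exact ⟨hx, by simp⟩
    | succ k ih =>
      rw [Function.iterate_succ_apply']
      exact ⟨hU _ ih.1, by rw [hg _ ih.1, ih.2, pow_succ]; ring⟩
  rw [eigenProj_apply]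
  simp only [Pi.smul_apply, Finset.sum_apply, smul_eq_mul, pullFun_pow_apply]
  rw [Finset.sum_congr rfl fun k _ => by
    rw [hfg _ (h1 k).1, (h1 k).2, inv_pow, inv_mul_cancel_left₀ (pow_ne_zero k hμ0)]]
  rw [Finset.sum_const, Finset.card_range, nsmul_eq_mul,
    inv_mul_cancel_left₀ (Nat.cast_ne_zero.2 hd.ne')]

end Equivariance

/-! ### Gluing data of classes in the dual of `H₁` -/

section GluingData

open Filter Topology Complex

variable {a b d : ℕ}

variable (a b d) in
/-- The deck transformation as a continuous self-map of the curve. -/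
def deckMap : C(Place (FunctionRing a b d), Place (FunctionRing a b d)) :=
  ⟨Place.map (deck a b d), Place.continuous_map _⟩

theorem deckMap_iterate (k : ℕ) (P : Place (FunctionRing a b d)) :
    (deckMap a b d)^[k] P = P.map (deck a b d ^ k) := by
  induction k with
  | zero => rfl
  | succ k ih => rw [Function.iterate_succ_apply', ih, Place.map_deck_pow_succ]; rfl

theorem deckMap_iterate_self : (deckMap a b d)^[d] = id := by
  funext P
  rw [deckMap_iterate, deck_pow_self]
  rfl

theorem omega_pow_pow (j : ℕ) : (omega d ^ j) ^ d = 1 := by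
  rw [← pow_mul, mul_comm, pow_mul, omega_pow, one_pow]

namespace Cusp

/-- Two primitives of a cochain on an overlap that are eigenfunctions of the deck transformation
differ by a multiple of a power of the label. -/
theorem exists_sub_eq_mul_label_pow (hd : 0 < d) (r : Cusp) (j : ℕ)
    {φ : C(stdSimplex ℝ (Fin 2), Place (FunctionRing a b d)) → ℂ}
    {f f' : Place (FunctionRing a b d) → ℂ} (hf : IsPrimitiveOn (r.overlap a b d) φ f)
    (hf' : IsPrimitiveOn (r.overlap a b d) φ f')
    (he : ∀ P ∈ r.overlap a b d, f (deckMap a b d P) = omega d ^ j * f P)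
    (he' : ∀ P ∈ r.overlap a b d, f' (deckMap a b d P) = omega d ^ j * f' P) :
    ∃ C : ℂ, ∀ P ∈ r.overlap a b d, f P - f' P = C * r.label a b d P ^ j := by
  set s := r.sheet (a := a) (b := b) hd 1 (one_pow d) with hs
  set Q := s.place hd ⟨r.base, r.base_mem_region⟩ with hQ
  have hQm : Q ∈ r.overlap a b d := r.sheet_mem_overlap hd 1 (one_pow d) _
  have hk : ∀ k : ℕ, (deckMap a b d)^[k] Q ∈ r.overlap a b d ∧
      f ((deckMap a b d)^[k] Q) - f' ((deckMap a b d)^[k] Q) = (omega d ^ j) ^ k * (f Q - f' Q) := by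
    intro k
    induction k with
    | zero => exact ⟨hQm, by simp⟩
    | succ k ih =>
      rw [Function.iterate_succ_apply']
      refine ⟨map_deck_mem_overlap ih.1, ?_⟩
      rw [he _ ih.1, he' _ ih.1, ← mul_sub, ih.2, pow_succ]
      ring
  refine ⟨f Q - f' Q, fun P hP => ?_⟩
  obtain ⟨k, hk', x, rfl, -⟩ := r.exists_sheet_eq hd hP
  rw [r.sub_eq_of_primitive hd hf hf', label_sheet]
  have h1 := r.sheet_map_deck_pow (a := a) (b := b) hd 1 (one_pow d) k _ hk' (mul_one _).symm
    ⟨r.base, r.base_mem_region⟩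
  rw [← h1, ← deckMap_iterate, (hk k).2, ← pow_mul, ← pow_mul, mul_comm j k]
  ring

/-- The points over the upper half plane have the same label on all three overlaps, those over the
lower half plane have labels that differ by the monodromy around `0` and `1`. -/
theorem label_of_mem {P : Place (FunctionRing a b d)}
    (h1 : P ∈ one.overlap a b d) (h2 : P ∈ infty.overlap a b d) :
    (one.label a b d P = infty.label a b d P ∧ zero.label a b d P = infty.label a b d P) ∨
    (omega d ^ a * one.label a b d P = infty.label a b d P ∧
      zero.label a b d P = omega d ^ b * infty.label a b d P) := by
  obtain ⟨x, hx, hP⟩ := h1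
  obtain ⟨x', hx', hP'⟩ := h2
  obtain rfl : x = x' := OnePoint.coe_injective (hP.symm.trans hP')
  have hb : ∀ r : Cusp, r.branch a b d x ≠ 0 := fun r => branch_ne_zero r x
  simp only [label, hP, finPart_coe]
  rcases lt_or_gt_of_ne (im_ne_zero_of_mem hx hx') with h | h
  · right
    have h3 := hb zero
    rw [branch_one_of_im_neg h, branch_infty_of_im_neg h]
    have h4 : omega d ≠ 0 := omega_ne_zero d
    constructor <;> field_simp
  · left
    rw [branch_of_im_pos one h, branch_of_im_pos zero h]
    exact ⟨rfl, rfl⟩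

theorem exists_mem_label (hd : 0 < d) {x : ℂ} (hx : x.im ≠ 0) :
    ∃ P : Place (FunctionRing a b d), (∀ r : Cusp, P ∈ r.overlap a b d) ∧
      P.val (xK a b d) = (x : OnePoint ℂ) ∧ infty.label a b d P = 1 := by
  have hm : ∀ r : Cusp, x ∈ r.region := fun r => r.mem_region_of_im_ne_zero hx
  refine ⟨(infty.sheet hd 1 (one_pow d)).place hd ⟨x, hm _⟩, fun r => ⟨x, hm r, ?_⟩, ?_, ?_⟩
  · exact sheet_val_xK hd infty 1 (one_pow d) ⟨x, hm _⟩
  · exact sheet_val_xK hd infty 1 (one_pow d) ⟨x, hm _⟩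
  · exact label_sheet hd infty 1 (one_pow d) ⟨x, hm _⟩

theorem exists_mem_label_upper (hd : 0 < d) :
    ∃ P : Place (FunctionRing a b d), (∀ r : Cusp, P ∈ r.overlap a b d) ∧
      ∀ r : Cusp, r.label a b d P = 1 := by
  obtain ⟨P, hP, hx, h1⟩ := exists_mem_label (a := a) (b := b) hd (x := I) (by simp)
  refine ⟨P, hP, fun r => ?_⟩
  rw [← h1]
  simp only [label, hx, finPart_coe]
  rw [branch_of_im_pos r (by simp)]

theorem exists_mem_label_lower (hd : 0 < d) :
    ∃ P : Place (FunctionRing a b d), (∀ r : Cusp, P ∈ r.overlap a b d) ∧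
      infty.label a b d P = 1 ∧ omega d ^ a * one.label a b d P = 1 ∧
        zero.label a b d P = omega d ^ b := by
  obtain ⟨P, hP, hx, h1⟩ := exists_mem_label (a := a) (b := b) hd (x := -I) (by simp)
  have h3 : zero.branch a b d (-I) ≠ 0 := branch_ne_zero _ _
  have h4 : omega d ≠ 0 := omega_ne_zero d
  have hi : (-I).im < 0 := by simp
  have h5 : one.label a b d P * omega d ^ a = infty.label a b d P ∧
      zero.label a b d P = omega d ^ b * infty.label a b d P := by
    simp only [label, hx, finPart_coe]
    rw [branch_one_of_im_neg hi, branch_infty_of_im_neg hi]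
    constructor <;> field_simp
  exact ⟨P, hP, h1, by rw [mul_comm, h5.1, h1], by rw [h5.2, h1, mul_one]⟩

end Cusp

/-- The class `θ` has a representative with primitives on the three stars that differ on the
overlaps by the given multiples of the `j`-th powers of the labels. -/
def HasData (j : ℕ) (θ : DualH1 (Place (FunctionRing a b d))) (α β : ℂ) : Prop :=
  ∃ (φ : C(stdSimplex ℝ (Fin 2), Place (FunctionRing a b d)) → ℂ)
    (f : Cusp → Place (FunctionRing a b d) → ℂ), IsCocycle φ ∧ Represents φ θ ∧
    (∀ i : Cusp, IsPrimitiveOn (i.nbhd a b d) φ (f i)) ∧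
    (∀ P ∈ Cusp.infty.overlap a b d,
      f .zero P - f .one P = α * Cusp.infty.label a b d P ^ j) ∧
    (∀ P ∈ Cusp.zero.overlap a b d,
      f .one P - f .infty P = β * Cusp.zero.label a b d P ^ j) ∧
    ∀ P ∈ Cusp.one.overlap a b d,
      f .zero P - f .infty P = (α + β) * Cusp.one.label a b d P ^ j

namespace HasData

variable {j : ℕ} {θ θ' : DualH1 (Place (FunctionRing a b d))} {α β α' β' : ℂ}

theorem add (h : HasData j θ α β) (h' : HasData j θ' α' β') :
    HasData j (θ + θ') (α + α') (β + β') := by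
  obtain ⟨φ, f, h1, h2, h3, h4, h5, h6⟩ := h
  obtain ⟨φ', f', h1', h2', h3', h4', h5', h6'⟩ := h'
  refine ⟨φ + φ', fun i => f i + f' i, h1.add h1', h2.add h2', fun i => (h3 i).add (h3' i),
    fun P hP => ?_, fun P hP => ?_, fun P hP => ?_⟩ <;> simp only [Pi.add_apply]
  · linear_combination h4 P hP + h4' P hP
  · linear_combination h5 P hP + h5' P hP
  · linear_combination h6 P hP + h6' P hP

theorem smul (h : HasData j θ α β) (c : ℂ) : HasData j (c • θ) (c * α) (c * β) := by
  obtain ⟨φ, f, h1, h2, h3, h4, h5, h6⟩ := h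
  refine ⟨c • φ, fun i => c • f i, h1.smul c, h2.smul c, fun i => (h3 i).smul c,
    fun P hP => ?_, fun P hP => ?_, fun P hP => ?_⟩ <;> simp only [Pi.smul_apply, smul_eq_mul]
  · linear_combination c * h4 P hP
  · linear_combination c * h5 P hP
  · linear_combination c * h6 P hP

theorem comp (hd : 0 < d) (h : HasData j θ α β) :
    HasData j (pullDual (deckMap a b d) θ) (omega d ^ j * α) (omega d ^ j * β) := by
  obtain ⟨φ, f, h1, h2, h3, h4, h5, h6⟩ := h
  have hl : ∀ (r : Cusp), ∀ P ∈ r.overlap a b d, r.label a b d (deckMap a b d P) ^ j =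
      omega d ^ j * r.label a b d P ^ j := fun r P hP => by
    rw [← mul_pow, ← r.label_map_deck hd hP]; rfl
  refine ⟨_, fun i => pullFun (deckMap a b d) (f i), h1.pull (deckMap a b d), h2.pull _,
    fun i => (h3 i).pull fun P hP => Cusp.map_deck_mem_nbhd hP,
    fun P hP => ?_, fun P hP => ?_, fun P hP => ?_⟩
  · refine (h4 (deckMap a b d P) (Cusp.map_deck_mem_overlap hP)).trans ?_
    rw [hl _ _ hP]; ring
  · refine (h5 (deckMap a b d P) (Cusp.map_deck_mem_overlap hP)).trans ?_
    rw [hl _ _ hP]; ring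
  · refine (h6 (deckMap a b d P) (Cusp.map_deck_mem_overlap hP)).trans ?_
    rw [hl _ _ hP]; ring

/-- A class with trivial gluing data is zero: the primitives glue. -/
theorem eq_zero (h : HasData j θ 0 0) : θ = 0 := by
  classical
  obtain ⟨φ, f, h1, h2, h3, h4, h5, h6⟩ := h
  let idx : Place (FunctionRing a b d) → Cusp := fun P => (Cusp.exists_mem_nbhd P).choose
  have hidx : ∀ P, P ∈ (idx P).nbhd a b d := fun P => (Cusp.exists_mem_nbhd P).choose_spec
  have hglue : ∀ (i i' : Cusp) (P : Place (FunctionRing a b d)), P ∈ i.nbhd a b d →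
      P ∈ i'.nbhd a b d → f i P = f i' P := by
    have h01 : ∀ P ∈ Cusp.zero.nbhd a b d, P ∈ Cusp.one.nbhd a b d → f .zero P = f .one P :=
      fun P h h' => by
        have := h4 P (Cusp.overlap_infty ▸ ⟨h, h'⟩)
        linear_combination this
    have h1i : ∀ P ∈ Cusp.one.nbhd a b d, P ∈ Cusp.infty.nbhd a b d → f .one P = f .infty P :=
      fun P h h' => by
        have := h5 P (Cusp.overlap_zero ▸ ⟨h, h'⟩)
        linear_combination this
    have h0i : ∀ P ∈ Cusp.zero.nbhd a b d, P ∈ Cusp.infty.nbhd a b d → f .zero P = f .infty P :=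
      fun P h h' => by
        have := h6 P (Cusp.overlap_one ▸ ⟨h, h'⟩)
        linear_combination this
    intro i i' P hP hP'
    cases i <;> cases i' <;> first | rfl | skip
    · exact h01 P hP hP'
    · exact h0i P hP hP'
    · exact (h01 P hP' hP).symm
    · exact h1i P hP hP'
    · exact (h0i P hP' hP).symm
    · exact (h1i P hP' hP).symm
  refine h2.eq_zero (f := fun P => f (idx P) P) ?_
  refine h1.isCoboundary_of_cover (fun i : Cusp => i.nbhd a b d) (fun i => i.isOpen_nbhd)
    Cusp.exists_mem_nbhd _ fun i γ hγ => ?_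
  rw [h3 i γ hγ, hglue _ i _ (hidx _) (hγ _), hglue _ i _ (hidx _) (hγ _)]

/-- The three gluing constants are related by the monodromy around the branch points. -/
theorem relation (hd : 0 < d) (h : HasData j θ α β) :
    ((omega d ^ j) ^ a - 1) * α + ((omega d ^ j) ^ (a + b) - 1) * β = 0 := by
  obtain ⟨φ, f, h1, h2, h3, h4, h5, h6⟩ := h
  obtain ⟨P, hP, hl1, hl2, hl3⟩ := Cusp.exists_mem_label_lower (a := a) (b := b) hd
  have e1 := h4 P (hP _)
  have e2 := h5 P (hP _)
  have e3 := h6 P (hP _)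
  rw [hl1, one_pow] at e1
  rw [hl3] at e2
  have e4 : (omega d ^ j) ^ a * Cusp.one.label a b d P ^ j = 1 := by
    rw [← pow_mul, mul_comm j, pow_mul, ← mul_pow, hl2, one_pow]
  have e5 : (omega d ^ j) ^ b = (omega d ^ b) ^ j := by rw [← pow_mul, ← pow_mul, mul_comm]
  rw [pow_add, e5]
  linear_combination (-(omega d ^ j) ^ a) * (e1 + e2 - e3) + (α + β) * e4

end HasData

/-- Primitives on the stars that are eigenfunctions of the deck transformation give gluing data,
which can be read off at a point over the upper half plane. -/
theorem hasData_of_isPrimitiveOn (hd : 0 < d) (j : ℕ) {θ : DualH1 (Place (FunctionRing a b d))}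
    {φ : C(stdSimplex ℝ (Fin 2), Place (FunctionRing a b d)) → ℂ} (hφ : IsCocycle φ)
    (hφθ : Represents φ θ) {F : Cusp → Place (FunctionRing a b d) → ℂ}
    (hF : ∀ i : Cusp, IsPrimitiveOn (i.nbhd a b d) φ (F i))
    (he : ∀ (i : Cusp), ∀ P ∈ i.nbhd a b d, F i (deckMap a b d P) = omega d ^ j * F i P)
    {P : Place (FunctionRing a b d)} (hP : ∀ r : Cusp, P ∈ r.overlap a b d)
    (hl : ∀ r : Cusp, r.label a b d P = 1) :
    HasData j θ (F .zero P - F .one P) (F .one P - F .infty P) := by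
  have key : ∀ r i i' : Cusp, r.overlap a b d = i.nbhd a b d ∩ i'.nbhd a b d →
      ∀ Q ∈ r.overlap a b d, F i Q - F i' Q = (F i P - F i' P) * r.label a b d Q ^ j := by
    intro r i i' h
    have hi : r.overlap a b d ⊆ i.nbhd a b d := h ▸ Set.inter_subset_left
    have hi' : r.overlap a b d ⊆ i'.nbhd a b d := h ▸ Set.inter_subset_right
    obtain ⟨C, hC⟩ := r.exists_sub_eq_mul_label_pow hd j ((hF i).mono hi) ((hF i').mono hi')
      (fun Q hQ => he i Q (hi hQ)) (fun Q hQ => he i' Q (hi' hQ))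
    have := hC P (hP r)
    rw [hl, one_pow, mul_one] at this
    rwa [this]
  refine ⟨φ, F, hφ, hφθ, hF, key _ _ _ Cusp.overlap_infty, key _ _ _ Cusp.overlap_zero, ?_⟩
  rw [sub_add_sub_cancel]
  exact key _ _ _ Cusp.overlap_one

/-- Every eigenclass has gluing data. -/
theorem exists_hasData (hd : 0 < d) (j : ℕ) {θ : DualH1 (Place (FunctionRing a b d))}
    (hθ : pullDual (deckMap a b d) θ = omega d ^ j • θ) : ∃ α β : ℂ, HasData j θ α β := by
  set σ := deckMap a b d with hσ
  set μ := omega d ^ j with hμ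
  have hμd : μ ^ d = 1 := omega_pow_pow j
  obtain ⟨φ, hφ, hφθ⟩ := exists_isCocycle_represents θ
  choose f hf using fun i : Cusp => i.exists_primitive hd hφ
  -- averaging makes the cocycle and its primitives eigenvectors
  have h1 : IsCocycle (eigenProj (pullCochain σ) d μ φ) :=
    eigenProj_induction (fun φ (_ : DualH1 (Place (FunctionRing a b d))) => IsCocycle φ)
      (fun _ _ _ _ h h' => h.add h') (fun c _ _ h => h.smul c) (fun _ => by simp)
      (T := pullDual σ) (fun _ _ h => h.pull σ) d μ (w := θ) hφ
  have h2 : Represents (eigenProj (pullCochain σ) d μ φ) θ := by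
    have := eigenProj_induction (fun φ (η : DualH1 (Place (FunctionRing a b d))) => Represents φ η)
      (fun _ _ _ _ h h' => h.add h') (fun c _ _ h => h.smul c)
      (by simpa using hφθ.smul 0) (fun _ _ h => h.pull σ) d μ hφθ
    rwa [eigenProj_eq_self hd hμd hθ] at this
  have h3 : ∀ i : Cusp, IsPrimitiveOn (i.nbhd a b d) (eigenProj (pullCochain σ) d μ φ)
      (eigenProj (pullFun σ) d μ (f i)) := fun i =>
    eigenProj_induction (fun φ f => IsPrimitiveOn (i.nbhd a b d) φ f)
      (fun _ _ _ _ h h' => h.add h') (fun c _ _ h => h.smul c) (fun _ _ => by simp)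
      (fun _ _ h => h.pull fun P hP => Cusp.map_deck_mem_nbhd hP) d μ (hf i)
  have he : ∀ (i : Cusp) (P : Place (FunctionRing a b d)),
      eigenProj (pullFun σ) d μ (f i) (σ P) = μ * eigenProj (pullFun σ) d μ (f i) P := fun i P =>
    congrFun (apply_eigenProj (pullFun_pow σ deckMap_iterate_self) hμd hd (f i)) P
  obtain ⟨P, hP, hl⟩ := Cusp.exists_mem_label_upper (a := a) (b := b) hd
  exact ⟨_, _, hasData_of_isPrimitiveOn hd j h1 h2 h3 (fun i P _ => he i P) hP hl⟩

end GluingData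

/-! ### The eigenspaces on the dual of `H₁` -/

section Eigenspaces

open Filter Topology Complex

variable {a b d : ℕ}

namespace Cusp

theorem g_zero : zero.g a b d = Nat.gcd a d := Int.gcd_natCast_natCast _ _

theorem g_one : one.g a b d = Nat.gcd b d := Int.gcd_natCast_natCast _ _

theorem g_infty : infty.g a b d = Nat.gcd (a + b) d := by
  rw [g, A, Int.neg_gcd, ← Nat.cast_add]
  exact Int.gcd_natCast_natCast _ _

theorem pow_gcd_eq_one_iff {μ : ℂ} (hμ : μ ^ d = 1) (n : ℕ) : μ ^ Nat.gcd n d = 1 ↔ μ ^ n = 1 := by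
  refine ⟨fun h => ?_, fun h => pow_gcd_eq_one.2 ⟨h, hμ⟩⟩
  obtain ⟨m, hm⟩ := Nat.gcd_dvd_left n d
  rw [hm, pow_mul, h, one_pow]

theorem e_dvd_iff (hd : 0 < d) (i : Cusp) (j : ℕ) :
    i.e a b d ∣ j ↔ (omega d ^ j) ^ i.g a b d = 1 := by
  rw [← pow_mul, (omega_isPrimitiveRoot hd).pow_eq_one_iff_dvd]
  have h := Nat.mul_dvd_mul_iff_right (i.g_pos (a := a) (b := b) hd) (a := i.e a b d) (b := j)
  rw [i.e_mul_g] at h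
  exact h.symm

/-- A locally constant function on a star which is an eigenfunction of the deck transformation and
vanishes nowhere: the power `ξ ^ j` of the leading coefficient of `y`. -/
theorem exists_locallyConstant_eigenfunction (hd : 0 < d) (i : Cusp) {j : ℕ}
    (hj : i.e a b d ∣ j) : ∃ p : Place (FunctionRing a b d) → ℂ, IsPrimitiveOn (i.nbhd a b d) 0 p ∧
      (∀ P ∈ i.nbhd a b d, p (deckMap a b d P) = omega d ^ j * p P) ∧
      ∀ P ∈ i.nbhd a b d, p P ≠ 0 := by
  classical
  obtain ⟨n, rfl⟩ := hj
  let p : Place (FunctionRing a b d) → ℂ := fun P =>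
    if hP : P ∈ i.nbhd a b d then (i.exists_star_place_eq hd hP).choose ^ (i.e a b d * n) else 0
  have hp : ∀ (ξ : ℂ) (hξ : ξ ^ d = i.κ b) (t : (i.star (a := a) hd ξ hξ).dom),
      p ((i.star hd ξ hξ).place hd t) = ξ ^ (i.e a b d * n) := by
    intro ξ hξ t
    have hP := i.star_place_mem_nbhd hd ξ hξ t
    simp only [p, dif_pos hP]
    obtain ⟨hξ', t', h⟩ := (i.exists_star_place_eq hd hP).choose_spec
    rw [pow_mul, pow_mul, ((i.star_place_eq_iff hd _ _ _ _).1 h).1]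
  refine ⟨p, fun γ hγ => ?_, fun P hP => ?_, fun P hP => ?_⟩
  · obtain ⟨ξ, hξ, δ, hδ⟩ := i.exists_lift hd γ hγ
    rw [hδ, hδ, hp, hp, sub_self]
    rfl
  · obtain ⟨ξ, hξ, t, rfl⟩ := i.exists_star_place_eq hd hP
    have hξ' : (omega d * ξ) ^ d = i.κ b := by rw [mul_pow, omega_pow, one_mul, hξ]
    have h1 : deckMap a b d ((i.star hd ξ hξ).place hd t) = (i.star hd _ hξ').place hd ⟨t, t.2⟩ :=
      star_map_deck hd i ξ hξ _ hξ' rfl t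
    rw [h1, hp, hp, mul_pow]
  · obtain ⟨ξ, hξ, t, rfl⟩ := i.exists_star_place_eq hd hP
    rw [hp]
    exact pow_ne_zero _ (i.ne_zero_of_pow_eq_κ hd hξ)

/-- A locally constant eigenfunction on a star vanishes if its eigenvalue is not an eigenvalue of
the permutation of the components: the centre of the star is fixed by the `g`-th power of the deck
transformation. -/
theorem eq_zero_of_locallyConstant_eigenfunction (hd : 0 < d) (i : Cusp) {μ : ℂ}
    (hμ : μ ^ i.g a b d ≠ 1) {p : Place (FunctionRing a b d) → ℂ}
    (hp : IsPrimitiveOn (i.nbhd a b d) 0 p) (he : ∀ P, p (deckMap a b d P) = μ * p P)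
    {P : Place (FunctionRing a b d)} (hP : P ∈ i.nbhd a b d) : p P = 0 := by
  obtain ⟨ξ, hξ, t, rfl⟩ := i.exists_star_place_eq hd hP
  have h0 : (0 : ℂ) ∈ (i.star (a := a) hd ξ hξ).dom := by
    change 1 - (0 : ℂ) ^ i.e a b d ∈ slitPlane
    rw [zero_pow (i.e_pos hd).ne', sub_zero]
    exact one_mem_slitPlane
  set O := (i.star hd ξ hξ).place hd ⟨0, h0⟩ with hO
  have h1 := hp (i.ray hd ξ hξ t) fun u => i.star_place_mem_nbhd hd ξ hξ _
  have h2 : i.ray hd ξ hξ t (stdSimplex.vertex 0) = O := by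
    simp only [ray, ContinuousMap.coe_mk, hO]
    congr 1
    exact Subtype.ext (by simp)
  have h3 : i.ray hd ξ hξ t (stdSimplex.vertex 1) = (i.star hd ξ hξ).place hd t := by
    simp only [ray, ContinuousMap.coe_mk]
    congr 1
    exact Subtype.ext (by simp)
  rw [h2, h3] at h1
  have h4 : ∀ k : ℕ, p ((deckMap a b d)^[k] O) = μ ^ k * p O := by
    intro k
    induction k with
    | zero => simp
    | succ k ih => rw [Function.iterate_succ_apply', he, ih, pow_succ]; ring
  have hξ' : (omega d ^ i.g a b d * ξ) ^ d = i.κ b := by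
    rw [mul_pow, omega_pow_pow, one_mul, hξ]
  have h5 : (deckMap a b d)^[i.g a b d] O = O := by
    rw [deckMap_iterate, hO, i.star_map_deck_pow hd ξ hξ _ _ _ hξ' rfl, star_place_eq_iff]
    refine ⟨?_, by simp⟩
    rw [mul_pow, ← pow_mul, mul_comm (i.g a b d), i.e_mul_g, omega_pow, one_mul]
  have h6 := h4 (i.g a b d)
  rw [h5] at h6
  have h7 : p O = 0 := by
    have : (μ ^ i.g a b d - 1) * p O = 0 := by linear_combination -h6
    exact (mul_eq_zero.1 this).resolve_left (sub_ne_zero.2 hμ)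
  simp only [Pi.zero_apply] at h1
  linear_combination -h1 + h7

end Cusp

theorem represents_zero {X : Type} [TopologicalSpace X] :
    Represents (0 : C(stdSimplex ℝ (Fin 2), X) → ℂ) (0 : DualH1 X) := by
  obtain ⟨θ, hθ⟩ := IsCocycle.exists_represents (φ := (0 : C(stdSimplex ℝ (Fin 2), X) → ℂ))
    fun _ => by simp
  rwa [hθ.eq_zero (f := 0) fun _ => by simp] at hθ

/-- Changing the primitives on the stars by locally constant functions changes the gluing data but
not the class. -/
theorem exists_hasData_zero (hd : 0 < d) (j : ℕ) (i : Cusp)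
    (hi : (omega d ^ j) ^ i.g a b d = 1) : ∃ p : Cusp → ℂ, p i ≠ 0 ∧ (∀ i', i' ≠ i → p i' = 0) ∧
      HasData j (0 : DualH1 (Place (FunctionRing a b d))) (p .zero - p .one) (p .one - p .infty) := by
  classical
  obtain ⟨q, hq, hqe, hq0⟩ := i.exists_locallyConstant_eigenfunction hd ((i.e_dvd_iff hd j).2 hi)
  obtain ⟨P, hP, hl⟩ := Cusp.exists_mem_label_upper (a := a) (b := b) hd
  have hPi : P ∈ i.nbhd a b d := by
    have h0 := hP .zero
    have h1 := hP .one
    rw [Cusp.overlap_zero] at h0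
    rw [Cusp.overlap_one] at h1
    cases i
    exacts [h1.1, h0.1, h0.2]
  have hF : ∀ i' : Cusp, IsPrimitiveOn (i'.nbhd a b d) 0 (if i' = i then q else 0) := by
    intro i'
    split_ifs with h
    · rwa [h]
    · intro γ _; simp
  have he : ∀ (i' : Cusp), ∀ P ∈ i'.nbhd a b d, (if i' = i then q else 0) (deckMap a b d P) =
      omega d ^ j * (if i' = i then q else 0) P := by
    intro i' P hP'
    split_ifs with h
    · exact hqe P (h ▸ hP')
    · simp
  refine ⟨fun i' => (if i' = i then q else 0) P, ?_, fun i' h => ?_, ?_⟩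
  · simpa using hq0 P hPi
  · simp [h]
  · exact hasData_of_isPrimitiveOn hd j (fun _ => by simp) represents_zero hF he hP hl

/-- Gluing data that satisfy the monodromy relation are realized by a class. -/
theorem exists_hasData_of_relation (hd : 0 < d) (j : ℕ) {α β : ℂ}
    (h : ((omega d ^ j) ^ a - 1) * α + ((omega d ^ j) ^ (a + b) - 1) * β = 0) :
    ∃ θ : DualH1 (Place (FunctionRing a b d)), HasData j θ α β := by
  let l : Cusp → Place (FunctionRing a b d) → ℂ := fun r P => r.label a b d P ^ j
  let c : Cusp → Cusp → Place (FunctionRing a b d) → ℂ := fun i i' P =>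
    match i, i' with
    | .zero, .zero => 0
    | .one, .one => 0
    | .infty, .infty => 0
    | .zero, .one => α * l .infty P
    | .one, .zero => -(α * l .infty P)
    | .one, .infty => β * l .zero P
    | .infty, .one => -(β * l .zero P)
    | .zero, .infty => (α + β) * l .one P
    | .infty, .zero => -((α + β) * l .one P)
  have key : ∀ P : Place (FunctionRing a b d), P ∈ Cusp.zero.nbhd a b d → P ∈ Cusp.one.nbhd a b d →
      P ∈ Cusp.infty.nbhd a b d → α * l .infty P + β * l .zero P = (α + β) * l .one P := by
    intro P h0 h1 hi
    have m1 : P ∈ Cusp.one.overlap a b d := Cusp.overlap_one ▸ ⟨h0, hi⟩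
    have mi : P ∈ Cusp.infty.overlap a b d := Cusp.overlap_infty ▸ ⟨h0, h1⟩
    simp only [l]
    rcases Cusp.label_of_mem m1 mi with ⟨e1, e2⟩ | ⟨e1, e2⟩
    · rw [e1, e2]; ring
    · have h2 : ∀ n : ℕ, (omega d ^ n) ^ j = (omega d ^ j) ^ n := fun n => by
        rw [← pow_mul, ← pow_mul, mul_comm]
      have ha : (omega d ^ j) ^ a ≠ 0 := pow_ne_zero _ (pow_ne_zero _ (omega_ne_zero d))
      rw [e2, ← e1, mul_pow, mul_pow, mul_pow, h2, h2]
      rw [pow_add] at h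
      linear_combination (Cusp.one.label a b d P ^ j) * h
  have hl : ∀ (r : Cusp) (C : ℂ) (P : Place (FunctionRing a b d)), P ∈ r.overlap a b d →
      ∀ᶠ Q in 𝓝 P, C * l r Q = C * l r P := fun r C P hP => by
    filter_upwards [r.eventually_label_eq hd hP] with Q hQ
    simp only [l, hQ]
  have m0 : ∀ P : Place (FunctionRing a b d), P ∈ Cusp.one.nbhd a b d → P ∈ Cusp.infty.nbhd a b d →
      P ∈ Cusp.zero.overlap a b d := fun P h h' => Cusp.overlap_zero ▸ ⟨h, h'⟩
  have m1 : ∀ P : Place (FunctionRing a b d), P ∈ Cusp.zero.nbhd a b d → P ∈ Cusp.infty.nbhd a b d →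
      P ∈ Cusp.one.overlap a b d := fun P h h' => Cusp.overlap_one ▸ ⟨h, h'⟩
  have mi : ∀ P : Place (FunctionRing a b d), P ∈ Cusp.zero.nbhd a b d → P ∈ Cusp.one.nbhd a b d →
      P ∈ Cusp.infty.overlap a b d := fun P h h' => Cusp.overlap_infty ▸ ⟨h, h'⟩
  obtain ⟨φ, hφ, f, hf, hfc⟩ := exists_isCocycle_of_cech (fun i : Cusp => i.nbhd a b d)
    (fun i => i.isOpen_nbhd) (fun P => (Cusp.exists_mem_nbhd P).choose)
    (fun P => (Cusp.exists_mem_nbhd P).choose_spec) c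
    (by
      rintro i i' P ⟨hi, hi'⟩
      cases i <;> cases i' <;> simp only [c, neg_inj]
      · exact Eventually.of_forall fun _ => trivial
      · exact hl _ _ P (mi P hi hi')
      · exact hl _ _ P (m1 P hi hi')
      · exact hl _ _ P (mi P hi' hi)
      · exact Eventually.of_forall fun _ => trivial
      · exact hl _ _ P (m0 P hi hi')
      · exact hl _ _ P (m1 P hi' hi)
      · exact hl _ _ P (m0 P hi' hi)
      · exact Eventually.of_forall fun _ => trivial)
    (by
      rintro i i' i'' P ⟨⟨hi, hi'⟩, hi''⟩
      cases i <;> cases i' <;> cases i'' <;> simp only [c] <;> first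
        | ring1
        | linear_combination key P (by assumption) (by assumption) (by assumption)
        | linear_combination -key P (by assumption) (by assumption) (by assumption))
  obtain ⟨θ, hθ⟩ := hφ.exists_represents
  refine ⟨θ, φ, f, hφ, hθ, hf, fun P hP => ?_, fun P hP => ?_, fun P hP => ?_⟩
  · exact hfc .zero .one P (Cusp.overlap_infty ▸ hP)
  · exact hfc .one .infty P (Cusp.overlap_zero ▸ hP)
  · exact hfc .zero .infty P (Cusp.overlap_one ▸ hP)

/-- If no star carries a locally constant eigenfunction, the zero class has no non-trivial gluing
data. -/
theorem HasData.eq_zero_of_zero (hd : 0 < d) {j : ℕ} {α β : ℂ}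
    (h : HasData j (0 : DualH1 (Place (FunctionRing a b d))) α β)
    (hg : ∀ i : Cusp, (omega d ^ j) ^ i.g a b d ≠ 1) : α = 0 ∧ β = 0 := by
  set σ := deckMap a b d with hσ
  set μ := omega d ^ j with hμ
  have hμd : μ ^ d = 1 := omega_pow_pow j
  obtain ⟨φ, f, h1, h2, h3, h4, h5, h6⟩ := h
  obtain ⟨G, hG⟩ := h2.exists_isCoboundary
  have hp : ∀ i : Cusp, IsPrimitiveOn (i.nbhd a b d) 0 (f i - G) := fun i γ hγ => by
    have e1 := h3 i γ hγ
    have e2 := hG γ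
    simp only [Pi.sub_apply, Pi.zero_apply]
    linear_combination e1 - e2
  have hp' : ∀ i : Cusp, IsPrimitiveOn (i.nbhd a b d) 0 (eigenProj (pullFun σ) d μ (f i - G)) := by
    intro i
    have := eigenProj_induction (fun φ f => IsPrimitiveOn (i.nbhd a b d) φ f)
      (fun _ _ _ _ h h' => h.add h') (fun c _ _ h => h.smul c) (fun _ _ => by simp)
      (fun _ _ h => h.pull fun P hP => Cusp.map_deck_mem_nbhd hP) d μ (hp i)
      (S := pullCochain σ) (T := pullFun σ)
    rwa [map_zero] at this
  have h0 : ∀ (i : Cusp), ∀ P ∈ i.nbhd a b d, eigenProj (pullFun σ) d μ (f i - G) P = 0 :=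
    fun i P hP => i.eq_zero_of_locallyConstant_eigenfunction hd (hg i) (hp' i) (fun P =>
      congrFun (apply_eigenProj (pullFun_pow σ deckMap_iterate_self) hμd hd (f i - G)) P) hP
  obtain ⟨P, hP, hl⟩ := Cusp.exists_mem_label_upper (a := a) (b := b) hd
  have key : ∀ (r i i' : Cusp) (C : ℂ), r.overlap a b d = i.nbhd a b d ∩ i'.nbhd a b d →
      (∀ P ∈ r.overlap a b d, f i P - f i' P = C * r.label a b d P ^ j) → C = 0 := by
    intro r i i' C h hC
    have e1 := eigenProj_pullFun_eq σ hd hμd (f := (f i - G) - (f i' - G))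
      (g := fun P => C * r.label a b d P ^ j) (U := r.overlap a b d)
      (fun P hP => Cusp.map_deck_mem_overlap hP) (fun P hP => by
        rw [← hC P hP]; simp only [Pi.sub_apply]; ring) (fun P hP => by
        have := r.label_map_deck hd hP
        change C * r.label a b d (P.map (deck a b d)) ^ j = _
        rw [this, mul_pow]; ring) (hP r)
    have hPr := hP r
    rw [h] at hPr
    rw [map_sub, Pi.sub_apply, h0 i P hPr.1, h0 i' P hPr.2, hl, one_pow, mul_one, sub_zero] at e1
    exact e1.symm
  exact ⟨key _ _ _ _ Cusp.overlap_infty h4, key _ _ _ _ Cusp.overlap_zero h5⟩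

end Eigenspaces

/-! ### The characteristic polynomial on `H₁` -/

section FirstHomology

open Polynomial

variable {a b d : ℕ}

theorem HasData.pullDual_eq (hd : 0 < d) {j : ℕ} {θ : DualH1 (Place (FunctionRing a b d))} {α β : ℂ}
    (h : HasData j θ α β) : pullDual (deckMap a b d) θ = omega d ^ j • θ := by
  have h1 := (h.comp hd).add (h.smul (-(omega d ^ j)))
  rw [neg_mul, neg_mul, add_neg_cancel, add_neg_cancel] at h1
  have h2 := h1.eq_zero
  rwa [neg_smul, ← sub_eq_add_neg, sub_eq_zero] at h2

/-- For a generic eigenvalue the gluing data form a line. -/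
theorem finrank_eigenspace_pullDual_eq_one (hd : 0 < d) (j : ℕ)
    (hg : ∀ i : Cusp, (omega d ^ j) ^ i.g a b d ≠ 1) :
    Module.finrank ℂ (Module.End.eigenspace (pullDual (deckMap a b d)) (omega d ^ j)) = 1 := by
  have hu : (omega d ^ j) ^ a - 1 ≠ 0 := by
    have := hg .zero
    rw [Cusp.g_zero, ne_eq, Cusp.pow_gcd_eq_one_iff (omega_pow_pow j)] at this
    exact sub_ne_zero.2 this
  obtain ⟨θ, hθ⟩ := exists_hasData_of_relation (a := a) (b := b) hd j
    (α := (omega d ^ j) ^ (a + b) - 1) (β := -((omega d ^ j) ^ a - 1)) (by ring)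
  rw [finrank_eq_one_iff']
  refine ⟨⟨θ, Module.End.mem_eigenspace_iff.2 (hθ.pullDual_eq hd)⟩, ?_, ?_⟩
  · intro h0
    have h1 : θ = 0 := congrArg Subtype.val h0
    subst h1
    exact hu (neg_eq_zero.1 (hθ.eq_zero_of_zero hd hg).2)
  · rintro ⟨η, hη⟩
    obtain ⟨α, β, h⟩ := exists_hasData hd j (Module.End.mem_eigenspace_iff.1 hη)
    have hr := h.relation hd
    refine ⟨-(β / ((omega d ^ j) ^ a - 1)), Subtype.ext ?_⟩
    have h1 := (hθ.smul (-(β / ((omega d ^ j) ^ a - 1)))).add (h.smul (-1))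
    have e1 : -(β / ((omega d ^ j) ^ a - 1)) * ((omega d ^ j) ^ (a + b) - 1) + -1 * α = 0 := by
      field_simp
      linear_combination -hr
    have e2 : -(β / ((omega d ^ j) ^ a - 1)) * -((omega d ^ j) ^ a - 1) + -1 * β = 0 := by
      field_simp
      ring
    rw [e1, e2] at h1
    have h2 := h1.eq_zero
    rw [neg_one_smul, ← sub_eq_add_neg, sub_eq_zero] at h2
    exact h2

/-- For the other eigenvalues, locally constant eigenfunctions on the stars absorb the gluing
data. -/
theorem eigenspace_pullDual_eq_bot (hd : 0 < d) (j : ℕ) (i : Cusp) (hg : (omega d ^ j) ^ i.g a b d = 1) :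
    Module.End.eigenspace (pullDual (deckMap a b d)) (omega d ^ j) = ⊥ := by
  have hμd := omega_pow_pow (d := d) j
  have hz : (omega d ^ j) ^ a = 1 →
      HasData j (0 : DualH1 (Place (FunctionRing a b d))) 1 0 := fun h => by
    obtain ⟨p, hp, hp', h'⟩ := exists_hasData_zero (a := a) (b := b) hd j .zero
      (by rwa [Cusp.g_zero, Cusp.pow_gcd_eq_one_iff hμd])
    rw [hp' .one nofun, hp' .infty nofun] at h'
    simpa [hp] using h'.smul (p .zero)⁻¹
  have ho : (omega d ^ j) ^ b = 1 →
      HasData j (0 : DualH1 (Place (FunctionRing a b d))) (-1) 1 := fun h => by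
    obtain ⟨p, hp, hp', h'⟩ := exists_hasData_zero (a := a) (b := b) hd j .one
      (by rwa [Cusp.g_one, Cusp.pow_gcd_eq_one_iff hμd])
    rw [hp' .zero nofun, hp' .infty nofun] at h'
    simpa [hp] using h'.smul (p .one)⁻¹
  have hi : (omega d ^ j) ^ (a + b) = 1 →
      HasData j (0 : DualH1 (Place (FunctionRing a b d))) 0 1 := fun h => by
    obtain ⟨p, hp, hp', h'⟩ := exists_hasData_zero (a := a) (b := b) hd j .infty
      (by rwa [Cusp.g_infty, Cusp.pow_gcd_eq_one_iff hμd])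
    rw [hp' .zero nofun, hp' .one nofun] at h'
    simpa [hp] using h'.smul (-(p .infty)⁻¹)
  refine (Submodule.eq_bot_iff _).2 fun θ hθ => ?_
  obtain ⟨α, β, h⟩ := exists_hasData hd j (Module.End.mem_eigenspace_iff.1 hθ)
  have hr := h.relation hd
  -- it suffices to realize the gluing data of `θ` by the zero class
  suffices hs : HasData j (0 : DualH1 (Place (FunctionRing a b d))) α β by
    have h1 := h.add (hs.smul (-1))
    rw [smul_zero, add_zero, neg_one_mul, neg_one_mul, add_neg_cancel, add_neg_cancel] at h1
    exact h1.eq_zero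
  by_cases ha : (omega d ^ j) ^ a = 1
  · by_cases hab : (omega d ^ j) ^ (a + b) = 1
    · simpa using ((hz ha).smul α).add ((hi hab).smul β)
    · rw [ha, sub_self, zero_mul, zero_add, mul_eq_zero, sub_eq_zero, or_iff_right hab] at hr
      simpa [hr] using (hz ha).smul α
  · by_cases hab : (omega d ^ j) ^ (a + b) = 1
    · rw [hab, sub_self, zero_mul, add_zero, mul_eq_zero, sub_eq_zero, or_iff_right ha] at hr
      simpa [hr] using (hi hab).smul β
    · have hb : (omega d ^ j) ^ b = 1 := by
        cases i
        · rw [Cusp.g_zero, Cusp.pow_gcd_eq_one_iff hμd] at hg; exact absurd hg ha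
        · rwa [Cusp.g_one, Cusp.pow_gcd_eq_one_iff hμd] at hg
        · rw [Cusp.g_infty, Cusp.pow_gcd_eq_one_iff hμd] at hg; exact absurd hg hab
      rw [pow_add, hb, mul_one, ← mul_add, mul_eq_zero, sub_eq_zero, or_iff_right ha] at hr
      have hα : α = -β := eq_neg_of_add_eq_zero_left hr
      simpa [hα] using (ho hb).smul β

/-! #### Passing from `H₁` to its dual -/

theorem homologyMap_one {K : Type} [CommRing K] [Algebra ℂ K] :
    homologyMap (1 : K ≃ₐ[ℂ] K) = 1 := by
  have h1 : TopCat.ofHom ⟨Place.map (1 : K ≃ₐ[ℂ] K), Place.continuous_map _⟩ =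
      CategoryTheory.CategoryStruct.id (TopCat.of (Place K)) := rfl
  rw [homologyMap, h1, CategoryTheory.Functor.map_id]
  rfl

theorem homologyMap_mul {K : Type} [CommRing K] [Algebra ℂ K] (σ τ : K ≃ₐ[ℂ] K) :
    homologyMap (σ * τ) = homologyMap τ * homologyMap σ := by
  have h1 : TopCat.ofHom ⟨Place.map (σ * τ), Place.continuous_map _⟩ =
      CategoryTheory.CategoryStruct.comp
        (TopCat.ofHom ⟨Place.map σ, Place.continuous_map _⟩ : TopCat.of (Place K) ⟶ TopCat.of (Place K))
        (TopCat.ofHom ⟨Place.map τ, Place.continuous_map _⟩) := rfl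
  rw [homologyMap, h1, CategoryTheory.Functor.map_comp]
  rfl

theorem homologyMap_pow {K : Type} [CommRing K] [Algebra ℂ K] (σ : K ≃ₐ[ℂ] K) (n : ℕ) :
    homologyMap (σ ^ n) = homologyMap σ ^ n := by
  induction n with
  | zero => rw [pow_zero, pow_zero, homologyMap_one]
  | succ n ih => rw [pow_succ, homologyMap_mul, ih, pow_succ']

theorem homologyMap_deck_pow : homologyMap (deck a b d) ^ d = 1 := by
  rw [← homologyMap_pow, deck_pow_self, homologyMap_one]

theorem dualMap_pow {V : Type*} [AddCommGroup V] [Module ℂ V] (T : Module.End ℂ V) (n : ℕ) :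
    (LinearMap.dualMap T : Module.End ℂ (Module.Dual ℂ V)) ^ n = LinearMap.dualMap (T ^ n) := by
  induction n with
  | zero => rfl
  | succ n ih => rw [pow_succ, ih, pow_succ']; rfl

theorem charpoly_dualMap {V : Type*} [AddCommGroup V] [Module ℂ V] [Module.Finite ℂ V]
    (T : Module.End ℂ V) :
    LinearMap.charpoly (LinearMap.dualMap T : Module.End ℂ (Module.Dual ℂ V)) = T.charpoly := by
  let B := Module.finBasis ℂ V
  rw [← LinearMap.charpoly_toMatrix T B, ← LinearMap.charpoly_toMatrix _ B.dualBasis,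
    LinearMap.dualMap_def, LinearMap.toMatrix_transpose, Matrix.charpoly_transpose]

variable (a b d) in
/-- The transpose of the action of the deck transformation on `H₁`. -/
def dualDeck : Module.End ℂ (Module.Dual ℂ (H1 (FunctionRing a b d))) :=
  (homologyMap (deck a b d)).dualMap

theorem dualDeck_pow : dualDeck a b d ^ d = 1 := by
  rw [dualDeck, dualMap_pow, homologyMap_deck_pow]
  rfl

variable (a b d) in
/-- Morphisms from `H₁` to `ℂ` are linear forms. -/
def dualEquiv : DualH1 (Place (FunctionRing a b d)) ≃ₗ[ℂ] Module.Dual ℂ (H1 (FunctionRing a b d)) :=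
  ModuleCat.homLinearEquiv (S := ℂ) (M := (chains (Place (FunctionRing a b d))).homology 1)
    (N := ModuleCat.of ℂ ℂ)

theorem dualEquiv_pullDual (θ : DualH1 (Place (FunctionRing a b d))) :
    dualEquiv a b d (pullDual (deckMap a b d) θ) = dualDeck a b d (dualEquiv a b d θ) := rfl

theorem map_eigenspace_pullDual (μ : ℂ) :
    (Module.End.eigenspace (pullDual (deckMap a b d)) μ).map (dualEquiv a b d).toLinearMap =
      Module.End.eigenspace (dualDeck a b d) μ := by
  ext θ
  obtain ⟨η, rfl⟩ := (dualEquiv a b d).surjective θ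
  rw [Submodule.mem_map_equiv, LinearEquiv.symm_apply_apply,
    Module.End.mem_eigenspace_iff, Module.End.mem_eigenspace_iff, ← dualEquiv_pullDual, ← map_smul,
    (dualEquiv a b d).injective.eq_iff]

theorem finrank_eigenspace_dualDeck (hd : 0 < d) (j : ℕ) [Decidable (∀ i : Cusp, (omega d ^ j) ^ i.g a b d ≠ 1)] :
    Module.finrank ℂ ((dualDeck a b d).eigenspace (omega d ^ j)) =
      if ∀ i : Cusp, (omega d ^ j) ^ i.g a b d ≠ 1 then 1 else 0 := by
  rw [← map_eigenspace_pullDual]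
  refine (LinearEquiv.finrank_map_eq _ _).trans ?_
  split_ifs with h
  · exact finrank_eigenspace_pullDual_eq_one hd j h
  · push Not at h
    obtain ⟨i, hi⟩ := h
    rw [eigenspace_pullDual_eq_bot hd j i hi, finrank_bot]

theorem finite_H1 (hd : 0 < d) : Module.Finite ℂ (H1 (FunctionRing a b d)) := by
  classical
  rw [← Module.finite_dual_iff ℂ]
  refine finite_of_finite_eigenspace hd dualDeck_pow fun j => ?_
  by_cases h : ∀ i : Cusp, (omega d ^ j) ^ i.g a b d ≠ 1
  · refine Module.finite_of_finrank_pos ?_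
    rw [finrank_eigenspace_dualDeck hd, if_pos h]
    exact one_pos
  · push Not at h
    obtain ⟨i, hi⟩ := h
    rw [← map_eigenspace_pullDual, eigenspace_pullDual_eq_bot hd j i hi, Submodule.map_bot]
    infer_instance

end FirstHomology

/-! ### Comparison of the roots -/

section Roots

open Polynomial

variable {a b c d : ℕ}

theorem rootMultiplicity_X_pow_sub_one {n : ℕ} (hn : 0 < n) (μ : ℂ) :
    (X ^ n - 1 : ℂ[X]).rootMultiplicity μ = if μ ^ n = 1 then 1 else 0 := by
  have hn0 : (n : ℂ) ≠ 0 := Nat.cast_ne_zero.2 hn.ne'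
  have hp : (X ^ n - 1 : ℂ[X]) ≠ 0 := (X_pow_sub_C_ne_zero hn 1 : (X ^ n - C 1 : ℂ[X]) ≠ 0)
  have hr : (X ^ n - 1 : ℂ[X]).IsRoot μ ↔ μ ^ n = 1 := by simp [IsRoot, sub_eq_zero]
  split_ifs with h
  · refine le_antisymm (rootMultiplicity_le_one_of_separable ?_ μ)
      ((rootMultiplicity_pos hp).2 (hr.2 h))
    exact (separable_X_pow_sub_C (1 : ℂ) hn0 one_ne_zero)
  · exact rootMultiplicity_eq_zero fun h' => h (hr.1 h')

theorem rootMultiplicity_charpoly_homologyMap (hd : 0 < d) (j : ℕ)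
    [Module.Finite ℂ (H1 (FunctionRing a b d))]
    [Decidable (∀ i : Cusp, (omega d ^ j) ^ i.g a b d ≠ 1)] :
    (homologyMap (deck a b d)).charpoly.rootMultiplicity (omega d ^ j) =
      if ∀ i : Cusp, (omega d ^ j) ^ i.g a b d ≠ 1 then 1 else 0 := by
  rw [← charpoly_dualMap, ← finrank_eigenspace_dualDeck hd]
  exact rootMultiplicity_charpoly_of_pow_eq_one hd dualDeck_pow _

theorem rootMultiplicity_charpoly_homologyMap_of_pow_ne_one (hd : 0 < d)
    [Module.Finite ℂ (H1 (FunctionRing a b d))] {μ : ℂ} (hμ : μ ^ d ≠ 1) :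
    (homologyMap (deck a b d)).charpoly.rootMultiplicity μ = 0 := by
  rw [rootMultiplicity_charpoly_of_pow_eq_one hd homologyMap_deck_pow]
  have : (homologyMap (deck a b d)).eigenspace μ = ⊥ := by
    refine (Submodule.eq_bot_iff _).2 fun v hv => ?_
    rw [Module.End.mem_eigenspace_iff] at hv
    have hk : ∀ k : ℕ, (homologyMap (deck a b d) ^ k) v = μ ^ k • v := by
      intro k
      induction k with
      | zero => simp
      | succ k ih => rw [pow_succ', Module.End.mul_apply, ih, map_smul, hv, smul_smul, pow_succ]
    have h := hk d
    rw [homologyMap_deck_pow, Module.End.one_apply] at h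
    have h2 : (μ ^ d - 1) • v = 0 := by rw [sub_smul, one_smul, ← h, sub_self]
    exact (smul_eq_zero.1 h2).resolve_left (sub_ne_zero.2 hμ)
  rw [this, finrank_bot]

theorem eq_of_rootMultiplicity_eq {p q : ℂ[X]} (hp : p.Monic) (hq : q.Monic)
    (h : ∀ μ, p.rootMultiplicity μ = q.rootMultiplicity μ) : p = q := by
  classical
  rw [(IsAlgClosed.splits p).eq_prod_roots_of_monic hp, (IsAlgClosed.splits q).eq_prod_roots_of_monic hq]
  congr 2
  ext μ
  rw [count_roots, count_roots, h]

theorem charpoly_homologyMap_mul (hd : 0 < d) (habc : a + b + c = d)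
    (hg : Nat.gcd (Nat.gcd a b) (Nat.gcd c d) = 1) [Module.Finite ℂ (H1 (FunctionRing a b d))] :
    (homologyMap (deck a b d)).charpoly *
      ((X ^ Nat.gcd a d - 1) * (X ^ Nat.gcd b d - 1) * (X ^ Nat.gcd c d - 1)) =
      (X ^ d - 1) * (X - 1) ^ 2 := by
  classical
  have hpos : ∀ n, 0 < Nat.gcd n d := fun n => Nat.gcd_pos_of_pos_right n hd
  have hm : ∀ {n : ℕ}, 0 < n → (X ^ n - 1 : ℂ[X]).Monic := fun {n} hn =>
    (monic_X_pow_sub_C 1 hn.ne' : (X ^ n - C 1 : ℂ[X]).Monic)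
  have hm1 : (X - 1 : ℂ[X]).Monic := by simpa using hm one_pos
  have hc := (homologyMap (deck a b d)).charpoly_monic
  have hABC := ((hm (hpos a)).mul (hm (hpos b))).mul (hm (hpos c))
  refine eq_of_rootMultiplicity_eq (hc.mul hABC) ((hm hd).mul (hm1.pow 2)) fun μ => ?_
  have h1 : (X - 1 : ℂ[X]).rootMultiplicity μ = if μ = 1 then 1 else 0 := by
    simpa using rootMultiplicity_X_pow_sub_one one_pos μ
  rw [rootMultiplicity_mul (hc.mul hABC).ne_zero, rootMultiplicity_mul hABC.ne_zero,
    rootMultiplicity_mul ((hm (hpos a)).mul (hm (hpos b))).ne_zero,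
    rootMultiplicity_mul ((hm hd).mul (hm1.pow 2)).ne_zero, pow_two,
    rootMultiplicity_mul (hm1.mul hm1).ne_zero, rootMultiplicity_X_pow_sub_one (hpos a),
    rootMultiplicity_X_pow_sub_one (hpos b), rootMultiplicity_X_pow_sub_one (hpos c),
    rootMultiplicity_X_pow_sub_one hd, h1]
  have : NeZero d := ⟨hd.ne'⟩
  by_cases hμ : μ ^ d = 1
  · obtain ⟨j, -, rfl⟩ := (omega_isPrimitiveRoot hd).eq_pow_of_pow_eq_one hμ
    rw [rootMultiplicity_charpoly_homologyMap hd]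
    have hprod : (omega d ^ j) ^ a * (omega d ^ j) ^ b * (omega d ^ j) ^ c = 1 := by
      rw [← pow_add, ← pow_add, habc, hμ]
    have hgen : (∀ i : Cusp, (omega d ^ j) ^ i.g a b d ≠ 1) ↔ (omega d ^ j) ^ a ≠ 1 ∧
        (omega d ^ j) ^ b ≠ 1 ∧ (omega d ^ j) ^ c ≠ 1 := by
      have hab : (omega d ^ j) ^ (a + b) = 1 ↔ (omega d ^ j) ^ c = 1 := by
        rw [← pow_add] at hprod
        constructor <;> intro h
        · rwa [h, one_mul] at hprod
        · rwa [h, mul_one] at hprod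
      constructor
      · intro h
        have h0 := h .zero
        have h1 := h .one
        have h2 := h .infty
        rw [Cusp.g_zero, ne_eq, Cusp.pow_gcd_eq_one_iff hμ] at h0
        rw [Cusp.g_one, ne_eq, Cusp.pow_gcd_eq_one_iff hμ] at h1
        rw [Cusp.g_infty, ne_eq, Cusp.pow_gcd_eq_one_iff hμ, hab] at h2
        exact ⟨h0, h1, h2⟩
      · rintro ⟨h0, h1, h2⟩ i
        cases i
        · rwa [Cusp.g_zero, ne_eq, Cusp.pow_gcd_eq_one_iff hμ]
        · rwa [Cusp.g_one, ne_eq, Cusp.pow_gcd_eq_one_iff hμ]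
        · rwa [Cusp.g_infty, ne_eq, Cusp.pow_gcd_eq_one_iff hμ, hab]
    -- two of the three powers can only be trivial together, and then the root is `1`
    have hone : (omega d ^ j) ^ a = 1 → (omega d ^ j) ^ b = 1 → (omega d ^ j) ^ c = 1 →
        omega d ^ j = 1 := fun ha hb hc => by
      have h := pow_gcd_eq_one.2 ⟨pow_gcd_eq_one.2 ⟨ha, hb⟩, pow_gcd_eq_one.2 ⟨hc, hμ⟩⟩
      rwa [hg, pow_one] at h
    have hone' : omega d ^ j = 1 → (omega d ^ j) ^ a = 1 ∧ (omega d ^ j) ^ b = 1 ∧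
        (omega d ^ j) ^ c = 1 := fun h => by simp [h]
    simp only [hgen, Cusp.pow_gcd_eq_one_iff hμ, hμ, if_true]
    by_cases ha : (omega d ^ j) ^ a = 1 <;> by_cases hb : (omega d ^ j) ^ b = 1 <;>
      by_cases hc : (omega d ^ j) ^ c = 1 <;> by_cases h1 : omega d ^ j = 1 <;>
      simp only [ha, hb, hc, mul_one, one_mul] at hprod hone hone' <;>
      first
        | exact absurd hprod ‹_›
        | exact absurd (hone' h1).1 ha
        | exact absurd (hone' h1).2.1 hb
        | exact absurd (hone' h1).2.2 hc
        | exact absurd (hone trivial trivial trivial) h1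
        | simp [ha, hb, hc, h1]
  · have hn : ∀ n, μ ^ Nat.gcd n d ≠ 1 := fun n h => by
      obtain ⟨m, hm⟩ := Nat.gcd_dvd_right n d
      exact hμ (by rw [hm, pow_mul, h, one_pow])
    have hμ1 : μ ≠ 1 := by rintro rfl; exact hμ (one_pow d)
    rw [rootMultiplicity_charpoly_homologyMap_of_pow_ne_one hd hμ]
    simp [hn, hμ, hμ1]

end Roots

end BelyiCover
end

theorem mainTheorem7 (a b c d : ℕ) (hd : 0 < d) (habc : a + b + c = d) :
    (∃ _ : Module.Finite ℂ (BelyiCover.holomorphicForms (BelyiCover.FunctionRing a b d)),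
      ∀ j : ℤ, ∀ m : ℕ,
        m = (BelyiCover.pullbackHolomorphic (BelyiCover.deck a b d)).charpoly.rootMultiplicity
          (Complex.exp (2 * Real.pi * Complex.I * j / d)) →
        (¬ ((d : ℤ) ∣ a * j ∧ (d : ℤ) ∣ b * j) →
          (m : ℤ) = -(⌊-((a * j : ℚ) / d)⌋ + ⌊-((b * j : ℚ) / d)⌋ +
            ⌊((a + b) * j : ℚ) / d⌋ + 1)) ∧
        ((d : ℤ) ∣ a * j ∧ (d : ℤ) ∣ b * j → m = 0) ∧
        (m = 0 ∨ m = 1)) ∧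
    (Nat.gcd (Nat.gcd a b) (Nat.gcd c d) = 1 →
      ∃ _ : Module.Finite ℂ (BelyiCover.H1 (BelyiCover.FunctionRing a b d)),
        (BelyiCover.homologyMap (BelyiCover.deck a b d)).charpoly *
          ((Polynomial.X ^ Nat.gcd a d - 1) * (Polynomial.X ^ Nat.gcd b d - 1) *
            (Polynomial.X ^ Nat.gcd c d - 1)) =
          (Polynomial.X ^ d - 1) * (Polynomial.X - 1) ^ 2) := by
  refine ⟨⟨BelyiCover.finite_holomorphicForms hd, fun j m hm => ?_⟩, fun hg =>
    ⟨BelyiCover.finite_H1 hd, ?_⟩⟩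
  · have := BelyiCover.finite_holomorphicForms (a := a) (b := b) hd
    rw [BelyiCover.rootMultiplicity_holomorphicForms hd j] at hm
    have h1 := BelyiCover.multiplicity_le_one (a := a) (b := b) hd j
    refine ⟨fun h => ?_, fun h => ?_, ?_⟩
    · have h0 := BelyiCover.multiplicity_nonneg (a := a) (b := b) hd j h
      rw [← BelyiCover.multiplicity_eq_floor, hm]
      split_ifs <;> push_cast <;> omega
    · rw [hm, BelyiCover.multiplicity_of_dvd hd j h]
      rfl
    · rw [hm]
      split_ifs <;> simp
  · have := BelyiCover.finite_H1 (a := a) (b := b) hd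
    exact BelyiCover.charpoly_homologyMap_mul hd habc hg
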